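/- Let $0<q<1$ and $z_-<0<z_+$, and put $\mathbb R_q=\mathbb R_q^-\cup\mathbb R_q^+$ with $\mathbb R_q^\pm=\{z_\pm q^n : n\in\mathbb Z\}$. Write $(x;q)_\infty=\prod_{k\ge 0}(1-xq^k)$, $\theta(x)=(x;q)_\infty(q/x;q)_\infty$, with $(x_1,\dots,x_m;q)_\infty=\prod_i(x_i;q)_\infty$ and $\theta(x_1,\dots,x_m)=\prod_i\theta(x_i)$; ${}_3\phi_2$ denotes the usual basic hypergeometric series. Parameters. A pair $(\alpha,\beta)\in\mathbb C^2$ is called admissible if $\alpha,\beta\notin z_\pm^{-1}q^{\mathbb Z}$ and either $\alpha=\overline\beta$, or $\alpha,\beta$ are real and for some $k\in\mathbb Z$ one has $z_+q^{k}<\beta^{-1}<\alpha^{-1}<z_+q^{k-1}$ or $z_-q^{k-1}<\alpha^{-1}<\beta^{-1}<z_-q^{k}$. Let $(a,b)$ and $(c,d)$ be admissible with $a\ne b$, $c\neq d$ and $c/a,\,c/b,\,d/a,\,d/b,\,cd/ab\notin q^{\mathbb Z}$. Put $s=\sqrt{cdq/ab}>0$. Operator. For $f:\mathbb R_q\to\mathbb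 C$ let $(Lf)(x)=A(x)f(x/q)+B(x)f(qx)+C(x)f(x)$, where $$A(x)=s^{-1}\Big(1-\frac q{ax}\Big)\Big(1-\frac q{bx}\Big),\quad B(x)=s\Big(1-\frac1{cx}\Big)\Big(1-\frac1{dx}\Big),\quad C=s^{-1}+s-A-B,$$ and let $(D_qf)(x)=\frac{f(x)-f(qx)}{(1-q)x}$. For $\mu\in\mathbb C$ let $V_\mu$ be the space of $f:\mathbb R_q\to\mathbb C$ with $Lf=\mu f$ such that the limits of $f$ and of $D_qf$ along $z_+q^k$ and along $z_-q^k$ ($k\to\infty$) exist, with $f(0^-)=f(0^+)$ and $(D_qf)(0^-)=(D_qf)(0^+)$. Put $$w(x)=\frac{(ax,bx;q)_\infty}{(cx,dx;q)_\infty},\quad u(x)=(1-q)^2B(x)x^2w(x),\quad D(f,g)(x)=\big(f(x)g(qx)-f(qx)g(x)\big)\frac{u(x)}{(1-q)x}.$$ Asymptotic solutions. Let $\mu(\gamma)=\gamma+\gamma^{-1}$ and $\mathcal S_{\mathrm{reg}}=\mathbb C^*\setminus\{\pm q^{k/2}: k\in\mathbb Z\}$. For $x=zq^{-k}$ with $z\in\{z_-,z_+\}$,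 $k\in\mathbb Z$ and $|x|>q/|b|$ put $$\Phi_\gamma(x)=(s\gamma)^k\,\frac{(q/bx,\;q^2\gamma/asx;q)_\infty}{(q/cx,\;q/dx;q)_\infty}\;{}_3\phi_2\!\left(\begin{matrix} q\gamma/s,\;cq\gamma/sa,\;dq\gamma/sa\\ q^2\gamma/asx,\;q\gamma^2\end{matrix};q,\frac q{bx}\right)$$ whenever $q^2\gamma/asx\notin\{q^{-n}:n\ge0\}$. Theorem. For every $\gamma\in\mathcal S_{\mathrm{reg}}$ there are functions $\Phi^+_\gamma,\Phi^-_\gamma:\mathbb R_q\to\mathbb C$, depending continuously on $\gamma\in\mathcal S_{\mathrm{reg}}$ at each fixed point of $\mathbb R_q$, with the following properties. (a) $\Phi^\pm_\gamma\in V_{\mu(\gamma)}$, and $\Phi_\gamma^\pm$ is the unique element of $V_{\mu(\gamma)}$ that coincides with $\Phi_\gamma$ at all $x\in\mathbb R_q^\pm$ with $|x|>q/|b|$ at which $\Phi_\gamma(x)$ is defined by the formula above. (b) If $|\gamma|<1$, then $\sum_{k\in\mathbb Z}|\Phi^\pm_\gamma(z_\pm q^k)|^2\,w(z_\pm q^k)\,|z_\pm|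 q^k<\infty$; that is, the Jackson integrals $\int_{\infty(z_-)}^0|\Phi_\gamma^-(x)|^2w(x)\,d_qx$ and $\int_0^{\infty(z_+)}|\Phi_\gamma^+(x)|^2w(x)\,d_qx$ are finite. (c) The Casorati determinant $v(\gamma)=D(\Phi_\gamma^+,\Phi_\gamma^-)$ is constant on $\mathbb R_q$, and $$v(\gamma)=-\frac{z_+(1-q)\,\theta(z_- /z_+)}{\theta(cz_-,dz_-,cz_+,dz_+)}\cdot\frac{(cq\gamma/as,\;dq\gamma/as,\;cq\gamma/bs,\;dq\gamma/bs,\;s\gamma,\;q\gamma/s;q)_\infty\;\theta(absz_-z_+/q\gamma)}{\gamma\,(q\gamma^2;q)_\infty^2}.$$ -/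

import Mathlib

open Filter Topology

namespace BigQJacobi

noncomputable section

/-! ### q-shifted factorials, theta functions, basic hypergeometric series -/

/-- The infinite q-shifted factorial `(x;q)_∞ = ∏_{k ≥ 0} (1 - x q^k)`. -/
def qPochInf (q : ℝ) (x : ℂ) : ℂ := ∏' k : ℕ, (1 - x * (q : ℂ) ^ k)

/-- The finite q-shifted factorial `(x;q)_n = ∏_{k < n} (1 - x q^k)`. -/
def qPoch (q : ℝ) (x : ℂ) (n : ℕ) : ℂ := ∏ k ∈ Finset.range n, (1 - x * (q : ℂ) ^ k)

/-- The normalized Jacobi theta function `θ(x) = (x, q/x; q)_∞`. -/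
def theta (q : ℝ) (x : ℂ) : ℂ := qPochInf q x * qPochInf q ((q : ℂ) / x)

/-- The basic hypergeometric series `₃φ₂(x₁, x₂, x₃; y₁, y₂; q, z)`. -/
def phi32 (q : ℝ) (x₁ x₂ x₃ y₁ y₂ z : ℂ) : ℂ :=
  ∑' n : ℕ, qPoch q x₁ n * qPoch q x₂ n * qPoch q x₃ n /
    (qPoch q (q : ℂ) n * qPoch q y₁ n * qPoch q y₂ n) * z ^ n

/-! ### The q-analogue of the real line -/

/-- The data `0 < q < 1`, `z₋ < 0 < z₊` defining the q-line. -/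
structure QLine where
  q : ℝ
  zp : ℝ
  zm : ℝ
  q_pos : 0 < q
  q_lt_one : q < 1
  zp_pos : 0 < zp
  zm_neg : zm < 0

/-- The four complex parameters `a, b, c, d`. -/
structure Params where
  a : ℂ
  b : ℂ
  c : ℂ
  d : ℂ

namespace QLine

variable (R : QLine)

/-- `z₊` for `true`, `z₋` for `false`. -/
def z (ε : Bool) : ℝ := if ε then R.zp else R.zm

/-- `ℝ_q = {z₊ q^n : n ∈ ℤ} ∪ {z₋ q^n : n ∈ ℤ}`, a subset of `ℝ`. -/
def Rq : Set ℝ := {x | ∃ (ε : Bool) (n : ℤ), x = R.z ε * R.q ^ n}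

/-- The point `z_ε q^n` of `ℝ_q`. -/
def pt (ε : Bool) (n : ℤ) : R.Rq := ⟨R.z ε * R.q ^ n, ε, n, rfl⟩

/-- The map `x ↦ x q^m` of `ℝ_q` to itself. -/
def shift (m : ℤ) (x : R.Rq) : R.Rq :=
  ⟨(x : ℝ) * R.q ^ m, by
    obtain ⟨ε, n, h⟩ := x.2
    exact ⟨ε, n + m, by rw [h, zpow_add₀ R.q_pos.ne', mul_assoc]⟩⟩

/-! ### Parameter domains -/

/-- The set `P_{q,z₋,z₊}` of admissible pairs `(α, β)`. -/
def PairAdmissible (α β : ℂ) : Prop :=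
  (∀ (ε : Bool) (n : ℤ), α ≠ (R.z ε : ℂ)⁻¹ * (R.q : ℂ) ^ n ∧ β ≠ (R.z ε : ℂ)⁻¹ * (R.q : ℂ) ^ n) ∧
  (α = (starRingEnd ℂ) β ∨
    (∃ (r t : ℝ) (k : ℤ), α = r ∧ β = t ∧
      R.zp * R.q ^ k < t⁻¹ ∧ t⁻¹ < r⁻¹ ∧ r⁻¹ < R.zp * R.q ^ (k - 1)) ∨
    (∃ (r t : ℝ) (k : ℤ), α = r ∧ β = t ∧
      R.zm * R.q ^ (k - 1) < r⁻¹ ∧ r⁻¹ < t⁻¹ ∧ t⁻¹ < R.zm * R.q ^ k))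

/-- The parameter domain `P`. -/
def InP (p : Params) : Prop :=
  R.PairAdmissible p.a p.b ∧ R.PairAdmissible p.c p.d ∧ p.a ≠ p.b

/-- The generic parameter domain `P_gen`. -/
def InPgen (p : Params) : Prop :=
  R.InP p ∧ p.c ≠ p.d ∧
    ∀ n : ℤ, p.c / p.a ≠ (R.q : ℂ) ^ n ∧ p.c / p.b ≠ (R.q : ℂ) ^ n ∧
      p.d / p.a ≠ (R.q : ℂ) ^ n ∧ p.d / p.b ≠ (R.q : ℂ) ^ n ∧
      p.c * p.d / (p.a * p.b) ≠ (R.q : ℂ) ^ n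

/-- The regular spectral values `ℂ^* \ {± q^{k/2} : k ∈ ℤ}`. -/
def Sreg : Set ℂ :=
  {γ | γ ≠ 0 ∧ ∀ k : ℤ, γ ≠ ((R.q ^ ((k : ℝ) / 2) : ℝ) : ℂ) ∧ γ ≠ -((R.q ^ ((k : ℝ) / 2) : ℝ) : ℂ)}

/-! ### The difference operator, its eigenspaces, the Casorati determinant -/

variable (p : Params)

/-- `s = √(cdq/ab)`, principal branch. -/
def s : ℂ := (p.c * p.d * R.q / (p.a * p.b)) ^ (1 / 2 : ℂ)

def A (x : ℝ) : ℂ := (R.s p)⁻¹ * (1 - R.q / (p.a * x)) * (1 - R.q / (p.b * x))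

def B (x : ℝ) : ℂ := R.s p * (1 - 1 / (p.c * x)) * (1 - 1 / (p.d * x))

def C (x : ℝ) : ℂ := (R.s p)⁻¹ + R.s p - R.A p x - R.B p x

/-- The operator `(L f)(x) = A(x) f(x/q) + B(x) f(qx) + C(x) f(x)` on functions on `ℝ_q`. -/
def L (f : R.Rq → ℂ) (x : R.Rq) : ℂ :=
  R.A p x * f (R.shift (-1) x) + R.B p x * f (R.shift 1 x) + R.C p x * f x

/-- The eigenvalue `μ(γ) = γ + γ⁻¹`. -/
def mu (γ : ℂ) : ℂ := γ + γ⁻¹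

/-- The q-derivative `(D_q f)(x) = (f(x) - f(qx)) / ((1-q)x)`. -/
def Dq (f : R.Rq → ℂ) (x : R.Rq) : ℂ :=
  (f x - f (R.shift 1 x)) / (((x : ℝ) : ℂ) * (1 - R.q))

/-- `f(0⁻)` and `f(0⁺)` exist and are equal. -/
def MatchAtZero (f : R.Rq → ℂ) : Prop :=
  ∃ l : ℂ, ∀ ε : Bool, Tendsto (fun k : ℕ => f (R.pt ε k)) atTop (𝓝 l)

/-- The eigenspace `V_μ`: solutions on `ℝ_q` of `L f = μ f` with `f(0⁻) = f(0⁺)` and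
`f'(0⁻) = f'(0⁺)`. -/
def V (m : ℂ) : Set (R.Rq → ℂ) :=
  {f | (∀ x, R.L p f x = m * f x) ∧ R.MatchAtZero f ∧ R.MatchAtZero (R.Dq f)}

/-- The weight `w(x) = (ax, bx; q)_∞ / (cx, dx; q)_∞`. -/
def w (x : ℝ) : ℂ :=
  qPochInf R.q (p.a * x) * qPochInf R.q (p.b * x) /
    (qPochInf R.q (p.c * x) * qPochInf R.q (p.d * x))

/-- `u(x) = (1-q)² B(x) x² w(x)`. -/
def u (x : ℝ) : ℂ := (1 - (R.q : ℂ)) ^ 2 * R.B p x * (x : ℂ) ^ 2 * R.w p x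

/-- The Casorati determinant `D(f,g)(x) = (f(x) g(qx) - f(qx) g(x)) u(x) / ((1-q)x)`. -/
def casorati (f g : R.Rq → ℂ) (x : R.Rq) : ℂ :=
  (f x * g (R.shift 1 x) - f (R.shift 1 x) * g x) *
    (R.u p x / ((1 - (R.q : ℂ)) * ((x : ℝ) : ℂ)))

/-- Absolute convergence of the Jackson integral of `f` over the half-line through `z_ε`. -/
def JacksonIntegrable (ε : Bool) (f : R.Rq → ℂ) : Prop :=
  Summable fun k : ℤ => ‖f (R.pt ε k) * ((R.pt ε k : ℝ) : ℂ)‖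

/-! ### Asymptotic solutions -/

/-- The value at `x = z_ε q^{-k}` of the asymptotic solution
`(sγ)^k (q/bx, q²γ/asx; q)_∞ / (q/cx, q/dx; q)_∞ ₃φ₂(qγ/s, cqγ/sa, dqγ/sa; q²γ/asx, qγ²; q, q/bx)`. -/
def PhiFormula (ε : Bool) (γ : ℂ) (k : ℤ) : ℂ :=
  let q : ℂ := R.q;
  let s : ℂ := R.s p;
  let x : ℂ := ((R.pt ε (-k) : ℝ) : ℂ);
  (s * γ) ^ k *
    (qPochInf R.q (q / (p.b * x)) * qPochInf R.q (q ^ 2 * γ / (p.a * s * x)) /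
      (qPochInf R.q (q / (p.c * x)) * qPochInf R.q (q / (p.d * x)))) *
    phi32 R.q (q * γ / s) (p.c * q * γ / (s * p.a)) (p.d * q * γ / (s * p.a))
      (q ^ 2 * γ / (p.a * s * x)) (q * γ ^ 2) (q / (p.b * x))

/-- `f ∈ V_{μ(γ)}` extends the asymptotic solution on the half-line through `z_ε`: it is given by
the explicit formula at all `x = z_ε q^{-k}` with `|x| > q/|b|` at which the series is
defined, that is, `q²γ/asx ∉ {q^{-n} : n ∈ ℕ}` (only finitely many such `x` are excluded, none
for generic `γ`). -/
def IsExtendedAsymptoticSolution (ε : Bool) (γ : ℂ) (f : R.Rq → ℂ) : Prop :=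
  f ∈ R.V p (mu γ) ∧
  ∀ k : ℤ, R.q / ‖p.b‖ < |(R.pt ε (-k) : ℝ)| →
    (∀ n : ℕ, (R.q : ℂ) ^ 2 * γ / (p.a * R.s p * ((R.pt ε (-k) : ℝ) : ℂ)) * (R.q : ℂ) ^ n ≠ 1) →
    f (R.pt ε (-k)) = R.PhiFormula p ε γ k

/-- The explicit value of `v(γ)`. -/
def v (γ : ℂ) : ℂ :=
  let q : ℂ := R.q;
  let s : ℂ := R.s p;
  let zp : ℂ := R.zp;
  let zm : ℂ := R.zm;
  (-(zp * (1 - q) * theta R.q (zm / zp)) /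
      (theta R.q (p.c * zm) * theta R.q (p.d * zm) * theta R.q (p.c * zp) * theta R.q (p.d * zp))) *
    (qPochInf R.q (p.c * q * γ / (p.a * s)) * qPochInf R.q (p.d * q * γ / (p.a * s)) *
      qPochInf R.q (p.c * q * γ / (p.b * s)) * qPochInf R.q (p.d * q * γ / (p.b * s)) *
      qPochInf R.q (s * γ) * qPochInf R.q (q * γ / s) *
      theta R.q (p.a * p.b * s * zm * zp / (q * γ)) /
      (γ * qPochInf R.q (q * γ ^ 2) ^ 2))

end QLine

end

end BigQJacobi

/-!
Write `x = z_ε q^n` for the points of a half-line of `ℝ_q`. The equation `Lf = μf` becomes on each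
half-line a three-term recurrence in `n` with nonvanishing coefficients, so that a solution is
determined by two consecutive values, and the Casorati determinant of two solutions is constant
(`hcas_const`).

*Behaviour at the origin.* As `n → ∞` the recurrence, written for the pair `(f, D_q f)`, has
relative increments `O(q^n)` (`exists_slow`). Hence every solution has *data at the origin*, the
limits of `f` and `D_q f` (`exists_data`), and the Casorati determinant is a constant times the
determinant of the data (`hcas_eq_of_data`). A solution is therefore determined by its data, and
solutions with prescribed data exist, holomorphically in `γ` (`exists_sol_of_data`). An element of
`V_μ` is a pair of solutions, one on each half-line, with common data; it is determined by its
restriction to one of the half-lines, and every solution on one half-line extends to it.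

*The asymptotic solution.* After multiplication by `(q²γ/asx, qγ²;q)_∞` the `₃φ₂` series is entire
in `γ`. A telescoping identity between its terms shows that it solves the recurrence where it
converges (`phiSol_recurrence`); the recurrence continues it to the half-line (`exists_extension`),
and the data at the origin give the function on the other half-line. Part (b) compares the
asymptotics `Φ ∼ (sγ)^k` and `w ∼ const·(q/s²)^k` at `z q^{-k}` (`summable_of_tendsto`).

*The Casorati determinant.* Both sides of the formula for `v(γ)` are holomorphic on the connected
set `S_reg`, so that it suffices to treat small `γ` (`det_eq_v`). There a second representation of
the solution is available, the convolution `conv` of the general term of a bilateral series with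
a `q`-binomial kernel: it solves the recurrence (`conv_recurrence`) and has the same asymptotics up
to a factor (`tendsto_conv_neg`), so it is a multiple of the asymptotic solution, since for
`|γ| < 1` the recessive solution is unique up to a factor (`IsHalfSol.eq_mul_of_tendsto`). In this
representation the data at the origin are the moments `0` and `1` of the bilateral series, and
`v(γ)` is a `2 × 2` determinant of moments at the base points `1/z_+` and `1/z_-`. Up to an
explicit factor, the determinant is unchanged when one of the four parameters of the bilateral
series is multiplied by `q` (`bilDet_step_left`, `bilDet_step_right`). Iterating, all parameters
become `0`, and what remains is a determinant of theta series of degree two, which Jacobi's triple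
product evaluates (`bilDet_zero`). The result is the product formula `bilDet_eq`.
-/

namespace BigQJacobi

/-! ### q-shifted factorials -/

section QPochhammer

variable {q : ℝ}

lemma qPoch_succ (q : ℝ) (x : ℂ) (n : ℕ) :
    qPoch q x (n + 1) = qPoch q x n * (1 - x * (q : ℂ) ^ n) := by
  simp [qPoch, Finset.prod_range_succ]

lemma qPoch_succ' (q : ℝ) (x : ℂ) (n : ℕ) :
    qPoch q x (n + 1) = (1 - x) * qPoch q (x * q) n := by
  simp only [qPoch, Finset.prod_range_succ']
  rw [mul_comm]
  congr 1
  · simp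
  · exact Finset.prod_congr rfl fun k _ => by ring

lemma multipliable_qPochInf (h0 : 0 < q) (h1 : q < 1) (x : ℂ) :
    Multipliable fun k : ℕ => 1 - x * (q : ℂ) ^ k := by
  have : Summable fun k : ℕ => ‖-(x * (q : ℂ) ^ k)‖ := by
    simp only [norm_neg, norm_mul, norm_pow, Complex.norm_real, Real.norm_eq_abs, abs_of_pos h0]
    exact (summable_geometric_of_lt_one h0.le h1).mul_left _
  simpa [sub_eq_add_neg] using multipliable_one_add_of_summable this

lemma tendsto_qPoch (h0 : 0 < q) (h1 : q < 1) (x : ℂ) :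
    Tendsto (qPoch q x) atTop (𝓝 (qPochInf q x)) :=
  (multipliable_qPochInf h0 h1 x).hasProd.tendsto_prod_nat

lemma qPochInf_eq (h0 : 0 < q) (h1 : q < 1) (x : ℂ) :
    qPochInf q x = (1 - x) * qPochInf q (x * q) := by
  refine tendsto_nhds_unique ((tendsto_add_atTop_iff_nat 1).2 (tendsto_qPoch h0 h1 x)) ?_
  simp only [qPoch_succ']
  exact (tendsto_qPoch h0 h1 _).const_mul _

lemma qPoch_mul_qPochInf (h0 : 0 < q) (h1 : q < 1) (x : ℂ) (n : ℕ) :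
    qPoch q x n * qPochInf q (x * (q : ℂ) ^ n) = qPochInf q x := by
  induction n with
  | zero => simp [qPoch]
  | succ n ih =>
    rw [← ih, qPoch_succ, qPochInf_eq h0 h1 (x * (q : ℂ) ^ n), pow_succ]
    ring_nf

lemma qPochInf_zero (q : ℝ) : qPochInf q 0 = 1 := by simp [qPochInf]

lemma qPochInf_eq_zero (h0 : 0 < q) (h1 : q < 1) {x : ℂ} {n : ℕ} (h : x * (q : ℂ) ^ n = 1) :
    qPochInf q x = 0 := by
  rw [← qPoch_mul_qPochInf h0 h1 x (n + 1), qPoch_succ, h]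
  simp

lemma qPochInf_ne_zero (h0 : 0 < q) (h1 : q < 1) {x : ℂ} (h : ∀ n : ℕ, x * (q : ℂ) ^ n ≠ 1) :
    qPochInf q x ≠ 0 := by
  have hs : Summable fun k : ℕ => ‖-(x * (q : ℂ) ^ k)‖ := by
    simp only [norm_neg, norm_mul, norm_pow, Complex.norm_real, Real.norm_eq_abs, abs_of_pos h0]
    exact (summable_geometric_of_lt_one h0.le h1).mul_left _
  have := tprod_one_add_ne_zero_of_summable (f := fun k : ℕ => -(x * (q : ℂ) ^ k))
    (fun k => by rw [← sub_eq_add_neg]; exact sub_ne_zero.2 (h k).symm) hs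
  simpa [qPochInf, sub_eq_add_neg] using this

lemma qPoch_ne_zero {x : ℂ} (h : ∀ n : ℕ, x * (q : ℂ) ^ n ≠ 1) (n : ℕ) : qPoch q x n ≠ 0 :=
  Finset.prod_ne_zero_iff.2 fun k _ => sub_ne_zero.2 (h k).symm

lemma ofReal_ne_zero (h0 : 0 < q) : (q : ℂ) ≠ 0 := by exact_mod_cast h0.ne'

lemma norm_q (h0 : 0 < q) : ‖(q : ℂ)‖ = q := by
  rw [Complex.norm_real, Real.norm_eq_abs, abs_of_pos h0]

lemma mul_pow_ne_one_of_norm_lt_one (h0 : 0 < q) (h1 : q < 1) {x : ℂ} (hx : ‖x‖ < 1) (n : ℕ) :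
    x * (q : ℂ) ^ n ≠ 1 := by
  intro h
  have : ‖x * (q : ℂ) ^ n‖ < 1 := by
    rw [norm_mul, norm_pow, norm_q h0]
    calc ‖x‖ * q ^ n ≤ ‖x‖ * 1 := by
          gcongr
          exact pow_le_one₀ h0.le h1.le
      _ < 1 := by simpa
  rw [h] at this
  simp at this

lemma qPochInf_ne_zero_of_norm_lt_one (h0 : 0 < q) (h1 : q < 1) {x : ℂ} (hx : ‖x‖ < 1) :
    qPochInf q x ≠ 0 :=
  qPochInf_ne_zero h0 h1 (mul_pow_ne_one_of_norm_lt_one h0 h1 hx)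

lemma qPochInf_q_ne_zero (h0 : 0 < q) (h1 : q < 1) : qPochInf q (q : ℂ) ≠ 0 :=
  qPochInf_ne_zero_of_norm_lt_one h0 h1 (by rwa [norm_q h0])

lemma qPoch_q_ne_zero (h0 : 0 < q) (h1 : q < 1) (n : ℕ) : qPoch q (q : ℂ) n ≠ 0 :=
  qPoch_ne_zero (mul_pow_ne_one_of_norm_lt_one h0 h1 (by rwa [norm_q h0])) n

/-- The majorant `(-r;q)_∞ = ∏_{k ≥ 0} (1 + r q^k)` of all `(x;q)_n` and `(x;q)_∞` with
`|x| ≤ r`. -/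
noncomputable def qMaj (q r : ℝ) : ℝ := ‖qPochInf q (-(r : ℂ))‖

lemma norm_one_add_mul_pow (h0 : 0 < q) {r : ℝ} (hr : 0 ≤ r) (k : ℕ) :
    ‖1 - -(r : ℂ) * (q : ℂ) ^ k‖ = 1 + r * q ^ k := by
  have : (1 : ℂ) - -(r : ℂ) * (q : ℂ) ^ k = ((1 + r * q ^ k : ℝ) : ℂ) := by push_cast; ring
  rw [this, Complex.norm_real, Real.norm_eq_abs, abs_of_nonneg (by positivity)]

lemma norm_qPoch_le_norm (h0 : 0 < q) {x : ℂ} {r : ℝ} (hx : ‖x‖ ≤ r) (n : ℕ) :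
    ‖qPoch q x n‖ ≤ ‖qPoch q (-(r : ℂ)) n‖ := by
  have hr : 0 ≤ r := (norm_nonneg x).trans hx
  simp only [qPoch, norm_prod]
  refine Finset.prod_le_prod (fun _ _ => norm_nonneg _) fun k _ => ?_
  rw [norm_one_add_mul_pow h0 hr]
  calc ‖1 - x * (q : ℂ) ^ k‖ ≤ ‖(1 : ℂ)‖ + ‖x * (q : ℂ) ^ k‖ := norm_sub_le _ _
    _ = 1 + ‖x‖ * q ^ k := by rw [norm_mul, norm_pow, norm_q h0, norm_one]
    _ ≤ 1 + r * q ^ k := by gcongr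

lemma norm_qPochInf_le (h0 : 0 < q) (h1 : q < 1) {x : ℂ} {r : ℝ} (hx : ‖x‖ ≤ r) :
    ‖qPochInf q x‖ ≤ qMaj q r :=
  le_of_tendsto_of_tendsto' (tendsto_qPoch h0 h1 x).norm (tendsto_qPoch h0 h1 _).norm
    fun n => norm_qPoch_le_norm h0 hx n

lemma norm_qPoch_le (h0 : 0 < q) (h1 : q < 1) {x : ℂ} {r : ℝ} (hx : ‖x‖ ≤ r) (n : ℕ) :
    ‖qPoch q x n‖ ≤ qMaj q r := by
  have hr : 0 ≤ r := (norm_nonneg x).trans hx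
  have hmono : Monotone fun n => ‖qPoch q (-(r : ℂ)) n‖ := by
    refine monotone_nat_of_le_succ fun n => ?_
    rw [qPoch_succ, norm_mul, norm_one_add_mul_pow h0 hr]
    exact le_mul_of_one_le_right (norm_nonneg _) (by linarith [show 0 ≤ r * q ^ n by positivity])
  exact (norm_qPoch_le_norm h0 hx n).trans
    (hmono.ge_of_tendsto (tendsto_qPoch h0 h1 _).norm n)

lemma qMaj_nonneg (q r : ℝ) : 0 ≤ qMaj q r := norm_nonneg _

/-- Telescoping form of the infinite product, the source of its analyticity in `x`. -/
lemma one_add_tsum_eq_qPochInf (h0 : 0 < q) (h1 : q < 1) (x : ℂ) :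
    1 + ∑' n : ℕ, -(x * (q : ℂ) ^ n) * qPoch q x n = qPochInf q x := by
  have hs : Summable fun n : ℕ => -(x * (q : ℂ) ^ n) * qPoch q x n := by
    refine Summable.of_norm_bounded (g := fun n => ‖x‖ * q ^ n * qMaj q ‖x‖)
      (((summable_geometric_of_lt_one h0.le h1).mul_left _).mul_right _) fun n => ?_
    rw [norm_mul, norm_neg, norm_mul, norm_pow, norm_q h0]
    gcongr
    exact norm_qPoch_le h0 h1 le_rfl n
  have h : ∀ n, 1 + ∑ k ∈ Finset.range n, -(x * (q : ℂ) ^ k) * qPoch q x k = qPoch q x n := by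
    intro n
    induction n with
    | zero => simp [qPoch]
    | succ n ih => rw [Finset.sum_range_succ, ← add_assoc, ih, qPoch_succ]; ring
  refine tendsto_nhds_unique (hs.hasSum.tendsto_sum_nat.const_add 1) ?_
  simp only [h]
  exact tendsto_qPoch h0 h1 x

lemma differentiable_qPoch (q : ℝ) (n : ℕ) : Differentiable ℂ fun x => qPoch q x n := by
  unfold qPoch
  fun_prop

lemma differentiable_qPochInf (h0 : 0 < q) (h1 : q < 1) : Differentiable ℂ (qPochInf q) := by
  intro x
  have hopen : IsOpen (Metric.ball (0 : ℂ) (‖x‖ + 1)) := Metric.isOpen_ball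
  have hd : DifferentiableOn ℂ (fun y => ∑' n : ℕ, -(y * (q : ℂ) ^ n) * qPoch q y n)
      (Metric.ball (0 : ℂ) (‖x‖ + 1)) := by
    refine Complex.differentiableOn_tsum_of_summable_norm
      (u := fun n => (‖x‖ + 1) * q ^ n * qMaj q (‖x‖ + 1))
      (((summable_geometric_of_lt_one h0.le h1).mul_left _).mul_right _) (fun n => ?_) hopen
      fun n y hy => ?_
    · exact Differentiable.differentiableOn ((by fun_prop : Differentiable ℂ fun y : ℂ =>
        -(y * (q : ℂ) ^ n)).mul (differentiable_qPoch q n))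
    · have hy' : ‖y‖ ≤ ‖x‖ + 1 := by
        simpa using (Metric.mem_ball.1 hy).le
      rw [norm_mul, norm_neg, norm_mul, norm_pow, norm_q h0]
      gcongr
      exact norm_qPoch_le h0 h1 hy' n
  have hx : x ∈ Metric.ball (0 : ℂ) (‖x‖ + 1) := by simp
  have := (hd.differentiableAt (hopen.mem_nhds hx)).const_add 1
  exact this.congr_of_eventuallyEq
    (Eventually.of_forall fun y => (one_add_tsum_eq_qPochInf h0 h1 y).symm)

lemma continuous_qPochInf (h0 : 0 < q) (h1 : q < 1) : Continuous (qPochInf q) :=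
  (differentiable_qPochInf h0 h1).continuous

lemma tendsto_qPochInf_one (h0 : 0 < q) (h1 : q < 1) {ι : Type*} {l : Filter ι} {f : ι → ℂ}
    (hf : Tendsto f l (𝓝 0)) : Tendsto (fun i => qPochInf q (f i)) l (𝓝 1) := by
  have := ((continuous_qPochInf h0 h1).tendsto 0).comp hf
  rwa [qPochInf_zero] at this

lemma tendsto_q_pow (h0 : 0 < q) (h1 : q < 1) :
    Tendsto (fun n : ℕ => (q : ℂ) ^ n) atTop (𝓝 0) :=
  tendsto_pow_atTop_nhds_zero_of_norm_lt_one (by rwa [norm_q h0])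

/-- Iteration of a first order q-difference equation, written for the values `F n` along
`q^n`, when the values converge. -/
lemma qPochInf_mul_eq_of_functional_eq₂ (h0 : 0 < q) (h1 : q < 1) {F : ℕ → ℂ} {u v w L : ℂ}
    (hF : ∀ n, (1 - u * (q : ℂ) ^ n) * F n =
      (1 - v * (q : ℂ) ^ n) * (1 - w * (q : ℂ) ^ n) * F (n + 1))
    (hL : Tendsto F atTop (𝓝 L)) :
    qPochInf q u * F 0 = qPochInf q v * qPochInf q w * L := by
  have h : ∀ n, qPoch q u n * F 0 = qPoch q v n * qPoch q w n * F n := by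
    intro n
    induction n with
    | zero => simp [qPoch]
    | succ n ih =>
      rw [qPoch_succ, qPoch_succ, qPoch_succ]
      linear_combination (1 - u * (q : ℂ) ^ n) * ih + qPoch q v n * qPoch q w n * hF n
  refine tendsto_nhds_unique ((tendsto_qPoch h0 h1 u).mul_const (F 0)) ?_
  simp only [h]
  exact ((tendsto_qPoch h0 h1 v).mul (tendsto_qPoch h0 h1 w)).mul hL

lemma qPochInf_mul_eq_of_functional_eq (h0 : 0 < q) (h1 : q < 1) {F : ℕ → ℂ} {u v L : ℂ}
    (hF : ∀ n, (1 - u * (q : ℂ) ^ n) * F n = (1 - v * (q : ℂ) ^ n) * F (n + 1))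
    (hL : Tendsto F atTop (𝓝 L)) : qPochInf q u * F 0 = qPochInf q v * L := by
  have := qPochInf_mul_eq_of_functional_eq₂ (w := 0) h0 h1 (fun n => by simpa using hF n) hL
  simpa [qPochInf_zero] using this

end QPochhammer

/-! ### Series toolkit and Jacobi's triple product -/

section TripleProduct

variable {q : ℝ}

/-- Ratio test for a sequence given by a first order recurrence `f (n+1) D n = N n f n` whose
coefficients converge. -/
lemma summable_of_first_order {f D N : ℕ → ℂ} {d ν : ℂ} (hf : ∀ n, f (n + 1) * D n = N n * f n)
    (hD : Tendsto D atTop (𝓝 d)) (hN : Tendsto N atTop (𝓝 ν)) (h : ‖ν‖ < ‖d‖) : Summable f := by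
  have hd : 0 < ‖d‖ := (norm_nonneg _).trans_lt h
  obtain ⟨r, hr0, hr1⟩ := exists_between ((div_lt_one hd).2 h)
  have hr : 0 ≤ r := (div_nonneg (norm_nonneg _) hd.le).trans hr0.le
  have hlim : Tendsto (fun n => r * ‖D n‖ - ‖N n‖) atTop (𝓝 (r * ‖d‖ - ‖ν‖)) :=
    (hD.norm.const_mul r).sub hN.norm
  have hpos : 0 < r * ‖d‖ - ‖ν‖ := sub_pos.2 ((div_lt_iff₀ hd).1 hr0)
  refine summable_of_ratio_norm_eventually_le hr1 ?_
  filter_upwards [hlim.eventually (lt_mem_nhds hpos), hD.norm.eventually (lt_mem_nhds hd)]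
    with n hn hDn
  refine le_of_mul_le_mul_right ?_ hDn
  calc ‖f (n + 1)‖ * ‖D n‖ = ‖N n‖ * ‖f n‖ := by rw [← norm_mul, hf, norm_mul]
    _ ≤ (r * ‖D n‖) * ‖f n‖ := by gcongr; linarith
    _ = r * ‖f n‖ * ‖D n‖ := by ring

lemma tsum_int_shift (f : ℤ → ℂ) : ∑' m : ℤ, f (m + 1) = ∑' m : ℤ, f m :=
  (Equiv.addRight (1 : ℤ)).tsum_eq f

lemma summable_int_shift {f : ℤ → ℂ} (hf : Summable f) (k : ℤ) : Summable fun m => f (m + k) :=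
  (Equiv.addRight k).summable_iff.2 hf

lemma triangle_succ (m : ℤ) : (m + 1) * (m + 1 - 1) / 2 = m * (m - 1) / 2 + m := by
  rw [show (m + 1) * (m + 1 - 1) = m * (m - 1) + m * 2 by ring]
  exact Int.add_mul_ediv_right _ _ two_ne_zero

/-- The `m`-th term of `∑ (-u)^m q^{m(m-1)/2} (b q^m;q)_∞`. The parameter `b` interpolates
between the theta series (`b = 0`) and a unilateral series (`b = q`). -/
noncomputable def thetaTerm (q : ℝ) (u b : ℂ) (m : ℤ) : ℂ :=
  (-u) ^ m * (q : ℂ) ^ (m * (m - 1) / 2) * qPochInf q (b * (q : ℂ) ^ m)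

lemma thetaTerm_succ (h0 : 0 < q) (h1 : q < 1) {u : ℂ} (hu : u ≠ 0) (b : ℂ) (m : ℤ) :
    thetaTerm q u b (m + 1) * (1 - b * (q : ℂ) ^ m) = -u * (q : ℂ) ^ m * thetaTerm q u b m := by
  have hq := ofReal_ne_zero h0
  rw [thetaTerm, thetaTerm, triangle_succ, qPochInf_eq h0 h1 (b * (q : ℂ) ^ m), zpow_add₀ hq,
    zpow_add_one₀ hq, zpow_add_one₀ (neg_ne_zero.2 hu)]
  ring_nf

lemma summable_thetaTerm_mul (h0 : 0 < q) (h1 : q < 1) {u b : ℂ} (hu : u ≠ 0) (j : ℕ)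
    (hb : ‖b‖ < ‖u‖ * q ^ j) :
    Summable fun m : ℤ => thetaTerm q u b m * ((q : ℂ) ^ m) ^ j := by
  have hq := ofReal_ne_zero h0
  have hqn := tendsto_q_pow h0 h1
  refine Summable.of_nat_of_neg_add_one ?_ ?_
  · refine summable_of_first_order (D := fun n => 1 - b * (q : ℂ) ^ n)
      (N := fun n => -u * (q : ℂ) ^ j * (q : ℂ) ^ n) (fun n => ?_)
      ((hqn.const_mul b).const_sub 1) (hqn.const_mul _) (by simp)
    have := thetaTerm_succ h0 h1 hu b n
    push_cast at this ⊢
    rw [zpow_add_one₀ hq]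
    simp only [zpow_natCast] at this ⊢
    linear_combination ((q : ℂ) ^ n) ^ j * (q : ℂ) ^ j * this
  · refine summable_of_first_order (D := fun n => -u * (q : ℂ) ^ j)
      (N := fun n => (q : ℂ) ^ 2 * (q : ℂ) ^ n - b) (fun n => ?_)
      tendsto_const_nhds ((hqn.const_mul _).sub_const b) ?_
    · have := thetaTerm_succ h0 h1 hu b (-(n + 1 + 1))
      have e : -((n : ℤ) + 1 + 1) + 1 = -(n + 1) := by ring
      have hX : (q : ℂ) ^ (-((n : ℤ) + 1)) = (q : ℂ) ^ (-((n : ℤ) + 1 + 1)) * q := by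
        rw [← e, zpow_add_one₀ hq]
      have hn : (q : ℂ) ^ (-((n : ℤ) + 1 + 1)) * ((q : ℂ) ^ 2 * (q : ℂ) ^ n) = 1 := by
        rw [← zpow_natCast, ← zpow_natCast, ← zpow_add₀ hq, ← zpow_add₀ hq]
        convert zpow_zero _
        push_cast
        ring
      rw [e] at this
      push_cast
      rw [hX]
      set X := (q : ℂ) ^ (-((n : ℤ) + 1 + 1))
      set Y := (q : ℂ) ^ 2 * (q : ℂ) ^ n
      linear_combination (-(Y * X ^ j * (q : ℂ) ^ j)) * this + (-u * (q : ℂ) ^ j * X ^ j *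
        thetaTerm q u b (-(n + 1 + 1)) +
        thetaTerm q u b (-(n + 1)) * b * X ^ j * (q : ℂ) ^ j) * (-hn)
    · simpa [norm_q h0, abs_of_pos h0] using hb

lemma norm_thetaTerm_le (h0 : 0 < q) (h1 : q < 1) (u : ℂ) {b b' : ℂ} (hb : ‖b'‖ ≤ ‖b‖) (m : ℤ) :
    ‖thetaTerm q u b' m‖ ≤ ‖thetaTerm q u (-(‖b‖ : ℂ)) m‖ := by
  have : -(‖b‖ : ℂ) * (q : ℂ) ^ m = -((‖b‖ * q ^ m : ℝ) : ℂ) := by push_cast; ring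
  simp only [thetaTerm, this, norm_mul]
  gcongr
  refine norm_qPochInf_le h0 h1 ?_
  rw [norm_mul, norm_zpow, norm_q h0]
  gcongr

/-- First order equation in `b`, whose iteration `b → bq → bq² → ⋯ → 0` relates the unilateral
series at `b = q` to the theta series at `b = 0`. -/
lemma tsum_thetaTerm_functional (h0 : 0 < q) (h1 : q < 1) {u b : ℂ} (hu : u ≠ 0)
    (hb : ‖b‖ < ‖u‖) :
    (1 - b / u) * ∑' m, thetaTerm q u b m = ∑' m, thetaTerm q u (b * q) m := by
  have hq := ofReal_ne_zero h0
  have hbq : ‖b * (q : ℂ)‖ < ‖u‖ * q ^ 1 := by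
    rw [norm_mul, norm_q h0, pow_one]; gcongr
  have hbq' : ‖b * (q : ℂ)‖ < ‖u‖ * q ^ 0 :=
    hbq.trans_le (by gcongr ‖u‖ * ?_; simpa using h1.le)
  have s0 : Summable (thetaTerm q u (b * q)) := by
    simpa using summable_thetaTerm_mul h0 h1 hu 0 hbq'
  have s1 : Summable fun m : ℤ => thetaTerm q u (b * q) m * (q : ℂ) ^ m := by
    simpa using summable_thetaTerm_mul h0 h1 hu 1 hbq
  -- Both sides are expressed by the moments of the series with parameter `b q`: once termwise, once
  -- after the shift `m ↦ m + 1`.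
  have e1 : ∀ m, thetaTerm q u b m
      = thetaTerm q u (b * q) m - b * (thetaTerm q u (b * q) m * (q : ℂ) ^ m) := by
    intro m
    rw [thetaTerm, thetaTerm, qPochInf_eq h0 h1 (b * (q : ℂ) ^ m), mul_right_comm b]
    ring
  have e2 : ∀ m, thetaTerm q u b (m + 1) = -u * (thetaTerm q u (b * q) m * (q : ℂ) ^ m) := by
    intro m
    rw [thetaTerm, thetaTerm, triangle_succ, zpow_add₀ hq, zpow_add_one₀ hq,
      zpow_add_one₀ (neg_ne_zero.2 hu)]
    ring_nf
  have t1 : ∑' m, thetaTerm q u b m = (∑' m, thetaTerm q u (b * q) m)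
      - b * ∑' m, thetaTerm q u (b * q) m * (q : ℂ) ^ m := by
    simp only [e1]
    rw [s0.tsum_sub (s1.mul_left b), tsum_mul_left]
  have t2 : ∑' m, thetaTerm q u b m = -u * ∑' m, thetaTerm q u (b * q) m * (q : ℂ) ^ m := by
    rw [← tsum_int_shift]
    simp only [e2]
    rw [tsum_mul_left]
  field_simp
  linear_combination u * t1 - b * t2

/-- Euler's expansion of `(u;q)_∞`. -/
lemma tsum_euler (h0 : 0 < q) (h1 : q < 1) (u : ℂ) :
    ∑' m : ℕ, (-u) ^ m * (q : ℂ) ^ (m.choose 2) / qPoch q q m = qPochInf q u := by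
  have hqn := tendsto_q_pow h0 h1
  have hne := fun n => qPoch_q_ne_zero h0 h1 n
  have hc : ∀ n : ℕ, (n + 1).choose 2 = n + n.choose 2 := fun n => by
    rw [Nat.choose_succ_succ' n 1, Nat.choose_one_right]
  have hs : ∀ u : ℂ, Summable fun m : ℕ => (-u) ^ m * (q : ℂ) ^ (m.choose 2) / qPoch q q m := by
    intro u
    refine summable_of_first_order (D := fun n => 1 - q * (q : ℂ) ^ n)
      (N := fun n => -u * (q : ℂ) ^ n) (fun n => ?_)
      ((hqn.const_mul (q : ℂ)).const_sub 1) (hqn.const_mul _) (by simp)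
    have h2 := hne (n + 1)
    rw [qPoch_succ] at h2 ⊢
    have h3 := left_ne_zero_of_mul h2
    have h4 := right_ne_zero_of_mul h2
    rw [hc, pow_add, pow_succ]
    field_simp
    ring
  have key := qPochInf_mul_eq_of_functional_eq (F := fun n : ℕ =>
      ∑' m : ℕ, (-(u * (q : ℂ) ^ n)) ^ m * (q : ℂ) ^ (m.choose 2) / qPoch q q m)
      (u := 0) (v := u) (L := 1) h0 h1 (fun n => ?_) ?_
  · simpa [qPochInf_zero] using key
  · set w := u * (q : ℂ) ^ n with hw
    rw [zero_mul, sub_zero, one_mul, pow_succ, ← mul_assoc, ← hw]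
    have e1 : (∑' m : ℕ, (-w) ^ m * (q : ℂ) ^ (m.choose 2) / qPoch q q m)
        - ∑' m : ℕ, (-(w * q)) ^ m * (q : ℂ) ^ (m.choose 2) / qPoch q q m
        = -w * ∑' m : ℕ, (-(w * q)) ^ m * (q : ℂ) ^ (m.choose 2) / qPoch q q m := by
      rw [← (hs w).tsum_sub (hs _), ← tsum_mul_left, ((hs w).sub (hs _)).tsum_eq_zero_add]
      simp only [pow_zero, sub_self, zero_add]
      congr 1
      ext m
      have h2 := hne (m + 1)
      rw [qPoch_succ] at h2 ⊢
      have h3 := left_ne_zero_of_mul h2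
      have h4 := right_ne_zero_of_mul h2
      rw [hc, pow_add]
      field_simp
      ring
    linear_combination e1
  · have : (1 : ℂ) = ∑' m : ℕ, if m = 0 then 1 else 0 := by simp
    rw [this]
    refine tendsto_tsum_of_dominated_convergence (bound := fun m : ℕ =>
      ‖(-u) ^ m * (q : ℂ) ^ (m.choose 2) / qPoch q q m‖) (hs u).norm (fun m => ?_)
      (Eventually.of_forall fun n m => ?_)
    · have h : Tendsto (fun n : ℕ => (-(u * (q : ℂ) ^ n)) ^ m) atTop (𝓝 ((-(u * 0)) ^ m)) :=
        ((hqn.const_mul u).neg).pow m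
      have h' := (h.mul_const ((q : ℂ) ^ (m.choose 2))).div_const (qPoch q q m)
      convert h' using 2
      rcases m with _ | m
      · simp [qPoch]
      · simp
    · simp only [norm_div, norm_mul, norm_pow, norm_neg, norm_q h0]
      gcongr
      exact mul_le_of_le_one_right (norm_nonneg _) (pow_le_one₀ h0.le h1.le)

/-- At `b = q` the terms with `m < 0` vanish, and the series is Euler's. -/
lemma tsum_thetaTerm_q (h0 : 0 < q) (h1 : q < 1) (u : ℂ) :
    ∑' m, thetaTerm q u q m = qPochInf q q * qPochInf q u := by
  have hq := ofReal_ne_zero h0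
  rw [← tsum_euler h0 h1 u, ← tsum_mul_left]
  have hsupp : Function.support (thetaTerm q u q) ⊆ Set.range ((↑) : ℕ → ℤ) := by
    intro m hm
    by_contra hneg
    have hlt : m < 0 := by
      by_contra h
      exact hneg ⟨m.toNat, by simp; omega⟩
    refine hm ?_
    rw [thetaTerm, qPochInf_eq_zero h0 h1 (n := (-m - 1).toNat), mul_zero]
    rw [← zpow_natCast, mul_assoc, ← zpow_add₀ hq, ← zpow_one_add₀ hq,
      Int.toNat_of_nonneg (by omega)]
    convert zpow_zero _
    ring
  rw [← Function.Injective.tsum_eq Nat.cast_injective hsupp]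
  congr 1
  ext m
  have hc : ((m : ℤ) * (m - 1) / 2) = (m.choose 2 : ℕ) := by
    rw [Nat.choose_two_right]
    rcases m with _ | m
    · simp
    · push_cast; simp
  rw [thetaTerm, hc, zpow_natCast, zpow_natCast, zpow_natCast, ← qPoch_mul_qPochInf h0 h1 q m]
  have := qPoch_q_ne_zero h0 h1 m
  field_simp

/-- Jacobi's triple product where the iteration from `b = q` converges; quasi-periodicity removes
the restriction on `u`. -/
lemma tsum_thetaTerm_zero_of_lt (h0 : 0 < q) (h1 : q < 1) {u : ℂ} (hu : q < ‖u‖) :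
    ∑' m, thetaTerm q u 0 m = qPochInf q q * theta q u := by
  have hu0 : u ≠ 0 := norm_pos_iff.1 (h0.trans hu)
  have hle : ∀ n : ℕ, ‖(q : ℂ) * (q : ℂ) ^ n‖ ≤ ‖(q : ℂ)‖ := fun n => by
    rw [norm_mul, norm_pow, norm_q h0]
    exact mul_le_of_le_one_right h0.le (pow_le_one₀ h0.le h1.le)
  have key := qPochInf_mul_eq_of_functional_eq (F := fun n : ℕ =>
      ∑' m, thetaTerm q u (q * (q : ℂ) ^ n) m)
      (u := q / u) (v := 0) (L := ∑' m, thetaTerm q u 0 m) h0 h1 (fun n => ?_) ?_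
  · rw [qPochInf_zero, one_mul, pow_zero, mul_one, tsum_thetaTerm_q h0 h1] at key
    rw [← key, theta]
    ring
  · have := tsum_thetaTerm_functional h0 h1 hu0 (b := q * (q : ℂ) ^ n)
      ((hle n).trans_lt (by rwa [norm_q h0]))
    rw [pow_succ, ← mul_assoc, ← this]
    ring
  · refine tendsto_tsum_of_dominated_convergence
      (bound := fun m => ‖thetaTerm q u (-(‖(q : ℂ)‖ : ℂ)) m‖) ?_ (fun m => ?_)
      (Eventually.of_forall fun n m => norm_thetaTerm_le h0 h1 u (hle n) m)
    · have := summable_thetaTerm_mul h0 h1 hu0 (b := -(‖(q : ℂ)‖ : ℂ)) 0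
        (by simpa [abs_of_pos h0] using hu)
      simpa using this.norm
    · have h : Tendsto (fun n : ℕ => (q : ℂ) * (q : ℂ) ^ n * (q : ℂ) ^ m) atTop
          (𝓝 (0 * (q : ℂ) ^ m)) := by
        simpa using ((tendsto_q_pow h0 h1).const_mul (q : ℂ)).mul_const ((q : ℂ) ^ m)
      exact (((continuous_qPochInf h0 h1).tendsto _).comp h).const_mul _

/-- Quasi-periodicity of the theta function. -/
lemma theta_mul_q (h0 : 0 < q) (h1 : q < 1) {u : ℂ} (hu : u ≠ 0) :
    theta q u = -u * theta q (u * q) := by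
  have hq := ofReal_ne_zero h0
  rw [theta, theta, qPochInf_eq h0 h1 u, show (q : ℂ) / (u * q) = 1 / u by field_simp,
    qPochInf_eq h0 h1 (1 / u), show 1 / u * (q : ℂ) = q / u by ring]
  field_simp
  ring

lemma theta_div (h0 : 0 < q) {u : ℂ} (hu : u ≠ 0) : theta q (q / u) = theta q u := by
  have hq := ofReal_ne_zero h0
  rw [theta, theta, mul_comm, show (q : ℂ) / (q / u) = u by field_simp]

/-- Jacobi's triple product identity. -/
lemma tsum_thetaTerm_zero (h0 : 0 < q) (h1 : q < 1) {u : ℂ} (hu : u ≠ 0) :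
    ∑' m, thetaTerm q u 0 m = qPochInf q q * theta q u := by
  have hq := ofReal_ne_zero h0
  have hstep : ∀ v : ℂ, v ≠ 0 → ∑' m, thetaTerm q v 0 m = qPochInf q q * theta q v →
      ∑' m, thetaTerm q (v * q) 0 m = qPochInf q q * theta q (v * q) := by
    intro v hv h
    have hsh : ∑' m, thetaTerm q v 0 m = -v * ∑' m, thetaTerm q (v * q) 0 m := by
      rw [← tsum_int_shift, ← tsum_mul_left]
      congr 1
      ext m
      rw [thetaTerm, thetaTerm, triangle_succ, zpow_add₀ hq, zpow_add_one₀ (neg_ne_zero.2 hv),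
        ← neg_mul, mul_zpow]
      ring_nf
    have hv' : -v ≠ 0 := neg_ne_zero.2 hv
    apply mul_left_cancel₀ hv'
    rw [← hsh, h, theta_mul_q h0 h1 hv]
    ring
  obtain ⟨n, hn⟩ : ∃ n : ℕ, q ^ n * q < ‖u‖ := by
    have : Tendsto (fun n : ℕ => q ^ n * q) atTop (𝓝 (0 * q)) :=
      (tendsto_pow_atTop_nhds_zero_of_lt_one h0.le h1).mul_const q
    rw [zero_mul] at this
    exact (this.eventually (gt_mem_nhds (norm_pos_iff.2 hu))).exists
  have hind : ∀ k : ℕ, ∑' m, thetaTerm q (u / (q : ℂ) ^ n * (q : ℂ) ^ k) 0 m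
      = qPochInf q q * theta q (u / (q : ℂ) ^ n * (q : ℂ) ^ k) := by
    intro k
    induction k with
    | zero =>
      rw [pow_zero, mul_one]
      refine tsum_thetaTerm_zero_of_lt h0 h1 ?_
      rw [norm_div, norm_pow, norm_q h0, lt_div_iff₀ (by positivity)]
      linarith
    | succ k ih =>
      have := hstep _ (mul_ne_zero (div_ne_zero hu (pow_ne_zero n hq)) (pow_ne_zero k hq)) ih
      rwa [mul_assoc, ← pow_succ] at this
  have := hind n
  rwa [div_mul_cancel₀ u (pow_ne_zero n hq)] at this

end TripleProduct

/-! ### Determinants of bilateral series -/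

section Bilateral

variable {q : ℝ}

/-- The `m`-th term, at `X = x q^m`, of the bilateral series
`∑ h^m x^{2m} q^{m(m-1)} (b₁X, b₂X, α₁/X, α₂/X;q)_∞`. Up to a factor independent of `m` this is
the general term of a `₂ψ₂` series; the normalization makes it entire in `b₁, b₂, α₁, α₂`. -/
noncomputable def bilTerm (q : ℝ) (h x b₁ b₂ α₁ α₂ : ℂ) (m : ℤ) : ℂ :=
  h ^ m * x ^ (2 * m) * (q : ℂ) ^ (m * (m - 1)) *
    (qPochInf q (b₁ * (x * (q : ℂ) ^ m)) * qPochInf q (b₂ * (x * (q : ℂ) ^ m)) *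
      (qPochInf q (α₁ / (x * (q : ℂ) ^ m)) * qPochInf q (α₂ / (x * (q : ℂ) ^ m))))

/-- The bilateral series `∑ bilTerm(m) X^j`, `X = x q^m`. -/
noncomputable def bilSum (q : ℝ) (h x b₁ b₂ α₁ α₂ : ℂ) (j : ℤ) : ℂ :=
  ∑' m : ℤ, bilTerm q h x b₁ b₂ α₁ α₂ m * (x * (q : ℂ) ^ m) ^ j

/-- The determinant formed from the moments `0` and `1` at the two base points `x` and `y`. -/
noncomputable def bilDet (q : ℝ) (h x y b₁ b₂ α₁ α₂ : ℂ) : ℂ :=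
  bilSum q h x b₁ b₂ α₁ α₂ 1 * bilSum q h y b₁ b₂ α₁ α₂ 0 -
    bilSum q h x b₁ b₂ α₁ α₂ 0 * bilSum q h y b₁ b₂ α₁ α₂ 1

lemma bilTerm_swap_left (h x b₁ b₂ α₁ α₂ : ℂ) :
    bilTerm q h x b₁ b₂ α₁ α₂ = bilTerm q h x b₂ b₁ α₁ α₂ := by
  ext m; simp only [bilTerm]; ring

lemma bilTerm_swap_right (h x b₁ b₂ α₁ α₂ : ℂ) :
    bilTerm q h x b₁ b₂ α₁ α₂ = bilTerm q h x b₁ b₂ α₂ α₁ := by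
  ext m; simp only [bilTerm]; ring

lemma bilDet_swap_left (h x y b₁ b₂ α₁ α₂ : ℂ) :
    bilDet q h x y b₁ b₂ α₁ α₂ = bilDet q h x y b₂ b₁ α₁ α₂ := by
  simp only [bilDet, bilSum, bilTerm_swap_left _ _ b₁ b₂]

lemma bilDet_swap_right (h x y b₁ b₂ α₁ α₂ : ℂ) :
    bilDet q h x y b₁ b₂ α₁ α₂ = bilDet q h x y b₁ b₂ α₂ α₁ := by
  simp only [bilDet, bilSum, bilTerm_swap_right _ _ b₁ b₂ α₁ α₂]

/-- First order recurrence of the terms; both factors are polynomials in `X = x q^m`. -/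
lemma bilTerm_succ (h0 : 0 < q) (h1 : q < 1) {h x : ℂ} (hh : h ≠ 0) (hx : x ≠ 0)
    (b₁ b₂ α₁ α₂ : ℂ) (m : ℤ) :
    bilTerm q h x b₁ b₂ α₁ α₂ (m + 1) *
        ((1 - b₁ * (x * (q : ℂ) ^ m)) * (1 - b₂ * (x * (q : ℂ) ^ m))) =
      h * (x * (q : ℂ) ^ m - α₁ / q) * (x * (q : ℂ) ^ m - α₂ / q) *
        bilTerm q h x b₁ b₂ α₁ α₂ m := by
  have hq := ofReal_ne_zero h0
  have hX : x * (q : ℂ) ^ m ≠ 0 := mul_ne_zero hx (zpow_ne_zero _ hq)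
  have hX' : x * (q : ℂ) ^ (m + 1) = x * (q : ℂ) ^ m * q := by rw [zpow_add_one₀ hq, mul_assoc]
  have e : h ^ (m + 1) * x ^ (2 * (m + 1)) * (q : ℂ) ^ ((m + 1) * (m + 1 - 1))
      = h ^ m * x ^ (2 * m) * (q : ℂ) ^ (m * (m - 1)) * (h * (x * (q : ℂ) ^ m) ^ 2) := by
    rw [show 2 * (m + 1) = 2 * m + 2 by ring,
      show (m + 1) * (m + 1 - 1) = m * (m - 1) + (m + m) by ring,
      zpow_add₀ hx, zpow_add₀ hq, zpow_add₀ hq, zpow_add_one₀ hh]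
    simp only [zpow_ofNat]
    ring
  simp only [bilTerm, e, hX']
  set X := x * (q : ℂ) ^ m
  rw [qPochInf_eq h0 h1 (b₁ * X), qPochInf_eq h0 h1 (b₂ * X), qPochInf_eq h0 h1 (α₁ / (X * q)),
    qPochInf_eq h0 h1 (α₂ / (X * q)), show α₁ / (X * q) * q = α₁ / X by field_simp,
    show α₂ / (X * q) * q = α₂ / X by field_simp, ← mul_assoc b₁, ← mul_assoc b₂]
  field_simp

lemma summable_bilTerm (h0 : 0 < q) (h1 : q < 1) {h x b₁ b₂ α₁ α₂ : ℂ} (hh : h ≠ 0) (hx : x ≠ 0)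
    (j : ℤ) (hα : ‖h * α₁ * α₂‖ * q ^ j < q ^ 2) (hb : ‖b₁ * b₂‖ < ‖h‖ * q ^ j) :
    Summable fun m : ℤ => bilTerm q h x b₁ b₂ α₁ α₂ m * (x * (q : ℂ) ^ m) ^ j := by
  have hq := ofReal_ne_zero h0
  have hqn := tendsto_q_pow h0 h1
  have hjn : ‖(q : ℂ) ^ j‖ = q ^ j := by rw [norm_zpow, norm_q h0]
  refine Summable.of_nat_of_neg_add_one ?_ ?_
  · have hX : Tendsto (fun n : ℕ => x * (q : ℂ) ^ n) atTop (𝓝 0) := by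
      simpa using hqn.const_mul x
    refine summable_of_first_order
      (D := fun n => (1 - b₁ * (x * (q : ℂ) ^ n)) * (1 - b₂ * (x * (q : ℂ) ^ n)))
      (N := fun n => h * (x * (q : ℂ) ^ n - α₁ / q) * (x * (q : ℂ) ^ n - α₂ / q) * (q : ℂ) ^ j)
      (fun n => ?_) (((hX.const_mul b₁).const_sub 1).mul ((hX.const_mul b₂).const_sub 1))
      ((((hX.sub_const _).const_mul h).mul (hX.sub_const _)).mul_const _) ?_
    · have := bilTerm_succ h0 h1 hh hx b₁ b₂ α₁ α₂ n
      push_cast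
      rw [zpow_add_one₀ hq, ← mul_assoc x, mul_zpow (x * (q : ℂ) ^ (n : ℤ))]
      simp only [zpow_natCast] at this ⊢
      linear_combination (x * (q : ℂ) ^ n) ^ j * (q : ℂ) ^ j * this
    · have : h * (0 - α₁ / q) * (0 - α₂ / q) * (q : ℂ) ^ j =
          h * α₁ * α₂ * (q : ℂ) ^ j / (q : ℂ) ^ 2 := by
        field_simp; ring
      rw [this, norm_div, norm_mul _ ((q : ℂ) ^ j), hjn, norm_pow, norm_q h0]
      simpa [div_lt_one (pow_pos h0 2)] using hα
  · have hY : Tendsto (fun n : ℕ => (q : ℂ) ^ 2 * (q : ℂ) ^ n / x) atTop (𝓝 0) := by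
      simpa using (hqn.const_mul ((q : ℂ) ^ 2)).div_const x
    refine summable_of_first_order
      (D := fun n => h * (1 - α₁ / q * ((q : ℂ) ^ 2 * (q : ℂ) ^ n / x)) *
        (1 - α₂ / q * ((q : ℂ) ^ 2 * (q : ℂ) ^ n / x)) * (q : ℂ) ^ j)
      (N := fun n => ((q : ℂ) ^ 2 * (q : ℂ) ^ n / x - b₁) * ((q : ℂ) ^ 2 * (q : ℂ) ^ n / x - b₂))
      (fun n => ?_)
      (((((hY.const_mul _).const_sub 1).const_mul h).mul
        ((hY.const_mul _).const_sub 1)).mul_const _)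
      ((hY.sub_const _).mul (hY.sub_const _)) ?_
    · have := bilTerm_succ h0 h1 hh hx b₁ b₂ α₁ α₂ (-(n + 1 + 1))
      have e : -((n : ℤ) + 1 + 1) + 1 = -(n + 1) := by ring
      have hX : x * (q : ℂ) ^ (-((n : ℤ) + 1)) = x * (q : ℂ) ^ (-((n : ℤ) + 1 + 1)) * q := by
        rw [← e, zpow_add_one₀ hq, mul_assoc]
      have hn : x * (q : ℂ) ^ (-((n : ℤ) + 1 + 1)) * ((q : ℂ) ^ 2 * (q : ℂ) ^ n / x) = 1 := by
        have : (q : ℂ) ^ (-((n : ℤ) + 1 + 1)) * ((q : ℂ) ^ 2 * (q : ℂ) ^ n) = 1 := by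
          rw [← zpow_natCast, ← zpow_natCast, ← zpow_add₀ hq, ← zpow_add₀ hq]
          convert zpow_zero _
          push_cast
          ring
        field_simp
        linear_combination this
      rw [e] at this
      push_cast
      rw [hX, mul_zpow (x * (q : ℂ) ^ (-((n : ℤ) + 1 + 1)))]
      have hX0 : x * (q : ℂ) ^ (-((n : ℤ) + 1 + 1)) ≠ 0 := mul_ne_zero hx (zpow_ne_zero _ hq)
      rw [eq_one_div_of_mul_eq_one_right hn]
      set X := x * (q : ℂ) ^ (-((n : ℤ) + 1 + 1))
      set T := bilTerm q h x b₁ b₂ α₁ α₂ (-(n + 1 + 1))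
      set T' := bilTerm q h x b₁ b₂ α₁ α₂ (-(n + 1))
      have : T * (h * (X - α₁ / q) * (X - α₂ / q)) = (1 - b₁ * X) * (1 - b₂ * X) * T' := by
        linear_combination -this
      have e1 : h * (1 - α₁ / q * (1 / X)) * (1 - α₂ / q * (1 / X))
          = (h * (X - α₁ / q) * (X - α₂ / q)) / X ^ 2 := by field_simp
      have e2 : (1 / X - b₁) * (1 / X - b₂) = (1 - b₁ * X) * (1 - b₂ * X) / X ^ 2 := by field_simp
      rw [e1, e2]
      linear_combination X ^ j * (q : ℂ) ^ j / X ^ 2 * this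
    · simpa [hjn, abs_of_pos h0] using hb

/-- Majorant by the same term with `x` positive and the parameters nonpositive. -/
lemma norm_bilTerm_le (h0 : 0 < q) (h1 : q < 1) (h x : ℂ) {b₁ b₂ α₁ α₂ b₁' b₂' α₁' α₂' : ℂ}
    (hb₁ : ‖b₁'‖ ≤ ‖b₁‖) (hb₂ : ‖b₂'‖ ≤ ‖b₂‖) (hα₁ : ‖α₁'‖ ≤ ‖α₁‖) (hα₂ : ‖α₂'‖ ≤ ‖α₂‖) (m : ℤ) :
    ‖bilTerm q h x b₁' b₂' α₁' α₂' m‖ ≤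
      ‖bilTerm q h (‖x‖ : ℂ) (-(‖b₁‖ : ℂ)) (-(‖b₂‖ : ℂ)) (-(‖α₁‖ : ℂ)) (-(‖α₂‖ : ℂ)) m‖ := by
  have e : ∀ b : ℂ, -(‖b‖ : ℂ) * ((‖x‖ : ℂ) * (q : ℂ) ^ m) = -((‖b‖ * (‖x‖ * q ^ m) : ℝ) : ℂ) := by
    intro b; push_cast; ring
  have e' : ∀ b : ℂ, -(‖b‖ : ℂ) / ((‖x‖ : ℂ) * (q : ℂ) ^ m) = -((‖b‖ / (‖x‖ * q ^ m) : ℝ) : ℂ) := by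
    intro b; push_cast; ring
  have f : ∀ {b b' : ℂ}, ‖b'‖ ≤ ‖b‖ → ‖qPochInf q (b' * (x * (q : ℂ) ^ m))‖ ≤
      ‖qPochInf q (-((‖b‖ * (‖x‖ * q ^ m) : ℝ) : ℂ))‖ := fun hb => by
    refine norm_qPochInf_le h0 h1 ?_
    rw [norm_mul, norm_mul, norm_zpow, norm_q h0]
    gcongr
  have f' : ∀ {b b' : ℂ}, ‖b'‖ ≤ ‖b‖ → ‖qPochInf q (b' / (x * (q : ℂ) ^ m))‖ ≤
      ‖qPochInf q (-((‖b‖ / (‖x‖ * q ^ m) : ℝ) : ℂ))‖ := fun hb => by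
    refine norm_qPochInf_le h0 h1 ?_
    rw [norm_div, norm_mul, norm_zpow, norm_q h0]
    gcongr
  simp only [bilTerm, e, e', norm_mul, norm_zpow, Complex.norm_real, norm_norm]
  gcongr
  · exact f hb₁
  · exact f hb₂
  · exact f' hα₁
  · exact f' hα₂

lemma tendsto_bilSum (h0 : 0 < q) (h1 : q < 1) {h x b₁ b₂ α₁ α₂ : ℂ} (hh : h ≠ 0) (hx : x ≠ 0)
    (j : ℤ) (hα : ‖h * α₁ * α₂‖ * q ^ j < q ^ 2) (hb : ‖b₁ * b₂‖ < ‖h‖ * q ^ j)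
    {β₁ β₂ a₁ a₂ : ℕ → ℂ} {β₁' β₂' a₁' a₂' : ℂ}
    (hβ₁ : ∀ n, ‖β₁ n‖ ≤ ‖b₁‖) (hβ₂ : ∀ n, ‖β₂ n‖ ≤ ‖b₂‖)
    (ha₁ : ∀ n, ‖a₁ n‖ ≤ ‖α₁‖) (ha₂ : ∀ n, ‖a₂ n‖ ≤ ‖α₂‖)
    (tβ₁ : Tendsto β₁ atTop (𝓝 β₁')) (tβ₂ : Tendsto β₂ atTop (𝓝 β₂'))
    (ta₁ : Tendsto a₁ atTop (𝓝 a₁')) (ta₂ : Tendsto a₂ atTop (𝓝 a₂')) :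
    Tendsto (fun n => bilSum q h x (β₁ n) (β₂ n) (a₁ n) (a₂ n) j) atTop
      (𝓝 (bilSum q h x β₁' β₂' a₁' a₂' j)) := by
  have hx' : (‖x‖ : ℂ) ≠ 0 := by simpa using hx
  refine tendsto_tsum_of_dominated_convergence (bound := fun m : ℤ =>
    ‖bilTerm q h (‖x‖ : ℂ) (-(‖b₁‖ : ℂ)) (-(‖b₂‖ : ℂ)) (-(‖α₁‖ : ℂ)) (-(‖α₂‖ : ℂ)) m
      * ((‖x‖ : ℂ) * (q : ℂ) ^ m) ^ j‖) ?_ (fun m => ?_) (Eventually.of_forall fun n m => ?_)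
  · refine (summable_bilTerm h0 h1 hh hx' j ?_ ?_).norm
    · simpa using hα
    · simpa using hb
  · have c := continuous_qPochInf h0 h1
    exact (((((c.tendsto _).comp (tβ₁.mul_const _)).mul ((c.tendsto _).comp (tβ₂.mul_const _))).mul
      (((c.tendsto _).comp (ta₁.div_const _)).mul
        ((c.tendsto _).comp (ta₂.div_const _)))).const_mul _).mul_const _
  · rw [norm_mul, norm_mul _ (((‖x‖ : ℂ) * (q : ℂ) ^ m) ^ j)]
    refine mul_le_mul (norm_bilTerm_le h0 h1 h x (hβ₁ n) (hβ₂ n) (ha₁ n) (ha₂ n) m) (le_of_eq ?_)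
      (norm_nonneg _) (norm_nonneg _)
    simp

/-- Summing the first order recurrence of the terms gives a relation between three moments. -/
lemma bilSum_relation (h0 : 0 < q) (h1 : q < 1) {h x b₁ b₂ α₁ α₂ : ℂ} (hh : h ≠ 0) (hx : x ≠ 0)
    (j : ℤ) (hα : ‖h * α₁ * α₂‖ * q ^ j < q ^ 2) (hb : ‖b₁ * b₂‖ < ‖h‖ * q ^ (j + 2)) :
    bilSum q h x b₁ b₂ α₁ α₂ j - (b₁ + b₂) / q * bilSum q h x b₁ b₂ α₁ α₂ (j + 1) +
        b₁ * b₂ / q ^ 2 * bilSum q h x b₁ b₂ α₁ α₂ (j + 2) =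
      (q : ℂ) ^ j * h * (bilSum q h x b₁ b₂ α₁ α₂ (j + 2) -
        (α₁ + α₂) / q * bilSum q h x b₁ b₂ α₁ α₂ (j + 1) +
        α₁ * α₂ / q ^ 2 * bilSum q h x b₁ b₂ α₁ α₂ j) := by
  have hq := ofReal_ne_zero h0
  have hj : q ^ (j + 2) ≤ q ^ (j + 1) := zpow_le_zpow_right_of_le_one₀ h0 h1.le (by omega)
  have hj' : q ^ (j + 1) ≤ q ^ j := zpow_le_zpow_right_of_le_one₀ h0 h1.le (by omega)
  have s : ∀ i : ℤ, q ^ i ≤ q ^ j → q ^ (j + 2) ≤ q ^ i →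
      HasSum (fun m : ℤ => bilTerm q h x b₁ b₂ α₁ α₂ m * (x * (q : ℂ) ^ m) ^ i)
        (bilSum q h x b₁ b₂ α₁ α₂ i) := fun i hi hi' =>
    (summable_bilTerm h0 h1 hh hx i
      ((mul_le_mul_of_nonneg_left hi (norm_nonneg _)).trans_lt hα)
      (hb.trans_le (mul_le_mul_of_nonneg_left hi' (norm_nonneg _)))).hasSum
  have s0 := s j le_rfl (hj.trans hj')
  have s1 := s (j + 1) hj' hj
  have s2 := s (j + 2) (hj.trans hj') le_rfl
  have l := (s0.sub (s1.mul_left ((b₁ + b₂) / q))).add (s2.mul_left (b₁ * b₂ / q ^ 2))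
  have r := ((s2.sub (s1.mul_left ((α₁ + α₂) / q))).add (s0.mul_left (α₁ * α₂ / q ^ 2))).mul_left
    ((q : ℂ) ^ j * h)
  have l' := (Equiv.addRight (1 : ℤ)).hasSum_iff.2 l
  refine l'.unique (Eq.mpr (congrArg (fun f => HasSum f _) (funext fun m : ℤ => ?_)) r)
  have hX : x * (q : ℂ) ^ m ≠ 0 := mul_ne_zero hx (zpow_ne_zero _ hq)
  have hX' : x * (q : ℂ) ^ (m + 1) = x * (q : ℂ) ^ m * q := by rw [zpow_add_one₀ hq, mul_assoc]
  have := bilTerm_succ h0 h1 hh hx b₁ b₂ α₁ α₂ m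
  simp only [Function.comp, Equiv.coe_addRight, hX']
  set X := x * (q : ℂ) ^ m
  rw [zpow_add₀ (mul_ne_zero hX hq), zpow_add₀ (mul_ne_zero hX hq), zpow_add₀ hX, zpow_add₀ hX,
    mul_zpow X]
  simp only [zpow_ofNat]
  field_simp at this ⊢
  linear_combination this

/-- Contiguity of the determinant in `b₁`. -/
lemma bilDet_step_left (h0 : 0 < q) (h1 : q < 1) {h x y b₁ b₂ α₁ α₂ : ℂ} (hh : h ≠ 0)
    (hx : x ≠ 0) (hy : y ≠ 0) (hα : ‖h * α₁ * α₂‖ < q ^ 2) (hb : ‖b₁ * b₂‖ < ‖h‖ * q) :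
    (1 - b₁ * b₂ / (q * h)) * bilDet q h x y b₁ b₂ α₁ α₂ =
      (1 - b₁ * α₁ / q) * (1 - b₁ * α₂ / q) * bilDet q h x y (b₁ * q) b₂ α₁ α₂ := by
  have hq := ofReal_ne_zero h0
  have hb' : ‖b₁ * q * b₂‖ < ‖h‖ * q ^ (2 : ℤ) := by
    rw [mul_right_comm, norm_mul _ (q : ℂ), norm_q h0]
    norm_cast
    nlinarith
  have e : ∀ {z : ℂ}, z ≠ 0 → ∀ j : ℤ, q ^ j ≤ 1 → q ≤ q ^ j →
      bilSum q h z b₁ b₂ α₁ α₂ j = bilSum q h z (b₁ * q) b₂ α₁ α₂ j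
        - b₁ * bilSum q h z (b₁ * q) b₂ α₁ α₂ (j + 1) := by
    intro z hz j hj hj'
    have hqj : 0 < q ^ j := zpow_pos h0 j
    have s : ∀ i : ℤ, q ^ i ≤ 1 → q ^ (2 : ℤ) ≤ q ^ i →
        Summable fun m : ℤ => bilTerm q h z (b₁ * q) b₂ α₁ α₂ m * (z * (q : ℂ) ^ m) ^ i :=
      fun i hi hi' => by
      refine summable_bilTerm h0 h1 hh hz i ?_ ?_
      · exact (mul_le_of_le_one_right (norm_nonneg _) hi).trans_lt hα
      · exact hb'.trans_le (mul_le_mul_of_nonneg_left hi' (norm_nonneg _))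
    have e1 : q ^ (j + 1) = q ^ j * q := zpow_add_one₀ h0.ne' j
    have e2 : q ^ (2 : ℤ) = q * q := by norm_cast; ring
    have sj := s j hj (by rw [e2]; nlinarith)
    have sj' := s (j + 1) (by rw [e1]; nlinarith) (by rw [e1, e2]; nlinarith)
    rw [bilSum, bilSum, bilSum, ← tsum_mul_left, ← sj.tsum_sub (sj'.mul_left _)]
    congr 1
    ext m
    have hX : z * (q : ℂ) ^ m ≠ 0 := mul_ne_zero hz (zpow_ne_zero _ hq)
    rw [zpow_add_one₀ hX, bilTerm, bilTerm, qPochInf_eq h0 h1 (b₁ * (z * (q : ℂ) ^ m)),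
      mul_right_comm b₁]
    ring
  -- The moments `0, 1` for `b₁` are combinations of the moments `0, 1, 2` for `b₁ q`, and
  -- `bilSum_relation` eliminates the moment `2`: a linear change of the moment vector, the same at
  -- both base points, whose determinant is the quotient of the factors in the claim.
  have r : ∀ {z : ℂ}, z ≠ 0 → _ := fun {z} hz => bilSum_relation (x := z) (b₁ := b₁ * q)
    (b₂ := b₂) (α₁ := α₁) (α₂ := α₂) h0 h1 hh hz 0 (by simpa using hα) (by simpa using hb')
  have rx := r hx
  have ry := r hy
  have x0 := e hx 0 (by simp) (by simpa using h1.le)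
  have x1 := e hx 1 (by simpa using h1.le) (by simp)
  have y0 := e hy 0 (by simp) (by simpa using h1.le)
  have y1 := e hy 1 (by simpa using h1.le) (by simp)
  simp only [zero_add, zpow_zero, one_mul, one_add_one_eq_two] at rx ry x0 x1 y0 y1
  rw [bilDet, bilDet, x0, x1, y0, y1]
  set X0 := bilSum q h x (b₁ * q) b₂ α₁ α₂ 0
  set X1 := bilSum q h x (b₁ * q) b₂ α₁ α₂ 1
  set Y0 := bilSum q h y (b₁ * q) b₂ α₁ α₂ 0
  set Y1 := bilSum q h y (b₁ * q) b₂ α₁ α₂ 1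
  linear_combination (norm := (field_simp; ring)) b₁ / h * (Y0 - b₁ * Y1) * rx
    - b₁ / h * (X0 - b₁ * X1) * ry

/-- Contiguity of the determinant in `α₁`. -/
lemma bilDet_step_right (h0 : 0 < q) (h1 : q < 1) {h x y b₁ b₂ α₁ α₂ : ℂ} (hh : h ≠ 0)
    (hx : x ≠ 0) (hy : y ≠ 0) (hα : ‖h * α₁ * α₂‖ < q ^ 2) (hb : ‖b₁ * b₂‖ < ‖h‖ * q) :
    (1 - h * α₁ * α₂ / q ^ 2) * bilDet q h x y b₁ b₂ α₁ α₂ =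
      (1 - b₁ * α₁ / q) * (1 - b₂ * α₁ / q) * bilDet q h x y b₁ b₂ (α₁ * q) α₂ := by
  have hq := ofReal_ne_zero h0
  have hα' : ‖h * (α₁ * q) * α₂‖ * q ^ (-1 : ℤ) < q ^ 2 := by
    rw [← mul_assoc, mul_right_comm, norm_mul _ (q : ℂ), norm_q h0, zpow_neg_one]
    field_simp
    exact hα
  have e : ∀ {z : ℂ}, z ≠ 0 → ∀ j : ℤ, q ^ j ≤ 1 → q ≤ q ^ j →
      bilSum q h z b₁ b₂ α₁ α₂ j = bilSum q h z b₁ b₂ (α₁ * q) α₂ j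
        - α₁ * bilSum q h z b₁ b₂ (α₁ * q) α₂ (j - 1) := by
    intro z hz j hj hj'
    have hqj : 0 < q ^ j := zpow_pos h0 j
    have s : ∀ i : ℤ, q ^ i ≤ q ^ (-1 : ℤ) → q ≤ q ^ i →
        Summable fun m : ℤ => bilTerm q h z b₁ b₂ (α₁ * q) α₂ m * (z * (q : ℂ) ^ m) ^ i :=
      fun i hi hi' => by
      refine summable_bilTerm h0 h1 hh hz i ?_ ?_
      · exact (mul_le_mul_of_nonneg_left hi (norm_nonneg _)).trans_lt hα'
      · exact hb.trans_le (mul_le_mul_of_nonneg_left hi' (norm_nonneg _))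
    have e1 : q ^ (j - 1) = q ^ j * q⁻¹ := zpow_sub_one₀ h0.ne' j
    have hqi : 1 < q⁻¹ := (one_lt_inv₀ h0).2 h1
    have sj := s j (by rw [zpow_neg_one]; linarith) hj'
    have sj' := s (j - 1) (by rw [zpow_neg_one, e1]; nlinarith) (by rw [e1]; nlinarith)
    rw [bilSum, bilSum, bilSum, ← tsum_mul_left, ← sj.tsum_sub (sj'.mul_left _)]
    congr 1
    ext m
    have hX : z * (q : ℂ) ^ m ≠ 0 := mul_ne_zero hz (zpow_ne_zero _ hq)
    rw [zpow_sub_one₀ hX, bilTerm, bilTerm, qPochInf_eq h0 h1 (α₁ / (z * (q : ℂ) ^ m)),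
      ← mul_div_right_comm]
    field_simp
  -- As for `b₁`, with the moments `-1, 0, 1`.
  have r : ∀ {z : ℂ}, z ≠ 0 → _ := fun {z} hz => bilSum_relation (x := z) (b₁ := b₁)
    (b₂ := b₂) (α₁ := α₁ * q) (α₂ := α₂) h0 h1 hh hz (-1) (by simpa using hα') (by simpa using hb)
  have rx := r hx
  have ry := r hy
  have x0 := e hx 0 (by simp) (by simpa using h1.le)
  have x1 := e hx 1 (by simpa using h1.le) (by simp)
  have y0 := e hy 0 (by simp) (by simpa using h1.le)
  have y1 := e hy 1 (by simpa using h1.le) (by simp)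
  norm_num at rx ry x0 x1 y0 y1
  rw [bilDet, bilDet, x0, x1, y0, y1]
  set X0 := bilSum q h x b₁ b₂ (α₁ * q) α₂ 0
  set X1 := bilSum q h x b₁ b₂ (α₁ * q) α₂ 1
  set Y0 := bilSum q h y b₁ b₂ (α₁ * q) α₂ 0
  set Y1 := bilSum q h y b₁ b₂ (α₁ * q) α₂ 1
  linear_combination (norm := (field_simp; ring)) α₁ * (Y1 - α₁ * Y0) * rx
    - α₁ * (X1 - α₁ * X0) * ry

lemma norm_mul_pow_le (h0 : 0 < q) (h1 : q < 1) (b : ℂ) (n : ℕ) : ‖b * (q : ℂ) ^ n‖ ≤ ‖b‖ := by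
  rw [norm_mul, norm_pow, norm_q h0]
  exact mul_le_of_le_one_right (norm_nonneg _) (pow_le_one₀ h0.le h1.le)

lemma tendsto_mul_q_pow (h0 : 0 < q) (h1 : q < 1) (b : ℂ) :
    Tendsto (fun n : ℕ => b * (q : ℂ) ^ n) atTop (𝓝 0) := by
  simpa using (tendsto_q_pow h0 h1).const_mul b

lemma tendsto_bilDet (h0 : 0 < q) (h1 : q < 1) {h x y b₁ b₂ α₁ α₂ : ℂ} (hh : h ≠ 0)
    (hx : x ≠ 0) (hy : y ≠ 0) (hα : ‖h * α₁ * α₂‖ < q ^ 2) (hb : ‖b₁ * b₂‖ < ‖h‖ * q)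
    {β₁ a₁ : ℕ → ℂ} {β₁' a₁' : ℂ} (hβ₁ : ∀ n, ‖β₁ n‖ ≤ ‖b₁‖) (ha₁ : ∀ n, ‖a₁ n‖ ≤ ‖α₁‖)
    (tβ₁ : Tendsto β₁ atTop (𝓝 β₁')) (ta₁ : Tendsto a₁ atTop (𝓝 a₁')) :
    Tendsto (fun n => bilDet q h x y (β₁ n) b₂ (a₁ n) α₂) atTop
      (𝓝 (bilDet q h x y β₁' b₂ a₁' α₂)) := by
  have t : ∀ {z : ℂ}, z ≠ 0 → ∀ j : ℤ, q ^ j ≤ 1 → q ≤ q ^ j → Tendsto (fun n =>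
      bilSum q h z (β₁ n) b₂ (a₁ n) α₂ j) atTop (𝓝 (bilSum q h z β₁' b₂ a₁' α₂ j)) :=
    fun hz j hj hj' => tendsto_bilSum h0 h1 hh hz j
      ((mul_le_of_le_one_right (norm_nonneg _) hj).trans_lt hα)
      (hb.trans_le (mul_le_mul_of_nonneg_left hj' (norm_nonneg _)))
      hβ₁ (fun _ => le_rfl) ha₁ (fun _ => le_rfl) tβ₁ tendsto_const_nhds ta₁ tendsto_const_nhds
  have e1 : q ^ (1 : ℤ) ≤ 1 := by simpa using h1.le
  have e2 : q ≤ q ^ (1 : ℤ) := by simp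
  have e3 : q ^ (0 : ℤ) ≤ 1 := by simp
  have e4 : q ≤ q ^ (0 : ℤ) := by simpa using h1.le
  exact ((t hx 1 e1 e2).mul (t hy 0 e3 e4)).sub ((t hx 0 e3 e4).mul (t hy 1 e1 e2))

/-- Iterated contiguity `b₁ → b₁q → ⋯ → 0`. -/
lemma bilDet_left (h0 : 0 < q) (h1 : q < 1) {h x y b₁ b₂ α₁ α₂ : ℂ} (hh : h ≠ 0)
    (hx : x ≠ 0) (hy : y ≠ 0) (hα : ‖h * α₁ * α₂‖ < q ^ 2) (hb : ‖b₁ * b₂‖ < ‖h‖ * q) :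
    qPochInf q (b₁ * b₂ / (q * h)) * bilDet q h x y b₁ b₂ α₁ α₂ =
      qPochInf q (b₁ * α₁ / q) * qPochInf q (b₁ * α₂ / q) * bilDet q h x y 0 b₂ α₁ α₂ := by
  have key := qPochInf_mul_eq_of_functional_eq₂
    (F := fun n : ℕ => bilDet q h x y (b₁ * (q : ℂ) ^ n) b₂ α₁ α₂)
    (u := b₁ * b₂ / (q * h)) (v := b₁ * α₁ / q) (w := b₁ * α₂ / q)
    h0 h1 (fun n => ?_) (tendsto_bilDet h0 h1 hh hx hy hα hb (norm_mul_pow_le h0 h1 b₁)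
      (fun _ => le_rfl) (tendsto_mul_q_pow h0 h1 b₁) tendsto_const_nhds)
  · simpa using key
  · have := bilDet_step_left h0 h1 hh hx hy (b₁ := b₁ * (q : ℂ) ^ n) (b₂ := b₂) hα ?_
    · rw [pow_succ, ← mul_assoc b₁]
      convert this using 2 <;> ring
    · refine lt_of_le_of_lt ?_ hb
      rw [norm_mul, norm_mul b₁ b₂]
      gcongr
      exact norm_mul_pow_le h0 h1 b₁ n

/-- Iterated contiguity `α₁ → α₁q → ⋯ → 0`. -/
lemma bilDet_right (h0 : 0 < q) (h1 : q < 1) {h x y b₁ b₂ α₁ α₂ : ℂ} (hh : h ≠ 0)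
    (hx : x ≠ 0) (hy : y ≠ 0) (hα : ‖h * α₁ * α₂‖ < q ^ 2) (hb : ‖b₁ * b₂‖ < ‖h‖ * q) :
    qPochInf q (h * α₁ * α₂ / q ^ 2) * bilDet q h x y b₁ b₂ α₁ α₂ =
      qPochInf q (b₁ * α₁ / q) * qPochInf q (b₂ * α₁ / q) * bilDet q h x y b₁ b₂ 0 α₂ := by
  have key := qPochInf_mul_eq_of_functional_eq₂
    (F := fun n : ℕ => bilDet q h x y b₁ b₂ (α₁ * (q : ℂ) ^ n) α₂)
    (u := h * α₁ * α₂ / q ^ 2) (v := b₁ * α₁ / q) (w := b₂ * α₁ / q)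
    h0 h1 (fun n => ?_) (tendsto_bilDet h0 h1 hh hx hy hα hb (fun _ => le_rfl)
      (norm_mul_pow_le h0 h1 α₁) tendsto_const_nhds (tendsto_mul_q_pow h0 h1 α₁))
  · simpa using key
  · have := bilDet_step_right h0 h1 hh hx hy (α₁ := α₁ * (q : ℂ) ^ n) (α₂ := α₂) ?_ hb
    · rw [pow_succ (q : ℂ) n, ← mul_assoc α₁]
      convert this using 2 <;> ring
    · refine lt_of_le_of_lt ?_ hα
      rw [norm_mul, norm_mul h, norm_mul _ α₂, norm_mul h]
      gcongr
      exact norm_mul_pow_le h0 h1 α₁ n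

lemma two_mul_triangle (m : ℤ) : 2 * (m * (m - 1) / 2) = m * (m - 1) :=
  Int.mul_ediv_cancel' (Int.even_mul_pred_self m).two_dvd

/-- The pairs `(i, j)` with `i + j` even and odd, parametrized by `ℤ × ℤ`. -/
lemma isCompl_range_parity :
    IsCompl (Set.range fun p : ℤ × ℤ => (p.2 - p.1, p.2 + p.1))
      (Set.range fun p : ℤ × ℤ => (p.2 - p.1 + 1, p.2 + p.1)) := by
  refine ⟨Set.disjoint_left.2 ?_, codisjoint_iff.2 (Set.eq_univ_of_forall ?_)⟩
  · rintro _ ⟨⟨m, l⟩, rfl⟩ ⟨⟨m', l'⟩, h⟩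
    simp only [Prod.mk.injEq] at h
    omega
  · rintro ⟨i, j⟩
    rcases Int.even_or_odd' (i + j) with ⟨k, hk | hk⟩
    · exact Or.inl ⟨(j - k, k), by simp only [Prod.mk.injEq]; omega⟩
    · exact Or.inr ⟨(j - k, k), by simp only [Prod.mk.injEq]; omega⟩

lemma bilTerm_zero (q : ℝ) (h z : ℂ) (m : ℤ) :
    bilTerm q h z 0 0 0 0 m = h ^ m * z ^ (2 * m) * (q : ℂ) ^ (m * (m - 1)) := by
  simp [bilTerm, qPochInf_zero]

lemma thetaTerm_zero (q : ℝ) (z : ℂ) (m : ℤ) :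
    thetaTerm q z 0 m = (-z) ^ m * (q : ℂ) ^ (m * (m - 1) / 2) := by
  simp [thetaTerm, qPochInf_zero]

/-- A term of the first product in `bilDet` at parameters `0` is a term, of even total index, of a
product of two theta series. -/
lemma bilTerm_mul_bilTerm_even (h0 : 0 < q) {h x y : ℂ} (hh : h ≠ 0) (hx : x ≠ 0) (hy : y ≠ 0)
    (m l : ℤ) :
    bilTerm q h x 0 0 0 0 m * (x * (q : ℂ) ^ m) * bilTerm q h y 0 0 0 0 l =
      x * (thetaTerm q (y / x) 0 (l - m) * thetaTerm q (h * x * y) 0 (l + m)) := by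
  have hq := ofReal_ne_zero h0
  have ex : (l - m) * (l - m - 1) / 2 + (l + m) * (l + m - 1) / 2
      = m * (m - 1) + l * (l - 1) + m := by
    have := two_mul_triangle (l - m)
    have := two_mul_triangle (l + m)
    linarith
  simp only [bilTerm_zero, thetaTerm_zero]
  have e : ((-(y / x)) ^ (l - m) * (-(h * x * y)) ^ (l + m)) * x
      = h ^ m * x ^ (2 * m) * (h ^ l * y ^ (2 * l)) * x := by
    rw [show (-(y / x)) = (-1) * (y * x⁻¹) by ring, show -(h * x * y) = (-1) * (h * x * y) by ring]
    simp only [mul_zpow, inv_zpow]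
    rw [zpow_sub₀ (by norm_num : (-1 : ℂ) ≠ 0), zpow_sub₀ hy, zpow_sub₀ hx, zpow_add₀ hh,
      zpow_add₀ hx, zpow_add₀ hy, zpow_add₀ (by norm_num : (-1 : ℂ) ≠ 0), two_mul, two_mul,
      zpow_add₀ hx, zpow_add₀ hy]
    have : ((-1 : ℂ) ^ l) * (-1) ^ l = 1 := by rw [← mul_zpow]; simp
    field_simp
    linear_combination this
  calc _ = (h ^ m * x ^ (2 * m) * (h ^ l * y ^ (2 * l)) * x) *
        ((q : ℂ) ^ (m * (m - 1)) * (q : ℂ) ^ (l * (l - 1)) * (q : ℂ) ^ m) := by ring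
    _ = _ := by
        rw [← e, ← zpow_add₀ hq, ← zpow_add₀ hq, ← ex, zpow_add₀ hq]
        ring

/-- A term of the second product in `bilDet` at parameters `0` is a term, of odd total index and up
to the sign, of the same product of two theta series. -/
lemma bilTerm_mul_bilTerm_odd (h0 : 0 < q) {h x y : ℂ} (hh : h ≠ 0) (hx : x ≠ 0) (hy : y ≠ 0)
    (m l : ℤ) :
    bilTerm q h x 0 0 0 0 m * (bilTerm q h y 0 0 0 0 l * (y * (q : ℂ) ^ l)) =
      -x * (thetaTerm q (y / x) 0 (l - m + 1) * thetaTerm q (h * x * y) 0 (l + m)) := by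
  have hq := ofReal_ne_zero h0
  have hu : y / x ≠ 0 := div_ne_zero hy hx
  have ex : (l - m + 1) * (l - m + 1 - 1) / 2 + (l + m) * (l + m - 1) / 2
      = m * (m - 1) + l * (l - 1) + l := by
    have := two_mul_triangle (l - m + 1)
    have := two_mul_triangle (l + m)
    linarith
  simp only [bilTerm_zero, thetaTerm_zero]
  have e : ((-(y / x)) ^ (l - m + 1) * (-(h * x * y)) ^ (l + m)) * (-x)
      = h ^ m * x ^ (2 * m) * (h ^ l * y ^ (2 * l)) * y := by
    rw [zpow_add_one₀ (neg_ne_zero.2 hu), show (-(y / x)) = (-1) * (y * x⁻¹) by ring,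
      show -(h * x * y) = (-1) * (h * x * y) by ring]
    simp only [mul_zpow, inv_zpow]
    rw [zpow_sub₀ (by norm_num : (-1 : ℂ) ≠ 0), zpow_sub₀ hy, zpow_sub₀ hx, zpow_add₀ hh,
      zpow_add₀ hx, zpow_add₀ hy, zpow_add₀ (by norm_num : (-1 : ℂ) ≠ 0), two_mul, two_mul,
      zpow_add₀ hx, zpow_add₀ hy]
    have : ((-1 : ℂ) ^ l) * (-1) ^ l = 1 := by rw [← mul_zpow]; simp
    field_simp
    linear_combination this
  calc _ = (h ^ m * x ^ (2 * m) * (h ^ l * y ^ (2 * l)) * y) *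
        ((q : ℂ) ^ (m * (m - 1)) * (q : ℂ) ^ (l * (l - 1)) * (q : ℂ) ^ l) := by ring
    _ = _ := by
        rw [← e, ← zpow_add₀ hq, ← zpow_add₀ hq, ← ex, zpow_add₀ hq]
        ring

/-- The determinant of two theta series of degree two factors into two theta functions: split the
double series for the product according to the parity of the total index. -/
lemma bilDet_zero (h0 : 0 < q) (h1 : q < 1) {h x y : ℂ} (hh : h ≠ 0) (hx : x ≠ 0) (hy : y ≠ 0) :
    bilDet q h x y 0 0 0 0 =
      x * qPochInf q q ^ 2 * (theta q (y / x) * theta q (h * x * y)) := by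
  have hq := ofReal_ne_zero h0
  have hu : y / x ≠ 0 := div_ne_zero hy hx
  have hv : h * x * y ≠ 0 := mul_ne_zero (mul_ne_zero hh hx) hy
  have st : ∀ {w : ℂ}, w ≠ 0 → Summable fun m => ‖thetaTerm q w 0 m‖ := fun {w} hw => by
    have := summable_thetaTerm_mul (u := w) (b := 0) h0 h1 hw 0 (by simpa using hw)
    simpa using this.norm
  have sb : ∀ {z : ℂ}, z ≠ 0 → ∀ j : ℤ, Summable fun m : ℤ =>
      ‖bilTerm q h z 0 0 0 0 m * (z * (q : ℂ) ^ m) ^ j‖ := fun hz j =>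
    (summable_bilTerm h0 h1 hh hz j (by simpa using pow_pos h0 2)
      (by simpa using mul_pos (norm_pos_iff.2 hh) (zpow_pos h0 j))).norm
  have hF := (summable_mul_of_summable_norm (st hu) (st hv))
  have hprod := tsum_mul_tsum_of_summable_norm (st hu) (st hv)
  rw [tsum_thetaTerm_zero h0 h1 hu, tsum_thetaTerm_zero h0 h1 hv] at hprod
  have d1 : bilSum q h x 0 0 0 0 1 * bilSum q h y 0 0 0 0 0 =
      x * ∑' p : ℤ × ℤ, thetaTerm q (y / x) 0 (p.2 - p.1) *
        thetaTerm q (h * x * y) 0 (p.2 + p.1) := by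
    rw [bilSum, bilSum, tsum_mul_tsum_of_summable_norm (sb hx 1) (sb hy 0), ← tsum_mul_left]
    refine tsum_congr fun p => ?_
    rw [zpow_zero, zpow_one, mul_one, bilTerm_mul_bilTerm_even h0 hh hx hy]
  have d2 : bilSum q h x 0 0 0 0 0 * bilSum q h y 0 0 0 0 1 =
      -x * ∑' p : ℤ × ℤ, thetaTerm q (y / x) 0 (p.2 - p.1 + 1) *
        thetaTerm q (h * x * y) 0 (p.2 + p.1) := by
    rw [bilSum, bilSum, tsum_mul_tsum_of_summable_norm (sb hx 0) (sb hy 1), ← tsum_mul_left]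
    refine tsum_congr fun p => ?_
    rw [zpow_zero, zpow_one, mul_one, bilTerm_mul_bilTerm_odd h0 hh hx hy]
  have i1 : Function.Injective fun p : ℤ × ℤ => (p.2 - p.1, p.2 + p.1) := by
    rintro ⟨m, l⟩ ⟨m', l'⟩ h
    simp only [Prod.mk.injEq] at h ⊢
    omega
  have i2 : Function.Injective fun p : ℤ × ℤ => (p.2 - p.1 + 1, p.2 + p.1) := by
    rintro ⟨m, l⟩ ⟨m', l'⟩ h
    simp only [Prod.mk.injEq] at h ⊢
    omega
  have H1 := i1.hasSum_range_iff.2 (hF.comp_injective i1).hasSum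
  have H2 := i2.hasSum_range_iff.2 (hF.comp_injective i2).hasSum
  have H := (HasSum.add_isCompl (f := fun p : ℤ × ℤ => thetaTerm q (y / x) 0 p.1 *
    thetaTerm q (h * x * y) 0 p.2) isCompl_range_parity H1 H2).tsum_eq
  rw [bilDet, d1, d2]
  simp only [Function.comp_def] at H
  rw [← hprod] at H
  linear_combination -x * H

/-- The closed form of the determinant, an `A₁` extension of Ramanujan's `₁ψ₁` summation. -/
theorem bilDet_eq (h0 : 0 < q) (h1 : q < 1) {h x y b₁ b₂ α₁ α₂ : ℂ} (hh : h ≠ 0)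
    (hx : x ≠ 0) (hy : y ≠ 0) (hα : ‖h * α₁ * α₂‖ < q ^ 2) (hb : ‖b₁ * b₂‖ < ‖h‖ * q) :
    qPochInf q (b₁ * b₂ / (q * h)) * qPochInf q (h * α₁ * α₂ / q ^ 2) *
        bilDet q h x y b₁ b₂ α₁ α₂ =
      qPochInf q (b₁ * α₁ / q) * qPochInf q (b₁ * α₂ / q) *
        (qPochInf q (b₂ * α₁ / q) * qPochInf q (b₂ * α₂ / q)) *
        (x * qPochInf q q ^ 2 * (theta q (y / x) * theta q (h * x * y))) := by
  have hb0 : ‖(0 : ℂ)‖ < ‖h‖ * q := by simpa using mul_pos (norm_pos_iff.2 hh) h0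
  have hα0 : ‖(0 : ℂ)‖ < q ^ 2 := by simpa using pow_pos h0 2
  have s1 := bilDet_left h0 h1 hh hx hy hα hb
  have s2 := bilDet_left (b₁ := b₂) (b₂ := 0) h0 h1 hh hx hy hα (by rwa [mul_zero])
  have s3 := bilDet_right (b₁ := 0) (b₂ := 0) h0 h1 hh hx hy hα (by rwa [mul_zero])
  have s4 := bilDet_right (b₁ := 0) (b₂ := 0) (α₁ := α₂) (α₂ := 0) h0 h1 hh hx hy
    (by rwa [mul_zero]) (by rwa [mul_zero])
  simp only [mul_zero, zero_mul, zero_div, qPochInf_zero, one_mul] at s2 s3 s4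
  rw [bilDet_swap_left _ _ _ 0 b₂] at s1
  rw [bilDet_swap_right _ _ _ _ _ 0 α₂] at s3
  rw [← bilDet_zero h0 h1 hh hx hy, ← s4, ← s3]
  rw [s2] at s1
  linear_combination qPochInf q (h * α₁ * α₂ / q ^ 2) * s1

end Bilateral

/-! ### A convolution solution of the difference equation -/

section Convolution

variable {q : ℝ}

/-- The kernel `(q^{N+1};q)_∞ / (e q^N;q)_∞`, which vanishes for `N < 0`. -/
noncomputable def ker (q : ℝ) (e : ℂ) (N : ℤ) : ℂ :=
  qPochInf q ((q : ℂ) ^ (N + 1)) / qPochInf q (e * (q : ℂ) ^ N)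

/-- The companion kernel `(q^{N+1};q)_∞ / (e q^{N-1};q)_∞` of `ker`. -/
noncomputable def ker' (q : ℝ) (e : ℂ) (N : ℤ) : ℂ :=
  qPochInf q ((q : ℂ) ^ (N + 1)) / qPochInf q (e * (q : ℂ) ^ (N - 1))

lemma qPochInf_zpow_eq_zero (h0 : 0 < q) (h1 : q < 1) {N : ℤ} (hN : N < 0) :
    qPochInf q ((q : ℂ) ^ (N + 1)) = 0 := by
  have hq := ofReal_ne_zero h0
  refine qPochInf_eq_zero h0 h1 (n := (-N - 1).toNat) ?_
  rw [← zpow_natCast, ← zpow_add₀ hq, Int.toNat_of_nonneg (by omega)]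
  convert zpow_zero _
  ring

lemma ker_of_neg (h0 : 0 < q) (h1 : q < 1) (e : ℂ) {N : ℤ} (hN : N < 0) : ker q e N = 0 := by
  rw [ker, qPochInf_zpow_eq_zero h0 h1 hN, zero_div]

lemma ker'_of_neg (h0 : 0 < q) (h1 : q < 1) (e : ℂ) {N : ℤ} (hN : N < 0) : ker' q e N = 0 := by
  rw [ker', qPochInf_zpow_eq_zero h0 h1 hN, zero_div]

lemma ker_eq_succ (h0 : 0 < q) (h1 : q < 1) (e : ℂ) (N : ℤ) :
    ker q e N = (1 - (q : ℂ) ^ (N + 1)) * ker' q e (N + 1) := by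
  have hq := ofReal_ne_zero h0
  rw [ker, ker', qPochInf_eq h0 h1 ((q : ℂ) ^ (N + 1)), ← zpow_add_one₀ hq, add_sub_cancel_right,
    mul_div_assoc]

lemma ker_eq (h0 : 0 < q) (h1 : q < 1) {e : ℂ} (he : ‖e‖ < q) (N : ℤ) :
    ker q e N = (1 - e * (q : ℂ) ^ (N - 1)) * ker' q e N := by
  have hq := ofReal_ne_zero h0
  rcases lt_or_ge N 0 with hN | hN
  · rw [ker_of_neg h0 h1 e hN, ker'_of_neg h0 h1 e hN, mul_zero]
  · have hlt : ‖e * (q : ℂ) ^ (N - 1)‖ < 1 := by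
      rw [norm_mul, norm_zpow, norm_q h0, zpow_sub_one₀ h0.ne']
      have : q ^ N ≤ 1 := zpow_le_one₀ h0 h1.le hN
      calc ‖e‖ * (q ^ N * q⁻¹) ≤ ‖e‖ * (1 * q⁻¹) := by gcongr
        _ < q * (1 * q⁻¹) := by gcongr
        _ = 1 := by field_simp
    have hne : qPochInf q (e * (q : ℂ) ^ (N - 1)) ≠ 0 := qPochInf_ne_zero_of_norm_lt_one h0 h1 hlt
    have hr := qPochInf_eq h0 h1 (e * (q : ℂ) ^ (N - 1))
    rw [mul_assoc, ← zpow_add_one₀ hq, sub_add_cancel] at hr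
    rw [hr] at hne
    have h2 := left_ne_zero_of_mul hne
    rw [ker, ker', hr]
    field_simp

lemma tendsto_q_zpow (h0 : 0 < q) (h1 : q < 1) :
    Tendsto (fun N : ℤ => (q : ℂ) ^ N) atTop (𝓝 0) := by
  rw [← Nat.map_cast_int_atTop, tendsto_map'_iff]
  exact (tendsto_q_pow h0 h1).congr fun n => (zpow_natCast _ n).symm

lemma tendsto_ker (h0 : 0 < q) (h1 : q < 1) (e : ℂ) : Tendsto (ker q e) atTop (𝓝 1) := by
  have h := tendsto_q_zpow h0 h1
  have h' : Tendsto (fun N : ℤ => (q : ℂ) ^ (N + 1)) atTop (𝓝 0) :=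
    h.comp (tendsto_atTop_add_const_right _ 1 tendsto_id)
  have := (tendsto_qPochInf_one h0 h1 h').div
    (tendsto_qPochInf_one h0 h1 (by simpa using h.const_mul e)) one_ne_zero
  rwa [div_one] at this

lemma tendsto_ker' (h0 : 0 < q) (h1 : q < 1) (e : ℂ) : Tendsto (ker' q e) atTop (𝓝 1) := by
  have h := tendsto_q_zpow h0 h1
  have h' : Tendsto (fun N : ℤ => (q : ℂ) ^ (N + 1)) atTop (𝓝 0) :=
    h.comp (tendsto_atTop_add_const_right _ 1 tendsto_id)
  have h'' : Tendsto (fun N : ℤ => (q : ℂ) ^ (N - 1)) atTop (𝓝 0) :=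
    h.comp (tendsto_atTop_add_const_right _ (-1) tendsto_id)
  have := (tendsto_qPochInf_one h0 h1 h').div
    (tendsto_qPochInf_one h0 h1 (by simpa using h''.const_mul e)) one_ne_zero
  rwa [div_one] at this

/-- A function on `ℤ` supported on `ℕ` that converges at infinity is bounded. -/
lemma exists_bound_of_tendsto {f : ℤ → ℂ} {l : ℂ} (hf : ∀ N < 0, f N = 0)
    (h : Tendsto f atTop (𝓝 l)) : ∃ M : ℝ, ∀ N, ‖f N‖ ≤ M := by
  have hn : Tendsto (fun n : ℕ => ‖f n‖) atTop (𝓝 ‖l‖) :=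
    (h.comp tendsto_natCast_atTop_atTop).norm
  obtain ⟨M, hM⟩ := hn.bddAbove_range
  refine ⟨max M 0, fun N => ?_⟩
  rcases lt_or_ge N 0 with hN | hN
  · simp [hf N hN]
  · lift N to ℕ using hN
    exact le_max_of_le_left (hM ⟨N, rfl⟩)

lemma exists_bound_ker (h0 : 0 < q) (h1 : q < 1) (e : ℂ) : ∃ M : ℝ, ∀ N, ‖ker q e N‖ ≤ M :=
  exists_bound_of_tendsto (fun _ => ker_of_neg h0 h1 e) (tendsto_ker h0 h1 e)

lemma exists_bound_ker' (h0 : 0 < q) (h1 : q < 1) (e : ℂ) : ∃ M : ℝ, ∀ N, ‖ker' q e N‖ ≤ M :=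
  exists_bound_of_tendsto (fun _ => ker'_of_neg h0 h1 e) (tendsto_ker' h0 h1 e)

/-- The q-binomial theorem for the generating series of the kernel. -/
lemma qPochInf_mul_tsum_ker (h0 : 0 < q) (h1 : q < 1) {e t : ℂ} (he : ‖e‖ < q) (ht : ‖t‖ < 1) :
    qPochInf q t * ∑' j : ℕ, ker q e j * t ^ j =
      qPochInf q (e * t) * (qPochInf q q / qPochInf q e) := by
  have hq := ofReal_ne_zero h0
  obtain ⟨M, hM⟩ := exists_bound_ker h0 h1 e
  have hs : ∀ {t : ℂ}, ‖t‖ < 1 → Summable fun j : ℕ => ker q e j * t ^ j := fun {t} ht =>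
    Summable.of_norm_bounded (g := fun j => M * ‖t‖ ^ j)
      ((summable_geometric_of_lt_one (norm_nonneg t) ht).mul_left M) fun j => by
        rw [norm_mul, norm_pow]; gcongr; exact hM j
  have hrec : ∀ j : ℕ, ker q e j * (1 - e * (q : ℂ) ^ j)
      = ker q e (j + 1 : ℕ) * (1 - (q : ℂ) ^ (j + 1)) := by
    intro j
    have h2 := ker_eq_succ h0 h1 e j
    have h3 := ker_eq h0 h1 he (j + 1)
    rw [add_sub_cancel_right] at h3
    push_cast
    rw [h3, h2]
    norm_cast
    ring
  have key := qPochInf_mul_eq_of_functional_eq (F := fun n : ℕ =>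
    ∑' j : ℕ, ker q e j * (t * (q : ℂ) ^ n) ^ j) (u := t) (v := e * t) (L := ker q e 0) h0 h1
    (fun n => ?_) ?_
  · rw [pow_zero, mul_one] at key
    rw [key, ker]
    simp
  · have hw : ‖t * (q : ℂ) ^ n‖ < 1 := (norm_mul_pow_le h0 h1 t n).trans_lt ht
    set w := t * (q : ℂ) ^ n with hwdef
    have hwq : ‖w * q‖ < 1 := by
      simpa using (norm_mul_pow_le h0 h1 w 1).trans_lt hw
    rw [pow_succ, ← mul_assoc, ← hwdef, mul_right_comm, mul_assoc e, mul_comm ((q : ℂ) ^ n),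
      ← hwdef]
    have e1 : (∑' j : ℕ, ker q e j * w ^ j) - ∑' j : ℕ, ker q e j * (w * q) ^ j
        = w * ((∑' j : ℕ, ker q e j * w ^ j) - e * ∑' j : ℕ, ker q e j * (w * q) ^ j) := by
      rw [← (hs hw).tsum_sub (hs hwq), ← tsum_mul_left,
        ← (hs hw).tsum_sub ((hs hwq).mul_left e), ← tsum_mul_left,
        ((hs hw).sub (hs hwq)).tsum_eq_zero_add]
      simp only [pow_zero, sub_self, zero_add]
      refine tsum_congr fun j => ?_
      linear_combination (-w ^ (j + 1)) * hrec j
    linear_combination e1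
  · have : ker q e 0 = ∑' m : ℕ, if m = 0 then ker q e 0 else 0 := by simp
    rw [this]
    refine tendsto_tsum_of_dominated_convergence (bound := fun j : ℕ =>
      ‖ker q e j * t ^ j‖) (hs ht).norm (fun j => ?_)
      (Eventually.of_forall fun n j => ?_)
    · have h : Tendsto (fun n : ℕ => (t * (q : ℂ) ^ n) ^ j) atTop (𝓝 (0 ^ j)) :=
        (tendsto_mul_q_pow h0 h1 t).pow j
      have h' := h.const_mul (ker q e j)
      convert h' using 2
      rcases j with _ | j
      · simp
      · simp
    · rw [norm_mul, norm_mul, norm_pow, norm_pow]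
      gcongr
      exact norm_mul_pow_le h0 h1 t n

/-- The weights of the convolution. With `X = q^m / z` the ratio of consecutive terms is
`sγ (1 - qX/c)(1 - qX/d) / ((1 - q²γX/(as))(1 - q²γX/(bs)))`. -/
noncomputable def convTerm (q : ℝ) (s γ a b c d z : ℂ) : ℤ → ℂ :=
  bilTerm q (s * γ * q ^ 2 / (c * d)) z⁻¹ (q ^ 2 * γ / (a * s)) (q ^ 2 * γ / (b * s)) c d

/-- The moments of `convTerm`. -/
noncomputable def convSum (q : ℝ) (s γ a b c d z : ℂ) : ℤ → ℂ :=
  bilSum q (s * γ * q ^ 2 / (c * d)) z⁻¹ (q ^ 2 * γ / (a * s)) (q ^ 2 * γ / (b * s)) c d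

/-- The convolution of `convTerm` with the kernel, the value at `x = z q^n` of a multiple of the
asymptotic solution when `|γ|` is small. -/
noncomputable def conv (q : ℝ) (s γ a b c d z : ℂ) (n : ℤ) : ℂ :=
  ∑' m : ℤ, ker q (q * γ / s) (m + n) * convTerm q s γ a b c d z m

variable {s γ a b c d z : ℂ}

/-- The two bounds on `γ` make the moments `0`, `1`, `2` of `convTerm` converge; the second moment
is needed for the telescoping in `conv_recurrence`. -/
lemma summable_convTerm (h0 : 0 < q) (h1 : q < 1) (hs : s ≠ 0) (hγ : γ ≠ 0) (ha : a ≠ 0)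
    (hb : b ≠ 0) (hc : c ≠ 0) (hd : d ≠ 0) (hz : z ≠ 0) (hsq : s ^ 2 = c * d * q / (a * b))
    (ht : ‖s * γ‖ < 1) (he : ‖q * γ / s‖ < q ^ 2) (j : ℤ) (hj0 : 0 ≤ j) (hj2 : j ≤ 2) :
    Summable fun m : ℤ => convTerm q s γ a b c d z m * (z⁻¹ * (q : ℂ) ^ m) ^ j := by
  have hq := ofReal_ne_zero h0
  have hj : q ^ j ≤ 1 := zpow_le_one₀ h0 h1.le hj0
  have hj' : q ^ (2 : ℤ) ≤ q ^ j := zpow_le_zpow_right_of_le_one₀ h0 h1.le hj2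
  have hh : s * γ * q ^ 2 / (c * d) ≠ 0 := by simp [*]
  refine summable_bilTerm h0 h1 hh (inv_ne_zero hz) j ?_ ?_
  · have : s * γ * (q : ℂ) ^ 2 / (c * d) * c * d = s * γ * (q : ℂ) ^ 2 := by field_simp
    rw [this, norm_mul, norm_pow, norm_q h0]
    calc ‖s * γ‖ * q ^ 2 * q ^ j ≤ ‖s * γ‖ * q ^ 2 * 1 := by gcongr
      _ < 1 * q ^ 2 * 1 := by gcongr
      _ = q ^ 2 := by ring
  · have : q ^ 2 * γ / (a * s) * (q ^ 2 * γ / (b * s))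
        = s * γ * q ^ 2 / (c * d) * (q * γ / s) := by
      have : a * b * s ^ 2 = c * d * q := by rw [hsq]; field_simp
      field_simp
      linear_combination -this
    rw [this, norm_mul]
    have hp : 0 < ‖s * γ * (q : ℂ) ^ 2 / (c * d)‖ := norm_pos_iff.2 hh
    have hj'' : q ^ 2 ≤ q ^ j := by exact_mod_cast hj'
    exact mul_lt_mul_of_pos_left (he.trans_le hj'') hp

lemma convTerm_succ (h0 : 0 < q) (h1 : q < 1) (hs : s ≠ 0) (hγ : γ ≠ 0)
    (hc : c ≠ 0) (hd : d ≠ 0) (hz : z ≠ 0) (m : ℤ) :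
    convTerm q s γ a b c d z (m + 1) * ((1 - q ^ 2 * γ / (a * s) * (z⁻¹ * (q : ℂ) ^ m)) *
        (1 - q ^ 2 * γ / (b * s) * (z⁻¹ * (q : ℂ) ^ m))) =
      s * γ * (1 - q / c * (z⁻¹ * (q : ℂ) ^ m)) * (1 - q / d * (z⁻¹ * (q : ℂ) ^ m)) *
        convTerm q s γ a b c d z m := by
  have hq := ofReal_ne_zero h0
  have hh : s * γ * q ^ 2 / (c * d) ≠ 0 := by simp [*]
  rw [convTerm, bilTerm_succ h0 h1 hh (inv_ne_zero hz)]
  field_simp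
  ring

/-- The telescoping certificate for the convolution. Here `Y = q^{m+n}`, `X = q^m / z`,
`x = z q^n`, so that `Y = x X`; `k` and `k'` are two consecutive values of `ker'`. -/
lemma conv_certificate {Q A B X Y x μ k k' : ℂ} (hQ : Q ≠ 0) (hs : s ≠ 0) (hγ : γ ≠ 0)
    (ha : a ≠ 0) (hb : b ≠ 0) (hc : c ≠ 0) (hd : d ≠ 0) (hx : x ≠ 0)
    (hsq : s ^ 2 = c * d * Q / (a * b))
    (hA : A = s⁻¹ * (1 - Q / (a * x)) * (1 - Q / (b * x)))
    (hB : B = s * (1 - 1 / (c * x)) * (1 - 1 / (d * x))) (hμ : μ = γ + γ⁻¹) (hY : Y = x * X)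
    (hk : (1 - Q * γ / s * Y / Q) * k = (1 - Q * Y) * k') :
    A * ((1 - Y) * k) + B * ((1 - Q * γ / s * Y) * k') +
        (s⁻¹ + s - A - B - μ) * ((1 - Q * γ / s * Y / Q) * k) =
      (γ⁻¹ - s⁻¹) * (s * γ * (1 - Q / c * X) * (1 - Q / d * X) * k' -
        (1 - Q ^ 2 * γ / (a * s) * X / Q) * (1 - Q ^ 2 * γ / (b * s) * X / Q) * k) := by
  have hd' : d = s ^ 2 * (a * b) / (c * Q) := by rw [hsq]; field_simp
  subst hd' hA hB hμ hY
  linear_combination (norm := (field_simp; ring))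
    (s - γ - s * (1 - 1 / (c * x)) * (1 - 1 / (s ^ 2 * (a * b) / (c * Q) * x)) -
      (s - γ) * Q * (x * X) / (c * (s ^ 2 * (a * b) / (c * Q)) * x ^ 2)) * hk

lemma norm_lt_of_lt_sq (h0 : 0 < q) (h1 : q < 1) {e : ℂ} (he : ‖e‖ < q ^ 2) : ‖e‖ < q :=
  he.trans_le (by nlinarith)

lemma summable_ker_mul (h0 : 0 < q) (h1 : q < 1) (e : ℂ) {U : ℤ → ℂ} (hU : Summable U) (n : ℤ) :
    Summable fun m : ℤ => ker q e (m + n) * U m := by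
  obtain ⟨M, hM⟩ := exists_bound_ker h0 h1 e
  refine Summable.of_norm_bounded (hU.norm.mul_left M) fun m => ?_
  rw [norm_mul]
  gcongr
  exact hM _

lemma summable_ker'_mul (h0 : 0 < q) (h1 : q < 1) (e : ℂ) {U : ℤ → ℂ} (hU : Summable U) (n : ℤ) :
    Summable fun m : ℤ => ker' q e (m + n) * U m := by
  obtain ⟨M, hM⟩ := exists_bound_ker' h0 h1 e
  refine Summable.of_norm_bounded (hU.norm.mul_left M) fun m => ?_
  rw [norm_mul]
  gcongr
  exact hM _

lemma tendsto_tsum_ker_mul (h0 : 0 < q) (h1 : q < 1) (e : ℂ) {U : ℤ → ℂ} (hU : Summable U) :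
    Tendsto (fun n : ℤ => ∑' m : ℤ, ker q e (m + n) * U m) atTop (𝓝 (∑' m, U m)) := by
  obtain ⟨M, hM⟩ := exists_bound_ker h0 h1 e
  refine tendsto_tsum_of_dominated_convergence (hU.norm.mul_left M) (fun m => ?_)
    (Eventually.of_forall fun n m => ?_)
  · have := ((tendsto_ker h0 h1 e).comp
      (tendsto_atTop_add_const_left _ m tendsto_id)).mul_const (U m)
    simpa using this
  · rw [norm_mul]
    gcongr
    exact hM _

lemma tendsto_tsum_ker'_mul (h0 : 0 < q) (h1 : q < 1) (e : ℂ) {U : ℤ → ℂ} (hU : Summable U) :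
    Tendsto (fun n : ℤ => ∑' m : ℤ, ker' q e (m + (n + 1)) * U m) atTop (𝓝 (∑' m, U m)) := by
  obtain ⟨M, hM⟩ := exists_bound_ker' h0 h1 e
  refine tendsto_tsum_of_dominated_convergence (hU.norm.mul_left M) (fun m => ?_)
    (Eventually.of_forall fun n m => ?_)
  · have := ((tendsto_ker' h0 h1 e).comp (tendsto_atTop_add_const_left _ m
      (tendsto_atTop_add_const_right _ (1 : ℤ) tendsto_id))).mul_const (U m)
    simpa using this
  · rw [norm_mul]
    gcongr
    exact hM _

/-- `conv` solves the difference equation along `x = z q^n`. -/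
lemma conv_recurrence (h0 : 0 < q) (h1 : q < 1) (hs : s ≠ 0) (hγ : γ ≠ 0) (ha : a ≠ 0)
    (hb : b ≠ 0) (hc : c ≠ 0) (hd : d ≠ 0) (hz : z ≠ 0) (hsq : s ^ 2 = c * d * q / (a * b))
    (ht : ‖s * γ‖ < 1) (he : ‖q * γ / s‖ < q ^ 2) (n : ℤ) {A B x : ℂ} (hx : x = z * (q : ℂ) ^ n)
    (hA : A = s⁻¹ * (1 - q / (a * x)) * (1 - q / (b * x)))
    (hB : B = s * (1 - 1 / (c * x)) * (1 - 1 / (d * x))) :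
    A * conv q s γ a b c d z (n - 1) + B * conv q s γ a b c d z (n + 1) +
      (s⁻¹ + s - A - B) * conv q s γ a b c d z n = (γ + γ⁻¹) * conv q s γ a b c d z n := by
  have hq := ofReal_ne_zero h0
  have he1 := norm_lt_of_lt_sq h0 h1 he
  have hxn : x ≠ 0 := by rw [hx]; exact mul_ne_zero hz (zpow_ne_zero _ hq)
  have sU := summable_convTerm h0 h1 hs hγ ha hb hc hd hz hsq ht he
  set U := convTerm q s γ a b c d z with hU
  set e := q * γ / s with hedef
  have sU0 : Summable U := by simpa using sU 0 le_rfl zero_le_two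
  have sU1 := sU 1 zero_le_one one_le_two
  have sU2 := sU 2 zero_le_two le_rfl
  simp only [zpow_ofNat] at sU1 sU2
  -- The telescoped sequence.
  let G : ℤ → ℂ := fun m => (1 - q ^ 2 * γ / (a * s) * (z⁻¹ * (q : ℂ) ^ m) / q) *
    (1 - q ^ 2 * γ / (b * s) * (z⁻¹ * (q : ℂ) ^ m) / q) * (ker' q e (m + n) * U m)
  have sG : Summable G := by
    have := ((summable_ker'_mul h0 h1 e sU0 n).add ((summable_ker'_mul h0 h1 e sU1 n).mul_left
      (-(q * γ / (a * s) + q * γ / (b * s))))).add ((summable_ker'_mul h0 h1 e sU2 n).mul_left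
      (q * γ / (a * s) * (q * γ / (b * s))))
    refine this.congr fun m => ?_
    simp only [G]
    field_simp
    ring
  have hG : ∀ m, A * (ker q e (m + (n - 1)) * U m) + B * (ker q e (m + (n + 1)) * U m) +
      (s⁻¹ + s - A - B - (γ + γ⁻¹)) * (ker q e (m + n) * U m) =
        (γ⁻¹ - s⁻¹) * (G (m + 1) - G m) := by
    intro m
    have e1 : ker q e (m + (n - 1)) = (1 - (q : ℂ) ^ (m + n)) * ker' q e (m + n) := by
      have := ker_eq_succ h0 h1 e (m + (n - 1))
      rwa [show m + (n - 1) + 1 = m + n by ring] at this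
    have e2 : ker q e (m + n + 1) = (1 - e * (q : ℂ) ^ (m + n)) * ker' q e (m + n + 1) := by
      have := ker_eq h0 h1 he1 (m + (n + 1))
      rwa [show m + (n + 1) - 1 = m + n by ring, show m + (n + 1) = m + n + 1 by ring] at this
    have e3 : ker q e (m + n) = (1 - e * (q : ℂ) ^ (m + n) / q) * ker' q e (m + n) := by
      have := ker_eq h0 h1 he1 (m + n)
      rwa [zpow_sub_one₀ hq, ← mul_assoc, ← div_eq_mul_inv] at this
    have e4 := ker_eq_succ h0 h1 e (m + n)
    rw [e3, zpow_add_one₀ hq] at e4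
    have cert := conv_certificate (k := ker' q e (m + n))
      (k' := ker' q e (m + n + 1)) (X := z⁻¹ * (q : ℂ) ^ m) (Y := (q : ℂ) ^ (m + n))
      hq hs hγ ha hb hc hd hxn hsq hA hB rfl
      (by rw [hx, zpow_add₀ hq]; field_simp) (e4.trans (by ring))
    have hT := convTerm_succ (a := a) (b := b) h0 h1 hs hγ hc hd hz m
    rw [← hU] at hT
    simp only [G]
    rw [show m + 1 + n = m + n + 1 by ring, show m + (n + 1) = m + n + 1 by ring, e1, e2, e3,
      zpow_add_one₀ hq, ← mul_assoc z⁻¹]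
    set X := z⁻¹ * (q : ℂ) ^ m
    have e5 : ∀ y : ℂ, y * (X * q) / q = y * X := fun y => by field_simp
    rw [e5, e5]
    linear_combination U m * cert - (γ⁻¹ - s⁻¹) * ker' q e (m + n + 1) * hT
  have S := fun k => (summable_ker_mul h0 h1 e sU0 k).hasSum
  have L := (((S (n - 1)).mul_left A).add ((S (n + 1)).mul_left B)).add
    ((S n).mul_left (s⁻¹ + s - A - B - (γ + γ⁻¹)))
  simp only [hG] at L
  have R := ((summable_int_shift sG 1).hasSum.sub sG.hasSum).mul_left (γ⁻¹ - s⁻¹)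
  have := L.unique R
  rw [tsum_int_shift, sub_self, mul_zero] at this
  simp only [conv]
  linear_combination this

/-- At the origin `conv` tends to the moment `0` of the bilateral series. -/
lemma tendsto_conv (h0 : 0 < q) (h1 : q < 1) (hs : s ≠ 0) (hγ : γ ≠ 0) (ha : a ≠ 0)
    (hb : b ≠ 0) (hc : c ≠ 0) (hd : d ≠ 0) (hz : z ≠ 0) (hsq : s ^ 2 = c * d * q / (a * b))
    (ht : ‖s * γ‖ < 1) (he : ‖q * γ / s‖ < q ^ 2) :
    Tendsto (conv q s γ a b c d z) atTop (𝓝 (convSum q s γ a b c d z 0)) := by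
  have sU := summable_convTerm h0 h1 hs hγ ha hb hc hd hz hsq ht he 0 le_rfl zero_le_two
  simp only [zpow_zero, mul_one] at sU
  have : Tendsto (conv q s γ a b c d z) atTop (𝓝 (∑' m, convTerm q s γ a b c d z m)) :=
    tendsto_tsum_ker_mul h0 h1 (q * γ / s) sU
  simpa [convSum, convTerm, bilSum] using this

/-- At the origin the `q`-derivative of `conv` tends to a multiple of the moment `1`. -/
lemma tendsto_conv_deriv (h0 : 0 < q) (h1 : q < 1) (hs : s ≠ 0) (hγ : γ ≠ 0) (ha : a ≠ 0)
    (hb : b ≠ 0) (hc : c ≠ 0) (hd : d ≠ 0) (hz : z ≠ 0) (hsq : s ^ 2 = c * d * q / (a * b))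
    (ht : ‖s * γ‖ < 1) (he : ‖q * γ / s‖ < q ^ 2) :
    Tendsto (fun n : ℤ => (conv q s γ a b c d z n - conv q s γ a b c d z (n + 1)) /
      (z * (q : ℂ) ^ n * (1 - q))) atTop
      (𝓝 ((q * γ / s - q) / (1 - q) * convSum q s γ a b c d z 1)) := by
  have hq := ofReal_ne_zero h0
  have h1q : (1 : ℂ) - q ≠ 0 := sub_ne_zero.2 (by exact_mod_cast h1.ne')
  have he1 := norm_lt_of_lt_sq h0 h1 he
  have sU0 := summable_convTerm h0 h1 hs hγ ha hb hc hd hz hsq ht he 0 le_rfl zero_le_two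
  have sU1 := summable_convTerm h0 h1 hs hγ ha hb hc hd hz hsq ht he 1 zero_le_one one_le_two
  simp only [zpow_zero, mul_one] at sU0
  have := (tendsto_tsum_ker'_mul h0 h1 (q * γ / s) sU1).const_mul ((q * γ / s - q) / (1 - q))
  refine Tendsto.congr (fun n => ?_) (this.trans (by simp [convSum, bilSum, convTerm]))
  have e : ∀ m : ℤ, ker q (q * γ / s) (m + n) * convTerm q s γ a b c d z m
      - ker q (q * γ / s) (m + (n + 1)) * convTerm q s γ a b c d z m
      = (q * γ / s - q) * (z * (q : ℂ) ^ n) * (ker' q (q * γ / s) (m + (n + 1)) *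
        (convTerm q s γ a b c d z m * (z⁻¹ * (q : ℂ) ^ m) ^ (1 : ℤ))) := by
    intro m
    have e1 := ker_eq_succ h0 h1 (q * γ / s) (m + n)
    have e2 := ker_eq h0 h1 he1 (m + (n + 1))
    rw [show m + (n + 1) - 1 = m + n by ring] at e2
    rw [show m + n + 1 = m + (n + 1) by ring] at e1
    rw [e1, e2, ← add_assoc, zpow_add_one₀ hq, zpow_add₀ hq, zpow_one]
    field_simp
    ring
  rw [conv, conv,
    ← (summable_ker_mul h0 h1 _ sU0 n).tsum_sub (summable_ker_mul h0 h1 _ sU0 (n + 1))]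
  simp only [e]
  rw [tsum_mul_left]
  have hqn : (q : ℂ) ^ n ≠ 0 := zpow_ne_zero _ hq
  field_simp

/-- Quasi-periodicity of the theta function, iterated `m` times. -/
lemma theta_mul_zpow_neg (h0 : 0 < q) (h1 : q < 1) {u : ℂ} (hu : u ≠ 0) (m : ℕ) :
    qPochInf q (u / (q : ℂ) ^ m) * qPochInf q (q / u * (q : ℂ) ^ m) * (q : ℂ) ^ (m.choose 2 + m) =
      (-u) ^ m * theta q u := by
  have hq := ofReal_ne_zero h0
  induction m with
  | zero => simp [theta]
  | succ m ih =>
    have e1 := qPochInf_eq h0 h1 (u / (q : ℂ) ^ (m + 1))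
    rw [pow_succ, div_mul_eq_mul_div, mul_div_mul_right _ _ hq] at e1
    have e2 := qPochInf_eq h0 h1 (q / u * (q : ℂ) ^ m)
    rw [mul_assoc, ← pow_succ] at e2
    have e3 : (m + 1).choose 2 + (m + 1) = m.choose 2 + m + (m + 1) := by
      rw [Nat.choose_succ_succ' m 1, Nat.choose_one_right]; ring
    rw [e2] at ih
    rw [pow_succ (q : ℂ) m, e1, e3, pow_add, pow_succ (-u), mul_right_comm _ (-u), ← ih, pow_succ]
    field_simp
    ring

/-- For nonnegative indices the weight behaves like a geometric progression. -/
lemma convTerm_natCast (h0 : 0 < q) (h1 : q < 1) (hs : s ≠ 0) (hγ : γ ≠ 0)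
    (hc : c ≠ 0) (hd : d ≠ 0) (hz : z ≠ 0) (m : ℕ) :
    convTerm q s γ a b c d z m * (qPochInf q (q / (c * z) * (q : ℂ) ^ m) *
        qPochInf q (q / (d * z) * (q : ℂ) ^ m)) =
      (s * γ) ^ m * (theta q (c * z) * theta q (d * z)) *
        (qPochInf q (q ^ 2 * γ / (a * s) * (z⁻¹ * (q : ℂ) ^ m)) *
          qPochInf q (q ^ 2 * γ / (b * s) * (z⁻¹ * (q : ℂ) ^ m))) := by
  have hq := ofReal_ne_zero h0
  have tc := theta_mul_zpow_neg h0 h1 (mul_ne_zero hc hz) m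
  have td := theta_mul_zpow_neg h0 h1 (mul_ne_zero hd hz) m
  have e1 : (q : ℂ) ^ ((m : ℤ) * (m - 1)) * q ^ (2 * m) =
      (q : ℂ) ^ (m.choose 2 + m) * (q : ℂ) ^ (m.choose 2 + m) := by
    rw [← zpow_natCast, ← zpow_natCast, ← zpow_add₀ hq, ← zpow_add₀ hq]
    congr 1
    have : ((m.choose 2 : ℕ) : ℤ) * 2 = m * (m - 1) := by
      rcases m with _ | m
      · simp
      · have : (m + 1).choose 2 * 2 = (m + 1) * m := by
          rw [Nat.choose_two_right, Nat.add_sub_cancel]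
          exact Nat.div_mul_cancel (Nat.even_mul_pred_self (m + 1)).two_dvd
        push_cast
        rw [add_sub_cancel_right]
        exact_mod_cast this
    push_cast
    linarith
  have e2 : ∀ y : ℂ, y / (z⁻¹ * (q : ℂ) ^ m) = y * z / (q : ℂ) ^ m := fun y => by field_simp
  simp only [convTerm, bilTerm, zpow_natCast, e2]
  rw [show (2 : ℤ) * m = ((2 * m : ℕ) : ℤ) by push_cast; ring, zpow_natCast]
  have hqm : (q : ℂ) ^ m ≠ 0 := pow_ne_zero _ hq
  have hh : (s * γ * (q : ℂ) ^ 2 / (c * d)) ^ m * (z⁻¹) ^ (2 * m) *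
      ((-(c * z)) ^ m * (-(d * z)) ^ m) = (s * γ) ^ m * (q : ℂ) ^ (2 * m) := by
    rw [pow_mul, pow_mul, ← mul_pow, ← mul_pow, ← mul_pow, ← mul_pow]
    congr 1
    field_simp
  apply mul_right_cancel₀ (pow_ne_zero (2 * m) hq)
  set P := (q : ℂ) ^ (m.choose 2 + m)
  set K := qPochInf q (q ^ 2 * γ / (a * s) * (z⁻¹ * (q : ℂ) ^ m)) *
          qPochInf q (q ^ 2 * γ / (b * s) * (z⁻¹ * (q : ℂ) ^ m))
  set H := (s * γ * (q : ℂ) ^ 2 / (c * d)) ^ m * (z⁻¹) ^ (2 * m)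
  calc _ = H * ((q : ℂ) ^ ((m : ℤ) * (m - 1)) * q ^ (2 * m)) * K *
        ((qPochInf q (c * z / (q : ℂ) ^ m) * qPochInf q (q / (c * z) * (q : ℂ) ^ m)) *
        (qPochInf q (d * z / (q : ℂ) ^ m) * qPochInf q (q / (d * z) * (q : ℂ) ^ m))) := by ring
    _ = H * K * ((qPochInf q (c * z / (q : ℂ) ^ m) * qPochInf q (q / (c * z) * (q : ℂ) ^ m) * P) *
        (qPochInf q (d * z / (q : ℂ) ^ m) * qPochInf q (q / (d * z) * (q : ℂ) ^ m) * P)) := by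
          rw [e1]; ring
    _ = (H * ((-(c * z)) ^ m * (-(d * z)) ^ m)) * K * (theta q (c * z) * theta q (d * z)) := by
          rw [tc, td]; ring
    _ = _ := by rw [hh]; ring

/-- The behaviour of `conv` at infinity. -/
lemma tendsto_conv_neg (h0 : 0 < q) (h1 : q < 1) (hs : s ≠ 0) (hγ : γ ≠ 0)
    (hc : c ≠ 0) (hd : d ≠ 0) (hz : z ≠ 0)
    (ht : ‖s * γ‖ < 1) :
    Tendsto (fun k : ℕ => conv q s γ a b c d z (-k) / (s * γ) ^ k) atTop
      (𝓝 (theta q (c * z) * theta q (d * z) * ∑' j : ℕ, ker q (q * γ / s) j * (s * γ) ^ j)) := by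
  have hq := ofReal_ne_zero h0
  have hsγ : s * γ ≠ 0 := mul_ne_zero hs hγ
  set e := q * γ / s with hedef
  set U := convTerm q s γ a b c d z with hU
  set Θ := theta q (c * z) * theta q (d * z) with hΘ
  obtain ⟨M, hM⟩ := exists_bound_ker h0 h1 e
  have hlim : Tendsto (fun m : ℕ => U m / (s * γ) ^ m) atTop (𝓝 Θ) := by
    have n0 : ∀ w : ℂ, Tendsto (fun m : ℕ => qPochInf q (w * (q : ℂ) ^ m)) atTop (𝓝 1) :=
      fun w => tendsto_qPochInf_one h0 h1 (tendsto_mul_q_pow h0 h1 w)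
    have n1 : ∀ w : ℂ, Tendsto (fun m : ℕ => qPochInf q (w * (z⁻¹ * (q : ℂ) ^ m))) atTop (𝓝 1) := by
      intro w
      simpa [mul_assoc] using n0 (w * z⁻¹)
    have den := (n0 (q / (c * z))).mul (n0 (q / (d * z)))
    have num := ((n1 (q ^ 2 * γ / (a * s))).mul (n1 (q ^ 2 * γ / (b * s)))).const_mul Θ
    have := num.div den (by simp)
    simp only [mul_one, div_one] at this
    refine this.congr' ?_
    rw [mul_one] at den
    filter_upwards [den.eventually_ne one_ne_zero] with m hm
    have := convTerm_natCast (a := a) (b := b) h0 h1 hs hγ hc hd hz m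
    rw [← hU, ← hΘ] at this
    have hp : (s * γ) ^ m ≠ 0 := pow_ne_zero _ hsγ
    simp only [Pi.div_apply]
    rw [div_eq_div_iff hm hp]
    linear_combination -this
  obtain ⟨M', hM'⟩ := hlim.norm.bddAbove_range
  -- The kernel vanishes at negative arguments, so that only the terms with index at least `k`
  -- remain.
  have e1 : ∀ k : ℕ, conv q s γ a b c d z (-k) / (s * γ) ^ k =
      ∑' j : ℕ, ker q e j * (s * γ) ^ j * (U (k + j : ℕ) / (s * γ) ^ (k + j)) := by
    intro k
    rw [conv, ← hU, ← hedef, ← (Equiv.addRight (k : ℤ)).tsum_eq]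
    simp only [Equiv.coe_addRight, add_neg_cancel_right]
    rw [← Function.Injective.tsum_eq (g := ((↑) : ℕ → ℤ)) Nat.cast_injective, ← tsum_div_const]
    · refine tsum_congr fun j => ?_
      rw [pow_add]
      push_cast
      rw [add_comm (k : ℤ)]
      field_simp
    · intro m hm
      by_contra hneg
      have hlt : m < 0 := by
        by_contra h
        exact hneg ⟨m.toNat, by simp; omega⟩
      refine hm (?_ : ker q e m * U (m + k) = 0)
      rw [ker_of_neg h0 h1 e hlt, zero_mul]
  simp only [e1]
  rw [mul_comm Θ, ← tsum_mul_right]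
  refine tendsto_tsum_of_dominated_convergence (bound := fun j => M * ‖s * γ‖ ^ j * M')
    (((summable_geometric_of_lt_one (norm_nonneg _) ht).mul_left M).mul_right M') (fun j => ?_)
    (Eventually.of_forall fun k j => ?_)
  · exact ((hlim.comp (tendsto_add_atTop_nat j))).const_mul _
  · rw [norm_mul, norm_mul, norm_pow]
    have h1 := hM j
    have h2 : ‖U (k + j : ℕ) / (s * γ) ^ (k + j)‖ ≤ M' := hM' ⟨k + j, rfl⟩
    have hM0 : 0 ≤ M := (norm_nonneg _).trans h1
    gcongr

end Convolution

/-! ### The asymptotic solution -/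

section Asymptotic

variable {q : ℝ} {s γ a b c d z : ℂ}

/-- The coefficients of the series in `phiSum`. -/
noncomputable def phiCoef (q : ℝ) (s γ a c d : ℂ) (j : ℕ) : ℂ :=
  qPoch q (q * γ / s) j * qPoch q (c * q * γ / (s * a)) j * qPoch q (d * q * γ / (s * a)) j /
    qPoch q q j * qPochInf q (q * γ ^ 2 * (q : ℂ) ^ j)

/-- The series `₃φ₂(qγ/s, cqγ/(sa), dqγ/(sa); D, qγ²; q, Z)` multiplied by `(D, qγ²;q)_∞`,
which removes its poles in `D` and in `γ`. -/
noncomputable def phiSum (q : ℝ) (s γ a c d D Z : ℂ) : ℂ :=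
  ∑' j : ℕ, phiCoef q s γ a c d j * qPochInf q (D * (q : ℂ) ^ j) * Z ^ j

/-- The factor `(sγ)^{-n} (q/bx;q)_∞ / (q/cx, q/dx;q)_∞` of the asymptotic solution at
`x = z q^n`. -/
noncomputable def phiPre (q : ℝ) (s γ b c d z : ℂ) (n : ℤ) : ℂ :=
  (s * γ) ^ (-n) * (qPochInf q (q / (b * (z * (q : ℂ) ^ n))) /
    (qPochInf q (q / (c * (z * (q : ℂ) ^ n))) * qPochInf q (q / (d * (z * (q : ℂ) ^ n)))))

/-- The asymptotic solution at `x = z q^n`, in a form that is regular in `x`. -/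
noncomputable def phiSol (q : ℝ) (s γ a b c d z : ℂ) (n : ℤ) : ℂ :=
  phiPre q s γ b c d z n *
    (phiSum q s γ a c d (q ^ 2 * γ / (a * s * (z * (q : ℂ) ^ n))) (q / (b * (z * (q : ℂ) ^ n))) /
      qPochInf q (q * γ ^ 2))

/-- The bound is locally uniform in `γ`, which makes the series holomorphic. -/
lemma exists_bound_phiCoef (h0 : 0 < q) (h1 : q < 1) (s a c d : ℂ) (R : ℝ) :
    ∃ M : ℝ, 0 ≤ M ∧ ∀ γ : ℂ, ‖γ‖ ≤ R → ∀ j, ‖phiCoef q s γ a c d j‖ ≤ M := by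
  refine ⟨qMaj q (q * R / ‖s‖) * qMaj q (‖c‖ * q * R / (‖s‖ * ‖a‖)) *
    qMaj q (‖d‖ * q * R / (‖s‖ * ‖a‖)) * (qMaj q q / ‖qPochInf q (q : ℂ)‖) * qMaj q (q * R ^ 2),
    ?_, fun γ hγ j => ?_⟩
  · have := qMaj_nonneg
    exact mul_nonneg (mul_nonneg (mul_nonneg (mul_nonneg (this _ _) (this _ _)) (this _ _))
      (div_nonneg (this _ _) (norm_nonneg _))) (this _ _)
  · have hne := qPoch_q_ne_zero h0 h1 j
    have hne' := qPochInf_q_ne_zero h0 h1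
    have hinv : ‖(qPoch q (q : ℂ) j)⁻¹‖ ≤ qMaj q q / ‖qPochInf q (q : ℂ)‖ := by
      have : (qPoch q (q : ℂ) j)⁻¹ = qPochInf q (q * (q : ℂ) ^ j) / qPochInf q (q : ℂ) := by
        rw [eq_div_iff hne', ← qPoch_mul_qPochInf h0 h1 (q : ℂ) j]
        field_simp
      rw [this, norm_div]
      gcongr
      refine norm_qPochInf_le h0 h1 ((norm_mul_pow_le h0 h1 _ j).trans_eq (norm_q h0))
    rw [phiCoef, div_eq_mul_inv]
    simp only [norm_mul]
    unfold qMaj at hinv ⊢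
    gcongr
    · exact norm_qPoch_le h0 h1 (by rw [norm_div, norm_mul, norm_q h0]; gcongr) j
    · exact norm_qPoch_le h0 h1 (by simp only [norm_div, norm_mul, norm_q h0]; gcongr) j
    · exact norm_qPoch_le h0 h1 (by simp only [norm_div, norm_mul, norm_q h0]; gcongr) j
    · refine norm_qPochInf_le h0 h1 ((norm_mul_pow_le h0 h1 _ j).trans ?_)
      rw [norm_mul, norm_pow, norm_q h0]
      gcongr

lemma exists_bound_phiTerm (h0 : 0 < q) (h1 : q < 1) (s a c d : ℂ) (R ρ : ℝ) :
    ∃ M : ℝ, 0 ≤ M ∧ ∀ γ D : ℂ, ‖γ‖ ≤ R → ‖D‖ ≤ ρ → ∀ j : ℕ,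
      ‖phiCoef q s γ a c d j * qPochInf q (D * (q : ℂ) ^ j)‖ ≤ M := by
  obtain ⟨M, hM0, hM⟩ := exists_bound_phiCoef h0 h1 s a c d R
  refine ⟨M * qMaj q ρ, mul_nonneg hM0 (qMaj_nonneg _ _), fun γ D hγ hD j => ?_⟩
  rw [norm_mul]
  gcongr
  · exact hM γ hγ j
  · exact norm_qPochInf_le h0 h1 ((norm_mul_pow_le h0 h1 D j).trans hD)

lemma summable_phiTerm (h0 : 0 < q) (h1 : q < 1) (s γ a c d D : ℂ) {Z : ℂ} (hZ : ‖Z‖ < 1) :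
    Summable fun j : ℕ => phiCoef q s γ a c d j * qPochInf q (D * (q : ℂ) ^ j) * Z ^ j := by
  obtain ⟨M, hM0, hM⟩ := exists_bound_phiTerm h0 h1 s a c d ‖γ‖ ‖D‖
  refine Summable.of_norm_bounded
    ((summable_geometric_of_lt_one (norm_nonneg Z) hZ).mul_left M) fun j => ?_
  rw [norm_mul, norm_pow]
  gcongr
  exact hM γ D le_rfl le_rfl j

lemma phiCoef_zero (q : ℝ) (s γ a c d : ℂ) :
    phiCoef q s γ a c d 0 = qPochInf q (q * γ ^ 2) := by
  simp [phiCoef, qPoch]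

/-- The ratio of consecutive coefficients of the `₃φ₂` series. -/
lemma phiCoef_succ (h0 : 0 < q) (h1 : q < 1) (s γ a c d : ℂ) (j : ℕ) :
    phiCoef q s γ a c d (j + 1) * ((1 - q * (q : ℂ) ^ j) * (1 - q * γ ^ 2 * (q : ℂ) ^ j)) =
      phiCoef q s γ a c d j * ((1 - q * γ / s * (q : ℂ) ^ j) *
        (1 - c * q * γ / (s * a) * (q : ℂ) ^ j) * (1 - d * q * γ / (s * a) * (q : ℂ) ^ j)) := by
  have hne := qPoch_q_ne_zero h0 h1 (j + 1)
  rw [qPoch_succ] at hne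
  have h2 := left_ne_zero_of_mul hne
  have h3 := right_ne_zero_of_mul hne
  rw [phiCoef, phiCoef, qPochInf_eq h0 h1 (q * γ ^ 2 * (q : ℂ) ^ j)]
  simp only [qPoch_succ]
  rw [mul_assoc _ ((q : ℂ) ^ j), ← pow_succ]
  field_simp

lemma differentiable_phiTerm (h0 : 0 < q) (h1 : q < 1) (s a c d : ℂ) (E : ℂ) (j : ℕ) :
    Differentiable ℂ fun γ => phiCoef q s γ a c d j * qPochInf q (E * γ * (q : ℂ) ^ j) := by
  have h := differentiable_qPochInf h0 h1
  have h' := differentiable_qPoch q j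
  have hc : ∀ w : ℂ, Differentiable ℂ fun γ : ℂ => qPoch q (w * γ) j := fun w =>
    h'.comp (differentiable_id.const_mul w)
  have e : ∀ γ, phiCoef q s γ a c d j = qPoch q (q / s * γ) j * qPoch q (c * q / (s * a) * γ) j *
      qPoch q (d * q / (s * a) * γ) j / qPoch q q j * qPochInf q (q * γ ^ 2 * (q : ℂ) ^ j) := by
    intro γ
    rw [phiCoef]
    congr 5 <;> ring
  simp only [e]
  have h2 : Differentiable ℂ fun γ : ℂ => qPochInf q (q * γ ^ 2 * (q : ℂ) ^ j) :=
    h.comp (by fun_prop : Differentiable ℂ fun γ : ℂ => q * γ ^ 2 * (q : ℂ) ^ j)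
  have h3 : Differentiable ℂ fun γ : ℂ => qPochInf q (E * γ * (q : ℂ) ^ j) :=
    h.comp (by fun_prop : Differentiable ℂ fun γ : ℂ => E * γ * (q : ℂ) ^ j)
  exact (((((hc _).mul (hc _)).mul (hc _)).div_const _).mul h2).mul h3

/-- The regularized series is an entire function of `γ`. -/
lemma differentiable_phiSum (h0 : 0 < q) (h1 : q < 1) (s a c d E : ℂ) {Z : ℂ} (hZ : ‖Z‖ < 1) :
    Differentiable ℂ fun γ => phiSum q s γ a c d (E * γ) Z := by
  intro γ₀
  have hopen : IsOpen (Metric.ball (0 : ℂ) (‖γ₀‖ + 1)) := Metric.isOpen_ball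
  obtain ⟨M, hM0, hM⟩ := exists_bound_phiTerm h0 h1 s a c d (‖γ₀‖ + 1) (‖E‖ * (‖γ₀‖ + 1))
  have hd : DifferentiableOn ℂ (fun γ => phiSum q s γ a c d (E * γ) Z)
      (Metric.ball (0 : ℂ) (‖γ₀‖ + 1)) := by
    refine Complex.differentiableOn_tsum_of_summable_norm (u := fun j => M * ‖Z‖ ^ j)
      ((summable_geometric_of_lt_one (norm_nonneg Z) hZ).mul_left M) (fun j => ?_) hopen
      fun j γ hγ => ?_
    · exact ((differentiable_phiTerm h0 h1 s a c d E j).mul_const _).differentiableOn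
    · have hγ' : ‖γ‖ ≤ ‖γ₀‖ + 1 := by simpa using (Metric.mem_ball.1 hγ).le
      rw [norm_mul, norm_pow]
      gcongr
      exact hM γ (E * γ) hγ' (by rw [norm_mul]; gcongr) j
  have hmem : γ₀ ∈ Metric.ball (0 : ℂ) (‖γ₀‖ + 1) := by simp
  exact hd.differentiableAt (hopen.mem_nhds hmem)

/-- The telescoping certificate for the `₃φ₂` series. Here `Y = q^j`, and `A`, `B` are the
coefficients of the difference operator at `x`. -/
lemma phi_certificate {Q A B Y x : ℂ} (hQ : Q ≠ 0) (hs : s ≠ 0) (hγ : γ ≠ 0)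
    (ha : a ≠ 0) (hb : b ≠ 0) (hc : c ≠ 0) (hd : d ≠ 0) (hx : x ≠ 0) (hY : Y ≠ 0)
    (hsq : s ^ 2 = c * d * Q / (a * b))
    (hA : A = s⁻¹ * (1 - Q / (a * x)) * (1 - Q / (b * x)))
    (hB : B = s * (1 - 1 / (c * x)) * (1 - 1 / (d * x))) :
    γ * (1 - Q / (a * x)) * (1 - Q / (c * x)) * (1 - Q / (d * x)) * Y +
        γ⁻¹ * (1 - Q / (b * x) / Q) * ((1 - Q ^ 2 * γ / (a * s * x) * Y / Q) *
          (1 - Q ^ 2 * γ / (a * s * x) * Y)) / Y +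
        (s⁻¹ + s - A - B - (γ + γ⁻¹)) * (1 - Q ^ 2 * γ / (a * s * x) * Y) =
      -γ⁻¹ * ((1 - Q * γ / s * Y) * (1 - c * Q * γ / (s * a) * Y) * (1 - d * Q * γ / (s * a) * Y) *
        (Q / (b * x)) / (Q * Y) -
        (1 - Q ^ 2 * γ / (a * s * x) * Y) * ((1 - Y) * (1 - Q * γ ^ 2 * Y / Q)) / Y) := by
  have hd' : d = s ^ 2 * (a * b) / (c * Q) := by rw [hsq]; field_simp
  subst hd' hA hB
  field_simp
  ring

/-- `phiSum` satisfies the contiguous relation equivalent to the difference equation. -/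
lemma phiSum_contiguous (h0 : 0 < q) (h1 : q < 1) (hs : s ≠ 0) (hγ : γ ≠ 0) (ha : a ≠ 0)
    (hb : b ≠ 0) (hc : c ≠ 0) (hd : d ≠ 0) {A B x : ℂ} (hx : x ≠ 0)
    (hsq : s ^ 2 = c * d * q / (a * b))
    (hA : A = s⁻¹ * (1 - q / (a * x)) * (1 - q / (b * x)))
    (hB : B = s * (1 - 1 / (c * x)) * (1 - 1 / (d * x)))
    (hZ : ‖(q : ℂ) / (b * x) / q‖ < 1) :
    γ * (1 - q / (a * x)) * (1 - q / (c * x)) * (1 - q / (d * x)) *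
        phiSum q s γ a c d (q ^ 2 * γ / (a * s * x) * q) (q / (b * x) * q) +
      γ⁻¹ * (1 - q / (b * x) / q) *
        phiSum q s γ a c d (q ^ 2 * γ / (a * s * x) / q) (q / (b * x) / q) +
      (s⁻¹ + s - A - B - (γ + γ⁻¹)) *
        phiSum q s γ a c d (q ^ 2 * γ / (a * s * x)) (q / (b * x)) = 0 := by
  have hq := ofReal_ne_zero h0
  set Z := (q : ℂ) / (b * x) with hZdef
  set D := (q : ℂ) ^ 2 * γ / (a * s * x) with hDdef
  have hZn : ‖Z‖ < 1 := by
    rw [norm_div, norm_q h0, div_lt_one h0] at hZ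
    exact hZ.trans h1
  have hZq : ‖Z * q‖ < 1 := by simpa using (norm_mul_pow_le h0 h1 Z 1).trans_lt hZn
  -- the telescoped sequence
  let G : ℕ → ℂ := fun j => -γ⁻¹ * ((1 - (q : ℂ) ^ j) * (1 - q * γ ^ 2 * (q : ℂ) ^ j / q)) *
    (phiCoef q s γ a c d j * qPochInf q (D * (q : ℂ) ^ j) * (Z / q) ^ j)
  have hG0 : G 0 = 0 := by simp [G]
  have sG : Summable G := by
    have b1 : ∀ j : ℕ, ‖-γ⁻¹ * ((1 - (q : ℂ) ^ j) * (1 - q * γ ^ 2 * (q : ℂ) ^ j / q))‖ ≤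
        ‖γ⁻¹‖ * ((1 + 1) * (1 + ‖γ ^ 2‖)) := by
      intro j
      have hqj : ‖(q : ℂ) ^ j‖ ≤ 1 := by
        rw [norm_pow, norm_q h0]; exact pow_le_one₀ h0.le h1.le
      have e : q * γ ^ 2 * (q : ℂ) ^ j / q = γ ^ 2 * (q : ℂ) ^ j := by field_simp
      rw [e, norm_mul, norm_neg, norm_mul]
      gcongr
      · exact (norm_sub_le _ _).trans (by rw [norm_one]; gcongr)
      · refine (norm_sub_le _ _).trans ?_
        rw [norm_one, norm_mul]
        gcongr
        exact mul_le_of_le_one_right (norm_nonneg _) hqj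
    refine Summable.of_norm_bounded
      ((summable_phiTerm h0 h1 s γ a c d D hZ).norm.mul_left (‖γ⁻¹‖ * ((1 + 1) * (1 + ‖γ ^ 2‖))))
      fun j => ?_
    rw [norm_mul]
    exact mul_le_mul_of_nonneg_right (b1 j) (norm_nonneg _)
  have S1 := (summable_phiTerm h0 h1 s γ a c d (D * q) hZq).hasSum
  have S2 := (summable_phiTerm h0 h1 s γ a c d (D / q) hZ).hasSum
  have S3 := (summable_phiTerm h0 h1 s γ a c d D hZn).hasSum
  have L := ((S1.mul_left (γ * (1 - q / (a * x)) * (1 - q / (c * x)) * (1 - q / (d * x)))).add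
    (S2.mul_left (γ⁻¹ * (1 - Z / q)))).add (S3.mul_left (s⁻¹ + s - A - B - (γ + γ⁻¹)))
  have R := ((summable_nat_add_iff 1).2 sG).hasSum.sub sG.hasSum
  have hR : ∑' j, G (j + 1) = ∑' j, G j := by rw [sG.tsum_eq_zero_add, hG0, zero_add]
  rw [hR, sub_self] at R
  refine L.unique (Eq.mp (congrArg (fun f => HasSum f _) (funext fun j => ?_)) R)
  have hY : (q : ℂ) ^ j ≠ 0 := pow_ne_zero j hq
  have cert := phi_certificate (Y := (q : ℂ) ^ j) hq hs hγ ha hb hc hd hx hY hsq hA hB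
  rw [← hZdef, ← hDdef] at cert
  clear_value Z D
  have c1 := phiCoef_succ h0 h1 s γ a c d j
  have p1 := qPochInf_eq h0 h1 (D * (q : ℂ) ^ j)
  have p2 := qPochInf_eq h0 h1 (D / q * (q : ℂ) ^ j)
  rw [show D / q * (q : ℂ) ^ j * q = D * (q : ℂ) ^ j by field_simp] at p2
  simp only [G]
  rw [p2, show D * q * (q : ℂ) ^ j = D * (q : ℂ) ^ j * q by ring,
    show D * (q : ℂ) ^ (j + 1) = D * (q : ℂ) ^ j * q by ring, p1, mul_pow,
    div_pow Z _ (j + 1), div_pow Z _ j,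
    show D / q * (q : ℂ) ^ j = D * (q : ℂ) ^ j / q by ring]
  set Y := (q : ℂ) ^ j with hYdef
  set k := qPochInf q (D * Y * q)
  rw [show (q : ℂ) ^ (j + 1) = Y * q by rw [pow_succ], pow_succ Z]
  have e1 : q * γ ^ 2 * (Y * q) / q = q * γ ^ 2 * Y := by field_simp
  rw [e1]
  linear_combination (norm := (field_simp; ring))
    (-(phiCoef q s γ a c d j * Z ^ j * k)) * cert - γ⁻¹ * k * Z ^ j * Z / (Y * q) * c1

lemma qPochInf_div_ne_zero (h0 : 0 < q) (h1 : q < 1) {y : ℂ} (hy : y ≠ 0)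
    (h : ∀ n : ℕ, y / (q : ℂ) ^ (n + 1) ≠ 1) : qPochInf q (q / y) ≠ 0 := by
  have hq := ofReal_ne_zero h0
  refine qPochInf_ne_zero h0 h1 fun n hn => h n ?_
  rw [div_eq_one_iff_eq (pow_ne_zero _ hq), pow_succ, eq_comm]
  field_simp at hn
  linear_combination hn

/-- The asymptotic solution satisfies the difference equation where its series converges. -/
lemma phiSol_recurrence (h0 : 0 < q) (h1 : q < 1) (hs : s ≠ 0) (hγ : γ ≠ 0) (ha : a ≠ 0)
    (hb : b ≠ 0) (hc : c ≠ 0) (hd : d ≠ 0) (hz : z ≠ 0) (hsq : s ^ 2 = c * d * q / (a * b))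
    (hcz : ∀ n : ℤ, c * (z * (q : ℂ) ^ n) ≠ 1) (hdz : ∀ n : ℤ, d * (z * (q : ℂ) ^ n) ≠ 1)
    (n : ℤ) {A B x : ℂ} (hx : x = z * (q : ℂ) ^ n)
    (hA : A = s⁻¹ * (1 - q / (a * x)) * (1 - q / (b * x)))
    (hB : B = s * (1 - 1 / (c * x)) * (1 - 1 / (d * x)))
    (hZ : ‖(q : ℂ) / (b * (z * (q : ℂ) ^ (n + 1)))‖ < 1) :
    A * phiSol q s γ a b c d z (n - 1) + B * phiSol q s γ a b c d z (n + 1) +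
      (s⁻¹ + s - A - B) * phiSol q s γ a b c d z n = (γ + γ⁻¹) * phiSol q s γ a b c d z n := by
  have hq := ofReal_ne_zero h0
  have hxn : x ≠ 0 := by rw [hx]; exact mul_ne_zero hz (zpow_ne_zero _ hq)
  have xp : z * (q : ℂ) ^ (n + 1) = x * q := by rw [hx, zpow_add_one₀ hq, mul_assoc]
  have xm : z * (q : ℂ) ^ (n - 1) = x / q := by rw [hx, zpow_sub_one₀ hq]; ring
  have ed : ∀ w y : ℂ, w / (y * (x * q)) = w / (y * x) / q := fun w y => by
    rw [← mul_assoc, div_mul_eq_div_div]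
  have em : ∀ w y : ℂ, w / (y * (x / q)) = w / (y * x) * q := fun w y => by
    field_simp
  have hZ' : ‖(q : ℂ) / (b * x) / q‖ < 1 := by rwa [← ed, ← xp]
  have hZ1 : 1 - (q : ℂ) / (b * x) ≠ 0 := by
    intro h
    rw [norm_div, norm_q h0, div_lt_one h0, ← sub_eq_zero.1 h, norm_one] at hZ'
    linarith
  have key := phiSum_contiguous h0 h1 hs hγ ha hb hc hd hxn hsq hA hB hZ'
  have nz : ∀ y : ℂ, y ≠ 0 → (∀ n : ℤ, y * (z * (q : ℂ) ^ n) ≠ 1) →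
      qPochInf q (q / (y * x)) ≠ 0 := by
    intro y hy hyz
    refine qPochInf_div_ne_zero h0 h1 (mul_ne_zero hy hxn) fun k hk => hyz (n - (k + 1)) ?_
    rw [← hk, hx, zpow_sub₀ hq, show (k : ℤ) + 1 = ((k + 1 : ℕ) : ℤ) by push_cast; rfl,
      zpow_natCast]
    ring
  have nzc := nz c hc hcz
  have nzd := nz d hd hdz
  have u1 : ∀ y : ℂ, qPochInf q (q / (y * x)) = (1 - q / (y * x)) * qPochInf q (q / (y * x) * q) :=
    fun y => qPochInf_eq h0 h1 _
  have u2 : ∀ y : ℂ, qPochInf q (q / (y * x) / q) =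
      (1 - 1 / (y * x)) * qPochInf q (q / (y * x)) := by
    intro y
    rw [qPochInf_eq h0 h1 (q / (y * x) / q), div_mul_cancel₀ _ hq]
    congr 2
    field_simp
  have f1 : ∀ y : ℂ, (∀ n : ℤ, y * (z * (q : ℂ) ^ n) ≠ 1) → 1 - 1 / (y * x) ≠ 0 := by
    intro y hy h
    have h' := sub_eq_zero.1 h
    rcases eq_or_ne (y * x) 0 with h'' | h''
    · rw [h''] at h'; simp at h'
    · apply hy n
      rw [← hx]
      rw [eq_div_iff h''] at h'
      simpa using h'
  have f1c := f1 c hcz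
  have f1d := f1 d hdz
  have hsγ : s * γ ≠ 0 := mul_ne_zero hs hγ
  set P := phiPre q s γ b c d z n with hP
  have Pm : A * phiPre q s γ b c d z (n - 1) =
      γ * (1 - q / (a * x)) * (1 - q / (c * x)) * (1 - q / (d * x)) * P := by
    have nc := nzc
    have nd := nzd
    rw [u1] at nc nd
    have nc1 := left_ne_zero_of_mul nc
    have nc2 := right_ne_zero_of_mul nc
    have nd1 := left_ne_zero_of_mul nd
    have nd2 := right_ne_zero_of_mul nd
    rw [hP, phiPre, phiPre, xm, ← hx, em, em, em, u1 b, u1 c, u1 d,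
      show -(n - 1) = -n + 1 by ring, zpow_add_one₀ hsγ, hA]
    generalize (q : ℂ) / (b * x) = Zb at *
    generalize (q : ℂ) / (c * x) = Zc at *
    generalize (q : ℂ) / (d * x) = Zd at *
    field_simp
  have Pp : B * phiPre q s γ b c d z (n + 1) = γ⁻¹ * (1 - q / (b * x) / q) * P := by
    rw [hP, phiPre, phiPre, xp, ← hx, ed, ed, ed, u2 b, u2 c, u2 d,
      show -(n + 1) = -n - 1 by ring, zpow_sub_one₀ hsγ, hB,
      show (q : ℂ) / (b * x) / q = 1 / (b * x) by field_simp]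
    generalize (1 : ℂ) / (c * x) = Wc at *
    generalize (1 : ℂ) / (d * x) = Wd at *
    generalize (1 : ℂ) / (b * x) = Wb at *
    field_simp
  simp only [phiSol]
  rw [xp, xm, ← hx, ed, ed, em, em, ← hP]
  set S1 := phiSum q s γ a c d (q ^ 2 * γ / (a * s * x) * q) (q / (b * x) * q)
  set S2 := phiSum q s γ a c d (q ^ 2 * γ / (a * s * x) / q) (q / (b * x) / q)
  set S3 := phiSum q s γ a c d (q ^ 2 * γ / (a * s * x)) (q / (b * x))
  linear_combination S1 / qPochInf q (q * γ ^ 2) * Pm + S2 / qPochInf q (q * γ ^ 2) * Pp +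
    P / qPochInf q (q * γ ^ 2) * key

/-- Only the first term of the series survives in the limit. -/
lemma tendsto_phiSum (h0 : 0 < q) (h1 : q < 1) (s γ a c d : ℂ) {D Z : ℕ → ℂ}
    (hD : Tendsto D atTop (𝓝 0)) (hZ : Tendsto Z atTop (𝓝 0)) :
    Tendsto (fun k => phiSum q s γ a c d (D k) (Z k)) atTop (𝓝 (qPochInf q (q * γ ^ 2))) := by
  obtain ⟨M, hM0, hM⟩ := exists_bound_phiTerm h0 h1 s a c d ‖γ‖ 1
  have : qPochInf q (q * γ ^ 2) = ∑' j : ℕ, if j = 0 then qPochInf q (q * γ ^ 2) else 0 := by simp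
  rw [this]
  have hD' : ∀ᶠ k in atTop, ‖D k‖ ≤ 1 := by
    filter_upwards [hD.norm.eventually (gt_mem_nhds (by simp : ‖(0 : ℂ)‖ < 1))] with k hk
      using hk.le
  have hZ' : ∀ᶠ k in atTop, ‖Z k‖ ≤ 1 / 2 := by
    filter_upwards [hZ.norm.eventually (gt_mem_nhds (by simp : ‖(0 : ℂ)‖ < 1 / 2))] with k hk
      using hk.le
  refine tendsto_tsum_of_dominated_convergence (bound := fun j : ℕ => M * (1 / 2) ^ j)
    ((summable_geometric_of_lt_one (by norm_num) (by norm_num)).mul_left M) (fun j => ?_) ?_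
  · have t1 : Tendsto (fun k => qPochInf q (D k * (q : ℂ) ^ j)) atTop (𝓝 1) :=
      tendsto_qPochInf_one h0 h1 (by simpa using hD.mul_const ((q : ℂ) ^ j))
    have t2 := (t1.const_mul (phiCoef q s γ a c d j)).mul (hZ.pow j)
    convert t2 using 2
    rcases j with _ | j
    · simp [phiCoef_zero]
    · simp
  · filter_upwards [hD', hZ'] with k h1 h2 j
    rw [norm_mul, norm_pow]
    gcongr
    exact hM γ (D k) le_rfl h1 j

lemma div_mul_zpow_neg (w y : ℂ) (k : ℕ) (q : ℂ) :
    w / (y * (z * q ^ (-(k : ℤ)))) = w / (y * z) * q ^ k := by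
  rw [zpow_neg, zpow_natCast, ← mul_assoc, ← div_eq_mul_inv, div_div_eq_mul_div, mul_div_right_comm]

/-- The asymptotic solution is equivalent to `(sγ)^k` at `z q^{-k}`, `k → ∞`. -/
lemma tendsto_phiSol_neg (h0 : 0 < q) (h1 : q < 1) (hs : s ≠ 0) (hγ : γ ≠ 0)
    (hγ2 : qPochInf q (q * γ ^ 2) ≠ 0) (a b c d z : ℂ) :
    Tendsto (fun k : ℕ => phiSol q s γ a b c d z (-k) / (s * γ) ^ k) atTop (𝓝 1) := by
  have hsγ : s * γ ≠ 0 := mul_ne_zero hs hγ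
  have t : ∀ w y : ℂ, Tendsto (fun k : ℕ => w / (y * (z * (q : ℂ) ^ (-(k : ℤ))))) atTop (𝓝 0) := by
    intro w y
    simp only [div_mul_zpow_neg]
    exact tendsto_mul_q_pow h0 h1 _
  have p := fun y => tendsto_qPochInf_one h0 h1 (t (q : ℂ) y)
  have hpre := (p b).div ((p c).mul (p d)) (by simp)
  have hsum := (tendsto_phiSum h0 h1 s γ a c d (t (q ^ 2 * γ) (a * s)) (t q b)).div_const
    (qPochInf q (q * γ ^ 2))
  rw [div_self hγ2] at hsum
  have := hpre.mul hsum
  simp only [mul_one, div_one] at this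
  refine this.congr fun k => ?_
  have hp : (s * γ) ^ k ≠ 0 := pow_ne_zero _ hsγ
  rw [phiSol, phiPre, neg_neg, zpow_natCast]
  simp only [Pi.div_apply]
  field_simp

lemma differentiableOn_phiSol (h0 : 0 < q) (h1 : q < 1) (hs : s ≠ 0) (a b c d z : ℂ) {n : ℤ}
    (hZ : ‖(q : ℂ) / (b * (z * (q : ℂ) ^ n))‖ < 1) :
    DifferentiableOn ℂ (fun γ => phiSol q s γ a b c d z n)
      {γ | γ ≠ 0 ∧ qPochInf q (q * γ ^ 2) ≠ 0} := by
  intro γ hγ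
  have d1 : DifferentiableAt ℂ (fun γ => phiPre q s γ b c d z n) γ := by
    unfold phiPre
    refine DifferentiableAt.mul_const ?_ _
    exact (differentiableAt_zpow.2 (Or.inl (mul_ne_zero hs hγ.1))).comp γ
      (differentiableAt_id.const_mul s)
  have d2 : Differentiable ℂ fun γ => phiSum q s γ a c d
      (q ^ 2 * γ / (a * s * (z * (q : ℂ) ^ n))) (q / (b * (z * (q : ℂ) ^ n))) := by
    have := differentiable_phiSum h0 h1 s a c d ((q : ℂ) ^ 2 / (a * s * (z * (q : ℂ) ^ n))) hZ
    simpa only [div_mul_eq_mul_div] using this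
  have d3 : Differentiable ℂ fun γ : ℂ => qPochInf q (q * γ ^ 2) :=
    (differentiable_qPochInf h0 h1).comp (by fun_prop : Differentiable ℂ fun γ : ℂ => q * γ ^ 2)
  exact (d1.mul (d2.differentiableAt.div d3.differentiableAt hγ.2)).differentiableWithinAt

/-- Comparison with the unregularized series, where that is defined. -/
lemma phi32_eq_phiSum (h0 : 0 < q) (h1 : q < 1) {D Z : ℂ} (hD : ∀ n : ℕ, D * (q : ℂ) ^ n ≠ 1)
    (hγ2 : ∀ n : ℕ, q * γ ^ 2 * (q : ℂ) ^ n ≠ 1) :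
    qPochInf q D * phi32 q (q * γ / s) (c * q * γ / (s * a)) (d * q * γ / (s * a)) D (q * γ ^ 2) Z =
      phiSum q s γ a c d D Z / qPochInf q (q * γ ^ 2) := by
  have hE := qPochInf_ne_zero h0 h1 hγ2
  rw [eq_div_iff hE, phi32, phiSum, ← tsum_mul_left, ← tsum_mul_right]
  refine tsum_congr fun j => ?_
  have e1 := qPoch_mul_qPochInf h0 h1 D j
  have e2 := qPoch_mul_qPochInf h0 h1 (q * γ ^ 2) j
  have n1 := qPoch_ne_zero hD j
  have n2 := qPoch_ne_zero hγ2 j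
  have n3 := qPoch_q_ne_zero h0 h1 j
  rw [phiCoef, ← e1, ← e2]
  field_simp

/-- Where the explicit formula is defined, it agrees with the regularized solution. -/
lemma phiSol_eq_PhiFormula (R : QLine) (p : Params) (ε : Bool) (γ : ℂ) (k : ℤ)
    (hD : ∀ n : ℕ, (R.q : ℂ) ^ 2 * γ / (p.a * R.s p * ((R.pt ε (-k) : ℝ) : ℂ)) * (R.q : ℂ) ^ n ≠ 1)
    (hγ2 : ∀ n : ℕ, (R.q : ℂ) * γ ^ 2 * (R.q : ℂ) ^ n ≠ 1) :
    phiSol R.q (R.s p) γ p.a p.b p.c p.d (R.z ε) (-k) = R.PhiFormula p ε γ k := by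
  have hx : ((R.pt ε (-k) : ℝ) : ℂ) = (R.z ε : ℂ) * (R.q : ℂ) ^ (-k) := by
    simp [QLine.pt]
  simp only [QLine.PhiFormula]
  rw [hx] at hD ⊢
  have := phi32_eq_phiSum (s := R.s p) (a := p.a) (c := p.c) (d := p.d)
    (Z := R.q / (p.b * (R.z ε * (R.q : ℂ) ^ (-k)))) R.q_pos R.q_lt_one hD hγ2
  rw [phiSol, phiPre, ← this, neg_neg]
  ring

end Asymptotic

/-! ### Three-term recurrences on `ℤ` -/

section Recurrence

/-- The two consecutive values `(f k, f (k+1))`, `k ≥ 0`, of the solution of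
`A n f (n-1) + B n f (n+1) + C n f n = 0` with `(f 0, f 1) = u`. -/
noncomputable def recFwd (A B C : ℤ → ℂ) (u : ℂ × ℂ) : ℕ → ℂ × ℂ
  | 0 => u
  | k + 1 => ((recFwd A B C u k).2,
      -(A (k + 1) * (recFwd A B C u k).1 + C (k + 1) * (recFwd A B C u k).2) / B (k + 1))

/-- The two consecutive values `(f (-k), f (-k+1))`, `k ≥ 0`, of the same solution. -/
noncomputable def recBwd (A B C : ℤ → ℂ) (u : ℂ × ℂ) : ℕ → ℂ × ℂ
  | 0 => u
  | k + 1 => (-(B (-k) * (recBwd A B C u k).2 + C (-k) * (recBwd A B C u k).1) / A (-k),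
      (recBwd A B C u k).1)

/-- The solution on `ℤ` of `A n f (n-1) + B n f (n+1) + C n f n = 0` with `(f 0, f 1) = u`. -/
noncomputable def recSol (A B C : ℤ → ℂ) (u : ℂ × ℂ) (n : ℤ) : ℂ :=
  if 0 ≤ n then (recFwd A B C u n.toNat).1 else (recBwd A B C u (-n).toNat).1

variable {A B C : ℤ → ℂ} {u : ℂ × ℂ}

lemma recSol_natCast (k : ℕ) : recSol A B C u k = (recFwd A B C u k).1 := by
  simp [recSol]

lemma recSol_neg_natCast (k : ℕ) : recSol A B C u (-k) = (recBwd A B C u k).1 := by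
  rcases k with _ | k
  · simp [recSol, recFwd, recBwd]
  · rw [recSol, if_neg (by push_cast; omega), neg_neg, Int.toNat_natCast]

lemma recSol_zero : recSol A B C u 0 = u.1 := recSol_natCast 0

lemma recSol_one : recSol A B C u 1 = u.2 := recSol_natCast 1

lemma recSol_spec (hA : ∀ n, A n ≠ 0) (hB : ∀ n, B n ≠ 0) (n : ℤ) :
    A n * recSol A B C u (n - 1) + B n * recSol A B C u (n + 1) + C n * recSol A B C u n = 0 := by
  rcases lt_or_ge 0 n with h | h
  · obtain ⟨k, rfl⟩ : ∃ k : ℕ, n = (k : ℤ) + 1 := ⟨(n - 1).toNat, by omega⟩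
    have e0 : recSol A B C u ((k : ℤ) + 1 - 1) = (recFwd A B C u k).1 := by
      rw [add_sub_cancel_right, recSol_natCast]
    have e1 : recSol A B C u ((k : ℤ) + 1) = (recFwd A B C u k).2 := recSol_natCast (k + 1)
    have e2 : recSol A B C u ((k : ℤ) + 1 + 1) = -(A (k + 1) * (recFwd A B C u k).1 +
      C (k + 1) * (recFwd A B C u k).2) / B (k + 1) := recSol_natCast (k + 2)
    rw [e0, e1, e2]
    have := hB (k + 1)
    field_simp
    ring
  · obtain ⟨k, rfl⟩ : ∃ k : ℕ, n = -(k : ℤ) := ⟨(-n).toNat, by omega⟩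
    have e0 : recSol A B C u (-(k : ℤ) - 1) = -(B (-k) * (recBwd A B C u k).2 +
        C (-k) * (recBwd A B C u k).1) / A (-k) := by
      rw [show -(k : ℤ) - 1 = -((k + 1 : ℕ) : ℤ) by push_cast; ring, recSol_neg_natCast]
      rfl
    have e2 : recSol A B C u (-(k : ℤ) + 1) = (recBwd A B C u k).2 := by
      rcases k with _ | k
      · simpa [recBwd] using recSol_one
      · rw [show -((k + 1 : ℕ) : ℤ) + 1 = -(k : ℤ) by push_cast; ring, recSol_neg_natCast]
        rfl
    rw [e0, e2, recSol_neg_natCast]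
    have := hA (-k)
    field_simp
    ring

/-- Two consecutive zeros force a solution of the recurrence to vanish. -/
lemma eq_zero_of_recurrence (hA : ∀ n, A n ≠ 0) (hB : ∀ n, B n ≠ 0) {f : ℤ → ℂ}
    (hf : ∀ n, A n * f (n - 1) + B n * f (n + 1) + C n * f n = 0) (N : ℤ) (h0 : f N = 0)
    (h1 : f (N + 1) = 0) (n : ℤ) : f n = 0 := by
  have up : ∀ k : ℕ, f (N + k) = 0 ∧ f (N + k + 1) = 0 := by
    intro k
    induction k with
    | zero => simpa using ⟨h0, h1⟩
    | succ k ih =>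
      have h := hf (N + k + 1)
      rw [add_sub_cancel_right, ih.1, ih.2, mul_zero, mul_zero, zero_add, add_zero] at h
      push_cast
      rw [← add_assoc]
      exact ⟨ih.2, (mul_eq_zero.1 h).resolve_left (hB _)⟩
  have down : ∀ k : ℕ, f (N - k) = 0 ∧ f (N - k + 1) = 0 := by
    intro k
    induction k with
    | zero => simpa using ⟨h0, h1⟩
    | succ k ih =>
      have h := hf (N - k)
      rw [ih.1, ih.2, mul_zero, mul_zero, add_zero, add_zero] at h
      push_cast
      rw [show N - ((k : ℤ) + 1) = N - k - 1 by ring, sub_add_cancel]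
      exact ⟨(mul_eq_zero.1 h).resolve_left (hA _), ih.1⟩
  rcases le_total N n with h | h
  · simpa [Int.toNat_of_nonneg (sub_nonneg.2 h)] using (up (n - N).toNat).1
  · simpa [Int.toNat_of_nonneg (sub_nonneg.2 h)] using (down (N - n).toNat).1

lemma differentiableOn_recSol {S : Set ℂ} {C : ℂ → ℤ → ℂ} {u : ℂ → ℂ × ℂ}
    (hC : ∀ n, DifferentiableOn ℂ (fun γ => C γ n) S) (hu : DifferentiableOn ℂ u S) (n : ℤ) :
    DifferentiableOn ℂ (fun γ => recSol A B (C γ) (u γ) n) S := by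
  have fwd : ∀ k, DifferentiableOn ℂ (fun γ => recFwd A B (C γ) (u γ) k) S := by
    intro k
    induction k with
    | zero => exact hu
    | succ k ih =>
      exact ih.snd.prodMk ((((ih.fst.const_mul _).add ((hC _).mul ih.snd)).neg).div_const _)
  have bwd : ∀ k, DifferentiableOn ℂ (fun γ => recBwd A B (C γ) (u γ) k) S := by
    intro k
    induction k with
    | zero => exact hu
    | succ k ih =>
      exact DifferentiableOn.prodMk
        ((((ih.snd.const_mul _).add ((hC _).mul ih.fst)).neg).div_const _) ih.fst
  unfold recSol
  split_ifs
  · exact (fwd _).fst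
  · exact (bwd _).fst

end Recurrence

/-! ### Slowly varying sequences -/

section SlowVariation

variable {E : Type*} [NormedAddCommGroup E] {q K : ℝ}

/-- Discrete Grönwall inequality for relative increments bounded by `K q^k`. -/
lemma norm_le_of_slow (h0 : 0 < q) (h1 : q < 1) (hK : 0 ≤ K) {v : ℕ → E}
    (hv : ∀ k, ‖v (k + 1) - v k‖ ≤ K * q ^ k * ‖v k‖) (k : ℕ) :
    ‖v k‖ ≤ Real.exp (K / (1 - q)) * ‖v 0‖ := by
  have h : ∀ k, ‖v k‖ ≤ Real.exp (∑ i ∈ Finset.range k, K * q ^ i) * ‖v 0‖ := by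
    intro k
    induction k with
    | zero => simp
    | succ k ih =>
      rw [Finset.sum_range_succ, Real.exp_add]
      calc ‖v (k + 1)‖ = ‖v k + (v (k + 1) - v k)‖ := by rw [add_sub_cancel]
        _ ≤ ‖v k‖ + K * q ^ k * ‖v k‖ := (norm_add_le _ _).trans (by gcongr; exact hv k)
        _ = (K * q ^ k + 1) * ‖v k‖ := by ring
        _ ≤ Real.exp (K * q ^ k) *
            (Real.exp (∑ i ∈ Finset.range k, K * q ^ i) * ‖v 0‖) := by
          gcongr
          exact Real.add_one_le_exp _
        _ = _ := by ring
  refine (h k).trans ?_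
  gcongr
  have hs := (summable_geometric_of_lt_one h0.le h1).mul_left K
  have := hs.sum_le_tsum (Finset.range k) (fun i _ => by positivity)
  rwa [tsum_mul_left, tsum_geometric_of_lt_one h0.le h1, ← div_eq_mul_inv] at this

variable [NormedSpace ℂ E] [CompleteSpace E]

/-- A family of sequences whose relative increments are summable, locally uniformly in a complex
parameter, converges to a holomorphic function of the parameter if its members are
holomorphic. -/
lemma exists_differentiableOn_limit (h0 : 0 < q) (h1 : q < 1) {S : Set ℂ} (hS : IsOpen S)
    {v : ℂ → ℕ → E} (hd : ∀ k, DifferentiableOn ℂ (fun γ => v γ k) S)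
    {κ : ℂ → ℝ} (hκ : ContinuousOn κ S) (hκ0 : ∀ γ ∈ S, 0 ≤ κ γ)
    (hv : ∀ γ ∈ S, ∀ k, ‖v γ (k + 1) - v γ k‖ ≤ κ γ * q ^ k * ‖v γ k‖) :
    ∃ l : ℂ → E, DifferentiableOn ℂ l S ∧ ∀ γ ∈ S, Tendsto (v γ) atTop (𝓝 (l γ)) := by
  have bound : ∀ γ ∈ S, ∀ k, ‖v γ (k + 1) - v γ k‖ ≤
      κ γ * (Real.exp (κ γ / (1 - q)) * ‖v γ 0‖) * q ^ k := by
    intro γ hγ k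
    calc _ ≤ κ γ * q ^ k * ‖v γ k‖ := hv γ hγ k
      _ ≤ κ γ * q ^ k * (Real.exp (κ γ / (1 - q)) * ‖v γ 0‖) := by
        have := hκ0 γ hγ
        gcongr
        exact norm_le_of_slow h0 h1 this (hv γ hγ) k
      _ = _ := by ring
  refine ⟨fun γ => v γ 0 + ∑' k, (v γ (k + 1) - v γ k), ?_, fun γ hγ => ?_⟩
  · intro γ₀ hγ₀
    let F : ℂ → ℝ := fun γ => κ γ * (Real.exp (κ γ / (1 - q)) * ‖v γ 0‖)
    have hF : ContinuousAt F γ₀ := by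
      have hκ' := hκ.continuousAt (hS.mem_nhds hγ₀)
      have hv' := ((hd 0).continuousOn.continuousAt (hS.mem_nhds hγ₀)).norm
      exact hκ'.mul ((Real.continuous_exp.continuousAt.comp (hκ'.div_const _)).mul hv')
    have hev : ∀ᶠ γ in 𝓝 γ₀, F γ < F γ₀ + 1 ∧ γ ∈ S :=
      (hF.eventually (gt_mem_nhds (lt_add_one _))).and (hS.mem_nhds hγ₀)
    obtain ⟨W, hW, hWo, hγW⟩ := eventually_nhds_iff.1 hev
    have : DifferentiableOn ℂ (fun γ => ∑' k, (v γ (k + 1) - v γ k)) W := by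
      refine Complex.differentiableOn_tsum_of_summable_norm (u := fun k => (F γ₀ + 1) * q ^ k)
        ((summable_geometric_of_lt_one h0.le h1).mul_left _) (fun k => ?_) hWo fun k γ hγ => ?_
      · exact ((hd (k + 1)).sub (hd k)).mono fun γ hγ => (hW γ hγ).2
      · refine (bound γ (hW γ hγ).2 k).trans ?_
        gcongr
        exact (hW γ hγ).1.le
    have hat := (this.differentiableAt (hWo.mem_nhds hγW))
    exact (((hd 0).differentiableAt (hS.mem_nhds hγ₀)).add hat).differentiableWithinAt
  · have hs : Summable fun k => v γ (k + 1) - v γ k :=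
      Summable.of_norm_bounded ((summable_geometric_of_lt_one h0.le h1).mul_left _) (bound γ hγ)
    have := hs.hasSum.tendsto_sum_nat.const_add (v γ 0)
    refine this.congr fun n => ?_
    rw [Finset.sum_range_sub, add_sub_cancel]

end SlowVariation

/-! ### The half-lines of `ℝ_q` -/

namespace QLine

variable (R : QLine) (p : Params)

/-- The point `z_ε q^n` as a complex number. -/
noncomputable def node (ε : Bool) (n : ℤ) : ℂ := (R.z ε : ℂ) * (R.q : ℂ) ^ n

/-- What the proof uses of the assumption that the parameters are generic: they and `s` do not
vanish, and none of their inverses lies in `ℝ_q`. -/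
structure Nondegenerate : Prop where
  a_ne : p.a ≠ 0
  b_ne : p.b ≠ 0
  c_ne : p.c ≠ 0
  d_ne : p.d ≠ 0
  s_ne : R.s p ≠ 0
  s_sq : R.s p ^ 2 = p.c * p.d * R.q / (p.a * p.b)
  a_node : ∀ ε n, p.a * R.node ε n ≠ 1
  b_node : ∀ ε n, p.b * R.node ε n ≠ 1
  c_node : ∀ ε n, p.c * R.node ε n ≠ 1
  d_node : ∀ ε n, p.d * R.node ε n ≠ 1

lemma q_ne : (R.q : ℂ) ≠ 0 := ofReal_ne_zero R.q_pos

lemma one_sub_q_ne : (1 - R.q : ℂ) ≠ 0 := by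
  have h : (1 - R.q : ℝ) ≠ 0 := (sub_pos.2 R.q_lt_one).ne'
  exact_mod_cast h

lemma z_real_ne (ε : Bool) : R.z ε ≠ 0 := by
  cases ε
  · exact R.zm_neg.ne
  · exact R.zp_pos.ne'

lemma z_ne (ε : Bool) : (R.z ε : ℂ) ≠ 0 := Complex.ofReal_ne_zero.2 (R.z_real_ne ε)

lemma node_ne (ε : Bool) (n : ℤ) : R.node ε n ≠ 0 := mul_ne_zero (R.z_ne ε) (zpow_ne_zero _ R.q_ne)

lemma coe_pt (ε : Bool) (n : ℤ) : (((R.pt ε n : R.Rq) : ℝ) : ℂ) = R.node ε n := by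
  simp [pt, node]

lemma node_add_one (ε : Bool) (n : ℤ) : R.node ε (n + 1) = R.node ε n * R.q := by
  rw [node, node, zpow_add_one₀ R.q_ne, mul_assoc]

lemma node_eq_sub_one_mul (ε : Bool) (n : ℤ) : R.node ε n = R.node ε (n - 1) * R.q := by
  rw [← node_add_one, sub_add_cancel]

lemma shift_pt (ε : Bool) (m n : ℤ) : R.shift m (R.pt ε n) = R.pt ε (n + m) := by
  ext
  simp [shift, pt, zpow_add₀ R.q_pos.ne', mul_assoc]

lemma exists_eq_pt (x : R.Rq) : ∃ ε n, x = R.pt ε n := by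
  obtain ⟨x, ε, n, rfl⟩ := x
  exact ⟨ε, n, rfl⟩

lemma pt_injective {ε ε' : Bool} {n n' : ℤ} (h : R.pt ε n = R.pt ε' n') : ε = ε' ∧ n = n' := by
  have h' : R.z ε * R.q ^ n = R.z ε' * R.q ^ n' := congrArg Subtype.val h
  have hp := zpow_pos R.q_pos n
  have hp' := zpow_pos R.q_pos n'
  have key : ε = ε' := by
    cases ε <;> cases ε' <;> try rfl
    · have h1 := mul_neg_of_neg_of_pos R.zm_neg hp
      have h2 := mul_pos R.zp_pos hp'
      simp only [z, if_true, if_false, Bool.false_eq_true] at h'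
      linarith
    · have h1 := mul_neg_of_neg_of_pos R.zm_neg hp'
      have h2 := mul_pos R.zp_pos hp
      simp only [z, if_true, if_false, Bool.false_eq_true] at h'
      linarith
  subst key
  exact ⟨rfl, zpow_right_injective₀ R.q_pos R.q_lt_one.ne (mul_left_cancel₀ (R.z_real_ne ε) h')⟩

/-- The function on `ℝ_q` with given restrictions to the two half-lines. -/
noncomputable def glue (F : Bool → ℤ → ℂ) (x : R.Rq) : ℂ :=
  F (R.exists_eq_pt x).choose (R.exists_eq_pt x).choose_spec.choose

lemma glue_pt (F : Bool → ℤ → ℂ) (ε : Bool) (n : ℤ) : R.glue F (R.pt ε n) = F ε n := by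
  have h := (R.exists_eq_pt (R.pt ε n)).choose_spec.choose_spec
  obtain ⟨h1, h2⟩ := R.pt_injective h
  exact congrArg₂ F h1.symm h2.symm

variable {R p}

lemma PairAdmissible.ne_zero {α β : ℂ} (h : R.PairAdmissible α β) (hne : α ≠ β) :
    α ≠ 0 ∧ β ≠ 0 := by
  rcases h.2 with h | ⟨r, t, k, rfl, rfl, h1, h2, -⟩ | ⟨r, t, k, rfl, rfl, -, h2, h3⟩
  · constructor
    · rintro rfl
      exact hne ((map_eq_zero _).1 h.symm).symm
    · rintro rfl
      exact hne (by simpa using h)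
  · have h0 := mul_pos R.zp_pos (zpow_pos R.q_pos k)
    have ht := h0.trans h1
    exact ⟨Complex.ofReal_ne_zero.2 (inv_pos.1 (ht.trans h2)).ne',
      Complex.ofReal_ne_zero.2 (inv_pos.1 ht).ne'⟩
  · have h0 := mul_neg_of_neg_of_pos R.zm_neg (zpow_pos R.q_pos k)
    have ht := h3.trans h0
    exact ⟨Complex.ofReal_ne_zero.2 (inv_lt_zero.1 (h2.trans ht)).ne,
      Complex.ofReal_ne_zero.2 (inv_lt_zero.1 ht).ne⟩

lemma PairAdmissible.mul_node_ne_one {α β : ℂ} (h : R.PairAdmissible α β) (ε : Bool) (n : ℤ) :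
    α * R.node ε n ≠ 1 ∧ β * R.node ε n ≠ 1 := by
  have key : ∀ y : ℂ, y ≠ (R.z ε : ℂ)⁻¹ * (R.q : ℂ) ^ (-n) → y * R.node ε n ≠ 1 := by
    intro y hy h1
    refine hy ?_
    rw [eq_inv_of_mul_eq_one_left h1, node, mul_inv, zpow_neg]
  exact ⟨key _ (h.1 ε (-n)).1, key _ (h.1 ε (-n)).2⟩

lemma InPgen.nondegenerate (h : R.InPgen p) : R.Nondegenerate p := by
  obtain ⟨⟨hab, hcd, hne⟩, hne', -⟩ := h
  obtain ⟨ha, hb⟩ := hab.ne_zero hne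
  obtain ⟨hc, hd⟩ := hcd.ne_zero hne'
  have hq := R.q_ne
  have hsq : R.s p ^ 2 = p.c * p.d * R.q / (p.a * p.b) := by
    rw [s, ← Complex.cpow_nat_mul]
    norm_num
  refine ⟨ha, hb, hc, hd, fun h0 => ?_, hsq, fun ε n => (hab.mul_node_ne_one ε n).1,
    fun ε n => (hab.mul_node_ne_one ε n).2, fun ε n => (hcd.mul_node_ne_one ε n).1,
    fun ε n => (hcd.mul_node_ne_one ε n).2⟩
  rw [h0] at hsq
  exact (div_ne_zero (mul_ne_zero (mul_ne_zero hc hd) hq) (mul_ne_zero ha hb))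
    (by rw [← hsq]; norm_num)

variable (R p)

/-- The coefficient `A` at `z_ε q^n`. -/
noncomputable def An (ε : Bool) (n : ℤ) : ℂ := R.A p (R.pt ε n)

/-- The coefficient `B` at `z_ε q^n`. -/
noncomputable def Bn (ε : Bool) (n : ℤ) : ℂ := R.B p (R.pt ε n)

/-- The coefficient of `f(x)` in `Lf - mf` at `x = z_ε q^n`. -/
noncomputable def Cn (ε : Bool) (m : ℂ) (n : ℤ) : ℂ := R.C p (R.pt ε n) - m

/-- The weight at `z_ε q^n`. -/
noncomputable def wn (ε : Bool) (n : ℤ) : ℂ := R.w p (R.pt ε n)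

/-- The factor of the Casorati determinant at `z_ε q^n`. -/
noncomputable def cw (ε : Bool) (n : ℤ) : ℂ :=
  R.u p (R.pt ε n) / ((1 - (R.q : ℂ)) * ((R.pt ε n : ℝ) : ℂ))

/-- `f` solves `Lf = mf` on the half-line through `z_ε`. -/
def IsHalfSol (ε : Bool) (m : ℂ) (f : ℤ → ℂ) : Prop :=
  ∀ n, R.An p ε n * f (n - 1) + R.Bn p ε n * f (n + 1) + R.Cn p ε m n * f n = 0

/-- The Casorati determinant at `z_ε q^n` of two functions on the half-line through `z_ε`. -/
noncomputable def hcas (ε : Bool) (f g : ℤ → ℂ) (n : ℤ) : ℂ :=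
  (f n * g (n + 1) - f (n + 1) * g n) * R.cw p ε n

/-- The `q`-derivative at `z_ε q^n`. -/
noncomputable def hDq (ε : Bool) (f : ℤ → ℂ) (n : ℤ) : ℂ :=
  (f n - f (n + 1)) / (R.node ε n * (1 - R.q))

/-- `f` and its `q`-derivative have the limits `l` and `l'` at the origin. -/
def HasDataAtZero (ε : Bool) (f : ℤ → ℂ) (l l' : ℂ) : Prop :=
  Tendsto f atTop (𝓝 l) ∧ Tendsto (R.hDq ε f) atTop (𝓝 l')

lemma An_eq (ε : Bool) (n : ℤ) : R.An p ε n =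
    (R.s p)⁻¹ * (1 - R.q / (p.a * R.node ε n)) * (1 - R.q / (p.b * R.node ε n)) := by
  rw [An, A, coe_pt]

lemma Bn_eq (ε : Bool) (n : ℤ) : R.Bn p ε n =
    R.s p * (1 - 1 / (p.c * R.node ε n)) * (1 - 1 / (p.d * R.node ε n)) := by
  rw [Bn, B, coe_pt]

lemma Cn_eq (ε : Bool) (m : ℂ) (n : ℤ) : R.Cn p ε m n =
    (R.s p)⁻¹ + R.s p - R.An p ε n - R.Bn p ε n - m := by
  rw [Cn, C, An, Bn]

lemma wn_eq (ε : Bool) (n : ℤ) : R.wn p ε n =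
    qPochInf R.q (p.a * R.node ε n) * qPochInf R.q (p.b * R.node ε n) /
    (qPochInf R.q (p.c * R.node ε n) * qPochInf R.q (p.d * R.node ε n)) := by
  rw [wn, w, coe_pt]

lemma cw_eq (ε : Bool) (n : ℤ) :
    R.cw p ε n = (1 - R.q) * R.Bn p ε n * R.node ε n * R.wn p ε n := by
  have := R.node_ne ε n
  have := R.one_sub_q_ne
  rw [cw, u, coe_pt, Bn, wn]
  field_simp

lemma apply_add_one (ε : Bool) (f : ℤ → ℂ) (n : ℤ) :
    f (n + 1) = f n - (1 - R.q) * R.node ε n * R.hDq ε f n := by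
  have := R.node_ne ε n
  have := R.one_sub_q_ne
  rw [hDq]
  field_simp
  ring

variable {R p} {ε : Bool} {m : ℂ} {f g : ℤ → ℂ}

namespace Nondegenerate

lemma An_ne (h : R.Nondegenerate p) (ε : Bool) (n : ℤ) : R.An p ε n ≠ 0 := by
  rw [An_eq]
  have hx := R.node_ne ε (n - 1)
  have hq := R.q_ne
  have key : ∀ y : ℂ, y ≠ 0 → y * R.node ε (n - 1) ≠ 1 →
      1 - R.q / (y * R.node ε n) ≠ 0 := by
    intro y hy hy1 h0
    rw [node_eq_sub_one_mul] at h0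
    field_simp at h0
    exact hy1 (by linear_combination h0)
  exact mul_ne_zero (mul_ne_zero (inv_ne_zero h.s_ne) (key _ h.a_ne (h.a_node ε _)))
    (key _ h.b_ne (h.b_node ε _))

lemma Bn_ne (h : R.Nondegenerate p) (ε : Bool) (n : ℤ) : R.Bn p ε n ≠ 0 := by
  rw [Bn_eq]
  have hx := R.node_ne ε n
  have key : ∀ y : ℂ, y ≠ 0 → y * R.node ε n ≠ 1 → 1 - 1 / (y * R.node ε n) ≠ 0 := by
    intro y hy hy1 h0
    field_simp at h0
    exact hy1 (by linear_combination h0)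
  exact mul_ne_zero (mul_ne_zero h.s_ne (key _ h.c_ne (h.c_node ε _)))
    (key _ h.d_ne (h.d_node ε _))

lemma qPochInf_node_ne {y : ℂ} (hy : ∀ ε n, y * R.node ε n ≠ 1) (ε : Bool) (n : ℤ) :
    qPochInf R.q (y * R.node ε n) ≠ 0 := by
  refine qPochInf_ne_zero R.q_pos R.q_lt_one fun k => ?_
  have := hy ε (n + k)
  rwa [node, zpow_add₀ R.q_ne, zpow_natCast, ← mul_assoc, ← mul_assoc, mul_assoc y] at this

lemma wn_ne (h : R.Nondegenerate p) (ε : Bool) (n : ℤ) : R.wn p ε n ≠ 0 := by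
  rw [wn_eq]
  exact div_ne_zero
    (mul_ne_zero (qPochInf_node_ne h.a_node ε n) (qPochInf_node_ne h.b_node ε n))
    (mul_ne_zero (qPochInf_node_ne h.c_node ε n) (qPochInf_node_ne h.d_node ε n))

lemma cw_ne (h : R.Nondegenerate p) (ε : Bool) (n : ℤ) : R.cw p ε n ≠ 0 := by
  rw [cw_eq]
  exact mul_ne_zero (mul_ne_zero (mul_ne_zero R.one_sub_q_ne (h.Bn_ne ε n)) (R.node_ne ε n))
    (h.wn_ne ε n)

/-- The Pearson equation of the weight. -/
lemma cw_sub_one (h : R.Nondegenerate p) (ε : Bool) (n : ℤ) :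
    R.Bn p ε n * R.cw p ε (n - 1) = R.An p ε n * R.cw p ε n := by
  rw [cw_eq, cw_eq, wn_eq, wn_eq, Bn_eq R p ε (n - 1), An_eq, R.node_eq_sub_one_mul ε n]
  set x := R.node ε (n - 1) with hx
  have hx0 : x ≠ 0 := R.node_ne ε _
  have hq := R.q_ne
  have := h.a_ne
  have := h.b_ne
  have := h.c_ne
  have := h.d_ne
  have hs := h.s_ne
  have hc := h.c_node ε (n - 1)
  have hd := h.d_node ε (n - 1)
  have hC := qPochInf_node_ne h.c_node ε n
  have hD := qPochInf_node_ne h.d_node ε n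
  rw [R.node_eq_sub_one_mul, ← hx] at hC hD
  rw [← hx] at hc hd
  have e : ∀ y, qPochInf R.q (y * x) = (1 - y * x) * qPochInf R.q (y * (x * R.q)) := by
    intro y
    rw [qPochInf_eq R.q_pos R.q_lt_one, mul_assoc]
  rw [e p.a, e p.b, e p.c, e p.d]
  have hc' : 1 - p.c * x ≠ 0 := fun h0 => hc (by linear_combination -h0)
  have hd' : 1 - p.d * x ≠ 0 := fun h0 => hd (by linear_combination -h0)
  have hsq := h.s_sq
  generalize R.s p = s at *
  generalize qPochInf R.q (p.a * (x * R.q)) = PA at *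
  generalize qPochInf R.q (p.b * (x * R.q)) = PB at *
  generalize qPochInf R.q (p.c * (x * R.q)) = PC at *
  generalize qPochInf R.q (p.d * (x * R.q)) = PD at *
  have e1 : s * (1 - 1 / (p.c * x)) * (1 - 1 / (p.d * x)) * x *
      ((1 - p.a * x) * PA * ((1 - p.b * x) * PB) / ((1 - p.c * x) * PC * ((1 - p.d * x) * PD))) =
      s⁻¹ * s ^ 2 / (p.c * p.d * x) * ((1 - p.a * x) * (1 - p.b * x)) * (PA * PB / (PC * PD)) := by
    have k3 : 1 - 1 / (p.c * x) = -(1 - p.c * x) / (p.c * x) := by field_simp; ring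
    have k4 : 1 - 1 / (p.d * x) = -(1 - p.d * x) / (p.d * x) := by field_simp; ring
    rw [k3, k4]
    generalize 1 - p.c * x = U at *
    generalize 1 - p.d * x = W at *
    field_simp
  have e2 : s⁻¹ * (1 - R.q / (p.a * (x * R.q))) * (1 - R.q / (p.b * (x * R.q))) * (x * R.q) *
      (PA * PB / (PC * PD)) = s⁻¹ * R.q / (p.a * p.b * x) * ((1 - p.a * x) * (1 - p.b * x)) *
        (PA * PB / (PC * PD)) := by
    field_simp
    ring
  have e3 : s⁻¹ * s ^ 2 / (p.c * p.d * x) = s⁻¹ * R.q / (p.a * p.b * x) := by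
    rw [hsq]
    field_simp
  rw [e3] at e1
  generalize R.Bn p ε n = B at *
  linear_combination (1 - R.q : ℂ) * B * e1 - (1 - R.q : ℂ) * B * e2

lemma hcas_eq_sub_one (h : R.Nondegenerate p) (hf : R.IsHalfSol p ε m f)
    (hg : R.IsHalfSol p ε m g) (n : ℤ) :
    R.hcas p ε f g n = R.hcas p ε f g (n - 1) := by
  have hB := h.Bn_ne ε n
  have e1 := hf n
  have e2 := hg n
  have e3 := h.cw_sub_one ε n
  rw [hcas, hcas, sub_add_cancel]
  refine mul_left_cancel₀ hB ?_
  linear_combination (R.cw p ε n * f n) * e2 - (R.cw p ε n * g n) * e1 -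
    (f (n - 1) * g n - f n * g (n - 1)) * e3

/-- The Casorati determinant of two solutions is constant. -/
lemma hcas_const (h : R.Nondegenerate p) (hf : R.IsHalfSol p ε m f)
    (hg : R.IsHalfSol p ε m g) (n : ℤ) :
    R.hcas p ε f g n = R.hcas p ε f g 0 := by
  induction n using Int.induction_on with
  | zero => rfl
  | succ k ih => rw [h.hcas_eq_sub_one hf hg, add_sub_cancel_right, ih]
  | pred k ih => rw [← h.hcas_eq_sub_one hf hg, ih]

lemma tendsto_node (ε : Bool) : Tendsto (R.node ε) atTop (𝓝 0) := by
  have := (tendsto_q_zpow R.q_pos R.q_lt_one).const_mul (R.z ε : ℂ)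
  rwa [mul_zero] at this

lemma tendsto_wn (ε : Bool) : Tendsto (R.wn p ε) atTop (𝓝 1) := by
  have t : ∀ y : ℂ, Tendsto (fun n => qPochInf R.q (y * R.node ε n)) atTop (𝓝 1) := fun y =>
    tendsto_qPochInf_one R.q_pos R.q_lt_one (by simpa using (tendsto_node ε).const_mul y)
  have := ((t p.a).mul (t p.b)).div ((t p.c).mul (t p.d)) (by norm_num)
  simp only [mul_one, div_one] at this
  exact this.congr fun n => (wn_eq R p ε n).symm

/-- The limit at the origin that turns Casorati determinants into determinants of data. -/
lemma tendsto_cw (h : R.Nondegenerate p) (ε : Bool) :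
    Tendsto (fun n => (1 - R.q) * R.node ε n * R.cw p ε n) atTop
      (𝓝 ((1 - R.q) ^ 2 * R.s p / (p.c * p.d))) := by
  have hx := tendsto_node (R := R) ε
  have hl : (1 - R.q : ℂ) ^ 2 * R.s p / (p.c * p.d) =
      (1 - R.q : ℂ) ^ 2 * R.s p * (0 - 1 / p.c) * (0 - 1 / p.d) * 1 := by
    have := h.c_ne
    have := h.d_ne
    field_simp
    ring
  rw [hl]
  refine Tendsto.congr (fun n => ?_) ((((hx.sub_const (1 / p.c)).const_mul
    ((1 - R.q : ℂ) ^ 2 * R.s p)).mul (hx.sub_const (1 / p.d))).mul (tendsto_wn (R := R) (p := p) ε))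
  have := R.node_ne ε n
  have := h.c_ne
  have := h.d_ne
  rw [cw_eq, Bn_eq]
  field_simp

/-- The Casorati determinant in terms of the data at the origin. -/
lemma hcas_eq_of_data (h : R.Nondegenerate p) {l l' k k' : ℂ} (hf : R.IsHalfSol p ε m f)
    (hg : R.IsHalfSol p ε m g)
    (hf0 : R.HasDataAtZero ε f l l') (hg0 : R.HasDataAtZero ε g k k') (n : ℤ) :
    R.hcas p ε f g n = (1 - R.q) ^ 2 * R.s p / (p.c * p.d) * (l' * k - l * k') := by
  have t := (h.tendsto_cw ε).mul ((hf0.2.mul hg0.1).sub (hf0.1.mul hg0.2))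
  refine tendsto_nhds_unique (tendsto_const_nhds.congr fun j => ?_) t
  rw [h.hcas_const hf hg n, ← h.hcas_const hf hg j, hcas]
  rw [R.apply_add_one ε f, R.apply_add_one ε g]
  ring

end Nondegenerate

/-! ### Solutions near the origin -/

lemma isHalfSol_recSol (h : R.Nondegenerate p) (ε : Bool) (m : ℂ) (u : ℂ × ℂ) :
    R.IsHalfSol p ε m (recSol (R.An p ε) (R.Bn p ε) (R.Cn p ε m) u) :=
  recSol_spec (h.An_ne ε) (h.Bn_ne ε)

lemma IsHalfSol.lin (hf : R.IsHalfSol p ε m f) (hg : R.IsHalfSol p ε m g) (α β : ℂ) :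
    R.IsHalfSol p ε m fun n => α * f n + β * g n := by
  intro n
  linear_combination α * hf n + β * hg n

lemma HasDataAtZero.lin {l l' k k' : ℂ} (hf : R.HasDataAtZero ε f l l')
    (hg : R.HasDataAtZero ε g k k') (α β : ℂ) :
    R.HasDataAtZero ε (fun n => α * f n + β * g n) (α * l + β * k) (α * l' + β * k') := by
  refine ⟨(hf.1.const_mul α).add (hg.1.const_mul β), ?_⟩
  refine ((hf.2.const_mul α).add (hg.2.const_mul β)).congr fun n => ?_
  simp only [hDq]
  ring

/-- A solution vanishes if its Casorati determinants with all solutions do. -/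
lemma IsHalfSol.eq_zero_of_hcas (h : R.Nondegenerate p) (hf : R.IsHalfSol p ε m f)
    (h0 : ∀ g, R.IsHalfSol p ε m g → R.hcas p ε f g 0 = 0) (n : ℤ) : f n = 0 := by
  have hc := h.cw_ne ε 0
  have e0 := h0 _ (isHalfSol_recSol h ε m (0, 1))
  have e1 := h0 _ (isHalfSol_recSol h ε m (1, 0))
  rw [hcas, zero_add, recSol_zero, recSol_one] at e0 e1
  have e0' := (mul_eq_zero.1 e0).resolve_right hc
  have e1' := (mul_eq_zero.1 e1).resolve_right hc
  simp only [mul_one, mul_zero, sub_zero, zero_sub, neg_eq_zero] at e0' e1'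
  exact eq_zero_of_recurrence (h.An_ne ε) (h.Bn_ne ε) hf 0 e0' (by simpa using e1') n

/-- The increments of the data of a solution at `z_ε q^k` are small relative to the data. -/
lemma exists_slow (h : R.Nondegenerate p) (ε : Bool) : ∃ κ : ℂ → ℝ, Continuous κ ∧
    (∀ m, 0 ≤ κ m) ∧ ∀ m f, R.IsHalfSol p ε m f → ∀ k : ℕ,
      ‖((f (k + 1), R.hDq ε f (k + 1)) - (f k, R.hDq ε f k) : ℂ × ℂ)‖ ≤
        κ m * R.q ^ k * ‖((f k, R.hDq ε f k) : ℂ × ℂ)‖ := by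
  have hq := R.q_ne
  have hq1 := R.one_sub_q_ne
  have ha := h.a_ne
  have hb := h.b_ne
  have hc := h.c_ne
  have hd := h.d_ne
  have hs := h.s_ne
  let y : ℕ → ℂ := fun k => R.node ε k
  have hy : Tendsto y atTop (𝓝 0) := (Nondegenerate.tendsto_node ε).comp tendsto_natCast_atTop_atTop
  let δ : ℕ → ℂ := fun k => (1 - p.c * (y k * R.q)) * (1 - p.d * (y k * R.q))
  have hδ0 : ∀ k, δ k ≠ 0 := by
    intro k
    have hc := h.c_node ε (k + 1)
    have hd := h.d_node ε (k + 1)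
    rw [node_add_one] at hc hd
    exact mul_ne_zero (sub_ne_zero.2 hc.symm) (sub_ne_zero.2 hd.symm)
  have hδ : Tendsto δ atTop (𝓝 1) := by
    have := (((hy.mul_const (R.q : ℂ)).const_mul p.c).const_sub 1).mul
      (((hy.mul_const (R.q : ℂ)).const_mul p.d).const_sub 1)
    simpa using this
  -- The recurrence at `q y` reads
  -- `D_q f(q y) - D_q f(y) = y (e₁ D_q f(y) - (m - s - 1/s) e₂ f(q y))` with bounded coefficients
  -- `e₁`, `e₂`; this uses `s² = cdq/ab`.
  let e₁ : ℕ → ℂ := fun k =>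
    (-p.a - p.b + p.c * R.q + p.d * R.q + (p.a * p.b - p.c * p.d * R.q ^ 2) * y k) / δ k
  let e₂ : ℕ → ℂ := fun k => p.c * p.d * R.q / (R.s p * (1 - R.q)) / δ k
  have bd : ∀ {e : ℕ → ℂ} {l : ℂ}, Tendsto e atTop (𝓝 l) → ∃ M : ℝ, 0 ≤ M ∧ ∀ k, ‖e k‖ ≤ M := by
    intro e l he
    obtain ⟨M, hM⟩ := (Metric.isBounded_range_of_tendsto e he).exists_norm_le
    exact ⟨M, (norm_nonneg _).trans (hM (e 0) ⟨0, rfl⟩), fun k => hM _ ⟨k, rfl⟩⟩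
  obtain ⟨M₁, hM₁, he₁⟩ := bd (((hy.const_mul (p.a * p.b - p.c * p.d * R.q ^ 2)).const_add
    (-p.a - p.b + p.c * R.q + p.d * R.q)).div hδ one_ne_zero : Tendsto e₁ atTop _)
  obtain ⟨M₂, hM₂, he₂⟩ := bd ((tendsto_const_nhds (x := p.c * p.d * R.q / (R.s p * (1 - R.q)))).div
    hδ one_ne_zero : Tendsto e₂ atTop _)
  let Z : ℝ := |R.z ε|
  have hZ : 0 ≤ Z := abs_nonneg _
  have hyn : ∀ k, ‖y k‖ = Z * R.q ^ k := by
    intro k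
    simp only [y, node, norm_mul, zpow_natCast, norm_pow, norm_q R.q_pos, Complex.norm_real,
      Real.norm_eq_abs, Z]
  have hq01 := R.q_pos
  have hq11 := R.q_lt_one
  have h1q : ‖(1 - R.q : ℂ)‖ ≤ 1 := by
    rw [← Complex.ofReal_one, ← Complex.ofReal_sub, Complex.norm_real, Real.norm_eq_abs, abs_le]
    constructor <;> linarith
  refine ⟨fun m => Z * (1 + M₁ + ‖m - R.s p - (R.s p)⁻¹‖ * M₂ * (1 + Z)), by fun_prop,
    fun m => by positivity, fun m f hf k => ?_⟩
  set V := ‖((f k, R.hDq ε f k) : ℂ × ℂ)‖ with hV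
  have hf0 : ‖f k‖ ≤ V := norm_fst_le ((f k, R.hDq ε f k) : ℂ × ℂ)
  have hg0 : ‖R.hDq ε f k‖ ≤ V := norm_snd_le ((f k, R.hDq ε f k) : ℂ × ℂ)
  have hV0 : 0 ≤ V := norm_nonneg _
  have hyk : y k ≠ 0 := R.node_ne ε k
  have hqk : R.q ^ k ≤ 1 := pow_le_one₀ hq01.le hq11.le
  have d₁ : f (k + 1) - f k = -((1 - R.q) * y k * R.hDq ε f k) := by
    rw [R.apply_add_one ε f]
    ring
  have n₁ : ‖f (k + 1) - f k‖ ≤ Z * R.q ^ k * V := by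
    rw [d₁, norm_neg, norm_mul, norm_mul, hyn]
    calc _ ≤ 1 * (Z * R.q ^ k) * V := by gcongr
      _ = _ := by ring
  have nf : ‖f (k + 1)‖ ≤ (1 + Z) * V := by
    calc ‖f (k + 1)‖ = ‖f k + (f (k + 1) - f k)‖ := by rw [add_sub_cancel]
      _ ≤ V + Z * R.q ^ k * V := (norm_add_le _ _).trans (add_le_add hf0 n₁)
      _ ≤ V + Z * 1 * V := by gcongr
      _ = _ := by ring
  have d₂ : R.hDq ε f (k + 1) - R.hDq ε f k =
      y k * (e₁ k * R.hDq ε f k - (m - R.s p - (R.s p)⁻¹) * e₂ k * f (k + 1)) := by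
    have hr := hf (k + 1)
    rw [add_sub_cancel_right, Cn_eq] at hr
    have hB := h.Bn_ne ε (k + 1)
    have hx : R.node ε (k + 1) = y k * R.q := R.node_add_one ε k
    have hA' : R.An p ε (k + 1) = (R.s p)⁻¹ * ((1 - p.a * y k) * (1 - p.b * y k)) /
        (p.a * p.b * y k ^ 2) := by
      rw [An_eq, hx]
      field_simp
      ring
    have hB' : R.Bn p ε (k + 1) = R.s p * δ k / (p.c * p.d * (y k * R.q) ^ 2) := by
      rw [Bn_eq, hx]
      simp only [δ]
      field_simp
      ring
    have hδk := hδ0 k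
    have hsq := h.s_sq
    have e₁' : e₁ k * y k = R.An p ε (k + 1) / (R.q * R.Bn p ε (k + 1)) - 1 := by
      have : R.An p ε (k + 1) / (R.q * R.Bn p ε (k + 1)) =
          (1 - p.a * y k) * (1 - p.b * y k) / δ k *
            (p.c * p.d * R.q / (p.a * p.b) / R.s p ^ 2) := by
        rw [hA', hB']
        field_simp
      rw [this, ← hsq, div_self (pow_ne_zero _ hs), mul_one, div_mul_eq_mul_div,
        eq_sub_iff_add_eq, div_add_one hδk, div_left_inj' hδk]
      simp only [δ]
      ring
    have e₂' : e₂ k * y k = 1 / ((1 - R.q) * (y k * R.q) * R.Bn p ε (k + 1)) := by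
      rw [hB']
      simp only [e₂]
      field_simp
    have g₁ : f (k : ℤ) = f (k + 1) + R.hDq ε f k * (y k * (1 - R.q)) := by
      rw [R.apply_add_one ε f]
      ring
    have g₂ : f ((k : ℤ) + 1 + 1) = f (k + 1) - R.hDq ε f (k + 1) * (y k * R.q * (1 - R.q)) := by
      rw [R.apply_add_one ε f, hx]
      ring
    have e₃ : R.hDq ε f (k + 1) = R.An p ε (k + 1) / (R.q * R.Bn p ε (k + 1)) * R.hDq ε f k -
        (m - R.s p - (R.s p)⁻¹) * (1 / ((1 - R.q) * (y k * R.q) * R.Bn p ε (k + 1))) *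
          f (k + 1) := by
      rw [g₁, g₂] at hr
      generalize R.hDq ε f (k + 1) = G at *
      generalize R.hDq ε f k = H at *
      generalize f (k + 1) = F at *
      generalize R.An p ε (k + 1) = A at *
      generalize R.Bn p ε (k + 1) = B at *
      generalize y k = Y at *
      generalize (R.s p)⁻¹ = σ at *
      field_simp
      linear_combination -hr
    rw [← e₂', sub_eq_iff_eq_add.1 e₁'.symm] at e₃
    linear_combination e₃
  have n₂ : ‖R.hDq ε f (k + 1) - R.hDq ε f k‖ ≤
      Z * R.q ^ k * ((M₁ + ‖m - R.s p - (R.s p)⁻¹‖ * M₂ * (1 + Z)) * V) := by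
    rw [d₂, norm_mul, hyn]
    refine mul_le_mul_of_nonneg_left ?_ (by positivity)
    refine (norm_sub_le _ _).trans ?_
    rw [norm_mul, norm_mul, norm_mul]
    calc _ ≤ M₁ * V + ‖m - R.s p - (R.s p)⁻¹‖ * M₂ * ((1 + Z) * V) := by
          gcongr
          · exact he₁ k
          · exact he₂ k
      _ = _ := by ring
  have hqk0 : 0 ≤ R.q ^ k := by positivity
  rw [Prod.mk_sub_mk, Prod.norm_mk, max_le_iff]
  constructor
  · refine n₁.trans ?_
    calc _ = Z * 1 * R.q ^ k * V := by ring
      _ ≤ Z * (1 + M₁ + ‖m - R.s p - (R.s p)⁻¹‖ * M₂ * (1 + Z)) * R.q ^ k * V := by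
        gcongr
        have : 0 ≤ ‖m - R.s p - (R.s p)⁻¹‖ * M₂ * (1 + Z) := by positivity
        linarith
  · refine n₂.trans ?_
    calc _ = Z * (M₁ + ‖m - R.s p - (R.s p)⁻¹‖ * M₂ * (1 + Z)) * R.q ^ k * V := by ring
      _ ≤ Z * (1 + M₁ + ‖m - R.s p - (R.s p)⁻¹‖ * M₂ * (1 + Z)) * R.q ^ k * V := by
        gcongr
        linarith

/-- The data at the origin of a holomorphic family of solutions exist and are holomorphic. -/
lemma exists_data (h : R.Nondegenerate p) (ε : Bool) {S : Set ℂ} (hS : IsOpen S) {m : ℂ → ℂ}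
    (hm : DifferentiableOn ℂ m S) {f : ℂ → ℤ → ℂ} (hd : ∀ n, DifferentiableOn ℂ (fun γ => f γ n) S)
    (hf : ∀ γ ∈ S, R.IsHalfSol p ε (m γ) (f γ)) :
    ∃ l l' : ℂ → ℂ, DifferentiableOn ℂ l S ∧ DifferentiableOn ℂ l' S ∧
      ∀ γ ∈ S, R.HasDataAtZero ε (f γ) (l γ) (l' γ) := by
  obtain ⟨κ, hκ, hκ0, hslow⟩ := exists_slow h ε
  obtain ⟨l, hl, hlim⟩ := exists_differentiableOn_limit (E := ℂ × ℂ) R.q_pos R.q_lt_one hS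
    (v := fun γ k => (f γ k, R.hDq ε (f γ) k))
    (fun k => (hd k).prodMk (((hd k).sub (hd (k + 1))).div_const _))
    (κ := fun γ => κ (m γ)) (hκ.comp_continuousOn hm.continuousOn) (fun γ _ => hκ0 _)
    (fun γ hγ k => by exact_mod_cast hslow (m γ) (f γ) (hf γ hγ) k)
  refine ⟨fun γ => (l γ).1, fun γ => (l γ).2, hl.fst, hl.snd, fun γ hγ => ?_⟩
  have := hlim γ hγ
  rw [nhds_prod_eq, tendsto_prod_iff'] at this
  constructor
  · rw [← Nat.map_cast_int_atTop, tendsto_map'_iff]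
    exact this.1
  · rw [← Nat.map_cast_int_atTop, tendsto_map'_iff]
    exact this.2

lemma IsHalfSol.exists_data (h : R.Nondegenerate p) (hf : R.IsHalfSol p ε m f) :
    ∃ l l', R.HasDataAtZero ε f l l' := by
  obtain ⟨l, l', -, -, h⟩ := QLine.exists_data h ε isOpen_univ (differentiableOn_const m)
    (f := fun _ => f) (fun n => differentiableOn_const _) (fun _ _ => hf)
  exact ⟨l 0, l' 0, h 0 (Set.mem_univ _)⟩

/-- A solution is determined by its data at the origin. -/
lemma IsHalfSol.eq_zero_of_data (h : R.Nondegenerate p) (hf : R.IsHalfSol p ε m f)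
    (hf0 : R.HasDataAtZero ε f 0 0) (n : ℤ) : f n = 0 := by
  refine hf.eq_zero_of_hcas h (fun g hg => ?_) n
  obtain ⟨k, k', hk⟩ := hg.exists_data h
  rw [h.hcas_eq_of_data hf hg hf0 hk]
  ring

/-- Solutions with prescribed holomorphic data at the origin exist and are holomorphic. -/
lemma exists_sol_of_data (h : R.Nondegenerate p) (ε : Bool) {S : Set ℂ} (hS : IsOpen S)
    {m : ℂ → ℂ} (hm : DifferentiableOn ℂ m S) {F F' : ℂ → ℂ} (hF : DifferentiableOn ℂ F S)
    (hF' : DifferentiableOn ℂ F' S) :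
    ∃ f : ℂ → ℤ → ℂ, (∀ n, DifferentiableOn ℂ (fun γ => f γ n) S) ∧ ∀ γ ∈ S,
      R.IsHalfSol p ε (m γ) (f γ) ∧ R.HasDataAtZero ε (f γ) (F γ) (F' γ) := by
  -- The data of the solutions with initial values `(1, 0)` and `(0, 1)` are linearly independent,
  -- as their determinant is a Casorati determinant; Cramer's rule gives the solution.
  let e : ℂ × ℂ → ℂ → ℤ → ℂ := fun u γ => recSol (R.An p ε) (R.Bn p ε) (R.Cn p ε (m γ)) u
  have he : ∀ u n, DifferentiableOn ℂ (fun γ => e u γ n) S := fun u n =>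
    differentiableOn_recSol (fun n => hm.const_sub _) (differentiableOn_const u) n
  have hsol : ∀ u γ, R.IsHalfSol p ε (m γ) (e u γ) := fun u γ => isHalfSol_recSol h ε _ u
  obtain ⟨l₀, l₀', dl₀, dl₀', hl₀⟩ := QLine.exists_data h ε hS hm (he (1, 0)) (fun γ _ => hsol _ γ)
  obtain ⟨l₁, l₁', dl₁, dl₁', hl₁⟩ := QLine.exists_data h ε hS hm (he (0, 1)) (fun γ _ => hsol _ γ)
  have hdet : ∀ γ ∈ S, (1 - R.q) ^ 2 * R.s p / (p.c * p.d) * (l₀' γ * l₁ γ - l₀ γ * l₁' γ) =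
      R.cw p ε 0 := by
    intro γ hγ
    rw [← h.hcas_eq_of_data (hsol _ γ) (hsol _ γ) (hl₀ γ hγ) (hl₁ γ hγ) 0]
    simp [hcas, e, recSol_zero, recSol_one, -zero_add, show (0 : ℤ) + 1 = 1 from rfl]
  have hdet0 : ∀ γ ∈ S, l₀' γ * l₁ γ - l₀ γ * l₁' γ ≠ 0 := fun γ hγ =>
    right_ne_zero_of_mul (by rw [hdet γ hγ]; exact h.cw_ne ε 0)
  refine ⟨fun γ n => (F' γ * l₁ γ - F γ * l₁' γ) / (l₀' γ * l₁ γ - l₀ γ * l₁' γ) * e (1, 0) γ n +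
    (l₀' γ * F γ - l₀ γ * F' γ) / (l₀' γ * l₁ γ - l₀ γ * l₁' γ) * e (0, 1) γ n, fun n => ?_,
    fun γ hγ => ⟨(hsol _ γ).lin (hsol _ γ) _ _, ?_⟩⟩
  · have dd := (dl₀'.mul dl₁).sub (dl₀.mul dl₁')
    exact ((((hF'.mul dl₁).sub (hF.mul dl₁')).div dd hdet0).mul (he _ n)).add
      ((((dl₀'.mul hF).sub (dl₀.mul hF')).div dd hdet0).mul (he _ n))
  · have := hdet0 γ hγ
    convert (hl₀ γ hγ).lin (hl₁ γ hγ) _ _ using 1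
    all_goals
      rw [div_mul_eq_mul_div, div_mul_eq_mul_div, ← add_div, eq_div_iff this]
      ring

variable {γ : ℂ}

/-! ### Regular spectral values -/

lemma sq_ne_zpow_of_mem_Sreg (hγ : γ ∈ R.Sreg) (k : ℤ) : γ ^ 2 ≠ (R.q : ℂ) ^ k := by
  intro h
  have hr : (((R.q ^ ((k : ℝ) / 2) : ℝ) : ℂ)) ^ 2 = (R.q : ℂ) ^ k := by
    rw [← Complex.ofReal_pow, ← Complex.ofReal_zpow, ← Real.rpow_natCast, ← Real.rpow_mul
      R.q_pos.le]
    norm_num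
  have : (γ - (R.q ^ ((k : ℝ) / 2) : ℝ)) * (γ + (R.q ^ ((k : ℝ) / 2) : ℝ)) = 0 := by
    linear_combination h - hr
  rcases mul_eq_zero.1 this with h' | h'
  · exact (hγ.2 k).1 (sub_eq_zero.1 h')
  · exact (hγ.2 k).2 (eq_neg_of_add_eq_zero_left h')

lemma mul_sq_mul_pow_ne_one (hγ : γ ∈ R.Sreg) (n : ℕ) :
    (R.q : ℂ) * γ ^ 2 * (R.q : ℂ) ^ n ≠ 1 := by
  intro h
  refine sq_ne_zpow_of_mem_Sreg hγ (-(n + 1 : ℕ)) ?_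
  have := R.q_ne
  rw [zpow_neg, zpow_natCast, pow_succ]
  field_simp
  linear_combination h

lemma qPochInf_q_mul_sq_ne (hγ : γ ∈ R.Sreg) : qPochInf R.q (R.q * γ ^ 2) ≠ 0 :=
  qPochInf_ne_zero R.q_pos R.q_lt_one (mul_sq_mul_pow_ne_one hγ)

/-- `S_reg` is the set where `γ ≠ 0` and `θ(γ²) ≠ 0`. -/
lemma Sreg_eq : R.Sreg = {γ | γ ≠ 0} ∩ (fun γ => theta R.q (γ ^ 2)) ⁻¹' {0}ᶜ := by
  have hq := R.q_ne
  ext γ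
  constructor
  · intro hγ
    refine ⟨hγ.1, mul_ne_zero ?_ ?_⟩
    · refine qPochInf_ne_zero R.q_pos R.q_lt_one fun n h => sq_ne_zpow_of_mem_Sreg hγ (-(n : ℤ)) ?_
      rw [zpow_neg, zpow_natCast]
      field_simp
      linear_combination h
    · refine qPochInf_ne_zero R.q_pos R.q_lt_one fun n h =>
        sq_ne_zpow_of_mem_Sreg hγ ((n + 1 : ℕ) : ℤ) ?_
      have := hγ.1
      rw [zpow_natCast, pow_succ]
      field_simp at h
      linear_combination -h
  · rintro ⟨h0, h⟩
    have key : ∀ k : ℤ, γ ^ 2 ≠ (R.q : ℂ) ^ k := by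
      intro k hk
      refine h (?_ : theta R.q (γ ^ 2) = 0)
      rw [theta, hk]
      rcases lt_or_ge 0 k with h1 | h1
      · obtain ⟨j, rfl⟩ : ∃ j : ℕ, k = ((j + 1 : ℕ) : ℤ) := ⟨(k - 1).toNat, by omega⟩
        rw [qPochInf_eq_zero R.q_pos R.q_lt_one (x := R.q / _) (n := j), mul_zero]
        rw [zpow_natCast, pow_succ]
        field_simp
      · obtain ⟨j, rfl⟩ : ∃ j : ℕ, k = -(j : ℤ) := ⟨(-k).toNat, by omega⟩
        rw [qPochInf_eq_zero R.q_pos R.q_lt_one (x := (R.q : ℂ) ^ _) (n := j), zero_mul]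
        rw [zpow_neg, zpow_natCast]
        field_simp
    have hr : ∀ k : ℤ, (((R.q ^ ((k : ℝ) / 2) : ℝ) : ℂ)) ^ 2 = (R.q : ℂ) ^ k := by
      intro k
      rw [← Complex.ofReal_pow, ← Complex.ofReal_zpow, ← Real.rpow_natCast, ← Real.rpow_mul
        R.q_pos.le]
      norm_num
    refine ⟨h0, fun k => ⟨?_, ?_⟩⟩
    · rintro rfl
      exact key k (hr k)
    · rintro rfl
      exact key k (by rw [neg_sq, hr k])

lemma differentiableAt_theta {x : ℂ} (hx : x ≠ 0) : DifferentiableAt ℂ (theta R.q) x := by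
  have h := differentiable_qPochInf R.q_pos R.q_lt_one
  exact (h x).mul ((h _).comp x ((differentiableAt_const _).div differentiableAt_id hx))

lemma isOpen_Sreg : IsOpen R.Sreg := by
  rw [Sreg_eq]
  refine ContinuousOn.isOpen_inter_preimage (fun γ hγ => ?_) isOpen_ne isOpen_compl_singleton
  exact ((differentiableAt_theta (pow_ne_zero 2 hγ)).continuousAt.comp (f := fun γ : ℂ => γ ^ 2)
    (continuous_pow 2).continuousAt).continuousWithinAt

/-- The complement of `S_reg` is countable. -/
lemma isPreconnected_Sreg : IsPreconnected R.Sreg := by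
  have hc : (R.Sregᶜ).Countable := by
    have : R.Sregᶜ ⊆ {0} ∪ (Set.range fun k : ℤ => ((R.q ^ ((k : ℝ) / 2) : ℝ) : ℂ)) ∪
        Set.range fun k : ℤ => -((R.q ^ ((k : ℝ) / 2) : ℝ) : ℂ) := by
      intro γ hγ
      by_contra h
      simp only [Set.mem_union, Set.mem_singleton_iff, Set.mem_range, not_or, not_exists] at h
      exact hγ ⟨h.1.1, fun k => ⟨fun e => h.1.2 k e.symm, fun e => h.2 k e.symm⟩⟩
    exact (((Set.countable_singleton 0).union (Set.countable_range _)).union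
      (Set.countable_range _)).mono this
  have := hc.isPathConnected_compl_of_one_lt_rank (by rw [Complex.rank_real_complex]; norm_num)
  rw [compl_compl] at this
  exact this.isConnected.isPreconnected

lemma ofReal_mul_I_mem_Sreg {r : ℝ} (hr : r ≠ 0) : (r : ℂ) * Complex.I ∈ R.Sreg := by
  refine ⟨mul_ne_zero (Complex.ofReal_ne_zero.2 hr) Complex.I_ne_zero, fun k => ⟨fun h => ?_,
    fun h => ?_⟩⟩
  · have := congrArg Complex.im h
    rw [Complex.ofReal_im] at this
    simp [hr] at this
  · have := congrArg Complex.im h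
    rw [Complex.neg_im, Complex.ofReal_im] at this
    simp [hr] at this

lemma differentiableOn_mu : DifferentiableOn ℂ mu R.Sreg := fun _ hγ =>
  (differentiableAt_id.add (differentiableAt_inv hγ.1)).differentiableWithinAt

/-! ### The asymptotic solution on a half-line -/

variable (R p) in
/-- The regularized asymptotic solution on the half-line through `z_ε`. -/
noncomputable def hphi (ε : Bool) (γ : ℂ) (n : ℤ) : ℂ :=
  phiSol R.q (R.s p) γ p.a p.b p.c p.d (R.z ε) n

lemma norm_div_node (b : ℂ) (ε : Bool) (n : ℤ) :
    ‖(R.q : ℂ) / (b * R.node ε n)‖ = ‖(R.q : ℂ) / (b * R.z ε)‖ / R.q ^ n := by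
  rw [node, norm_div, norm_mul, norm_mul, norm_zpow, norm_div, norm_mul, norm_q R.q_pos,
    div_div, mul_assoc]

lemma hphi_recurrence (h : R.Nondegenerate p) (hγ : γ ≠ 0) (ε : Bool) (n : ℤ)
    (hZ : ‖(R.q : ℂ) / (p.b * R.node ε (n + 1))‖ < 1) :
    R.An p ε n * R.hphi p ε γ (n - 1) + R.Bn p ε n * R.hphi p ε γ (n + 1) +
      R.Cn p ε (mu γ) n * R.hphi p ε γ n = 0 := by
  have := phiSol_recurrence R.q_pos R.q_lt_one h.s_ne hγ h.a_ne h.b_ne h.c_ne h.d_ne (R.z_ne ε)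
    h.s_sq (h.c_node ε) (h.d_node ε) n (x := R.node ε n) rfl (R.An_eq p ε n) (R.Bn_eq p ε n) hZ
  rw [Cn_eq, mu]
  simp only [hphi]
  linear_combination this

/-- The asymptotic solution extends to a solution on its half-line, holomorphically in `γ`. -/
lemma exists_extension (h : R.Nondegenerate p) (ε : Bool) : ∃ f : ℂ → ℤ → ℂ,
    (∀ n, DifferentiableOn ℂ (fun γ => f γ n) R.Sreg) ∧
    ∀ γ ∈ R.Sreg, R.IsHalfSol p ε (mu γ) (f γ) ∧
      ∀ n, ‖(R.q : ℂ) / (p.b * R.node ε n)‖ < 1 → f γ n = R.hphi p ε γ n := by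
  set c₀ := ‖(R.q : ℂ) / (p.b * R.z ε)‖ with hc₀
  have hc₀p : 0 < c₀ := norm_pos_iff.2 (div_ne_zero R.q_ne (mul_ne_zero h.b_ne (R.z_ne ε)))
  have hZ : ∀ n, ‖(R.q : ℂ) / (p.b * R.node ε n)‖ < 1 ↔ c₀ < R.q ^ n := fun n => by
    rw [norm_div_node, div_lt_one (zpow_pos R.q_pos n)]
  -- The series converges at `z q^n` precisely for `n ≤ N + 1`; the solution is continued from its
  -- values at `N` and `N + 1`, which determine it downwards as well.
  obtain ⟨N', hN'⟩ := exists_mem_Ioc_zpow (inv_pos.2 hc₀p) ((one_lt_inv₀ R.q_pos).2 R.q_lt_one)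
  obtain ⟨N, rfl⟩ : ∃ N, N' = N + 1 := ⟨N' - 1, by ring⟩
  have hN : ∀ n, c₀ < R.q ^ n ↔ n ≤ N + 1 := by
    have h1 : c₀ < R.q ^ (N + 1) := by
      have := hN'.1
      rwa [inv_zpow, inv_lt_inv₀ (zpow_pos R.q_pos _) hc₀p] at this
    have h2 : R.q ^ (N + 1 + 1) ≤ c₀ := by
      have := hN'.2
      rwa [inv_zpow, inv_le_inv₀ hc₀p (zpow_pos R.q_pos _)] at this
    intro n
    constructor
    · intro hn
      have := (zpow_lt_zpow_iff_right_of_lt_one₀ R.q_pos R.q_lt_one).1 (h2.trans_lt hn)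
      omega
    · intro hn
      exact h1.trans_le ((zpow_le_zpow_iff_right_of_lt_one₀ R.q_pos R.q_lt_one).2 hn)
  let f : ℂ → ℤ → ℂ := fun γ n => recSol (fun j => R.An p ε (j + N)) (fun j => R.Bn p ε (j + N))
    (fun j => R.Cn p ε (mu γ) (j + N)) (R.hphi p ε γ N, R.hphi p ε γ (N + 1)) (n - N)
  have hd : ∀ n ≤ N + 1, DifferentiableOn ℂ (fun γ => R.hphi p ε γ n) R.Sreg := fun n hn =>
    (differentiableOn_phiSol R.q_pos R.q_lt_one h.s_ne p.a p.b p.c p.d (R.z ε)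
      ((hZ n).2 ((hN n).2 hn))).mono fun γ hγ => ⟨hγ.1, qPochInf_q_mul_sq_ne hγ⟩
  have hf : ∀ γ, R.IsHalfSol p ε (mu γ) (f γ) := by
    intro γ n
    have := recSol_spec (A := fun j => R.An p ε (j + N)) (B := fun j => R.Bn p ε (j + N))
      (C := fun j => R.Cn p ε (mu γ) (j + N)) (u := (R.hphi p ε γ N, R.hphi p ε γ (N + 1)))
      (fun j => h.An_ne ε _) (fun j => h.Bn_ne ε _) (n - N)
    rw [sub_add_cancel, sub_right_comm, sub_add_eq_add_sub] at this
    exact this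
  refine ⟨f, fun n => differentiableOn_recSol (fun j => differentiableOn_mu.const_sub _)
    ((hd N (by omega)).prodMk (hd (N + 1) le_rfl)) _, fun γ hγ => ⟨hf γ, fun n hn => ?_⟩⟩
  have key : ∀ j : ℕ, f γ (N - j) = R.hphi p ε γ (N - j) ∧
      f γ (N - j + 1) = R.hphi p ε γ (N - j + 1) := by
    intro j
    induction j with
    | zero =>
      simp only [f, Nat.cast_zero, sub_zero, sub_self, recSol_zero, add_sub_cancel_left, recSol_one,
        and_self]
    | succ j ih =>
      push_cast
      rw [← sub_sub, sub_add_cancel]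
      refine ⟨?_, ih.1⟩
      have e1 := hf γ (N - j)
      have e2 := hphi_recurrence h hγ.1 ε (N - j) ((hZ _).2 ((hN _).2 (by omega)))
      rw [ih.1, ih.2] at e1
      exact mul_left_cancel₀ (h.An_ne ε (N - j)) (by linear_combination e1 - e2)
  have hn' := (hN n).1 ((hZ n).1 hn)
  rcases eq_or_lt_of_le hn' with rfl | hlt
  · simpa using (key 0).2
  · simpa [Int.toNat_of_nonneg (show 0 ≤ N - n by omega)] using (key (N - n).toNat).1

lemma eventually_norm_lt_one (b : ℂ) (ε : Bool) :
    ∀ᶠ k : ℕ in atTop, ‖(R.q : ℂ) / (b * R.node ε (-k))‖ < 1 := by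
  have : Tendsto (fun k : ℕ => ‖(R.q : ℂ) / (b * R.z ε)‖ * R.q ^ k) atTop (𝓝 0) := by
    simpa using (tendsto_pow_atTop_nhds_zero_of_lt_one R.q_pos.le R.q_lt_one).const_mul
      ‖(R.q : ℂ) / (b * R.z ε)‖
  filter_upwards [this.eventually (gt_mem_nhds one_pos)] with k hk
  rwa [norm_div_node, zpow_neg, zpow_natCast, div_inv_eq_mul]

/-! ### Eigenfunctions on `ℝ_q` -/

lemma tendsto_int_iff {F : ℤ → ℂ} {l : ℂ} :
    Tendsto F atTop (𝓝 l) ↔ Tendsto (fun k : ℕ => F k) atTop (𝓝 l) := by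
  rw [← Nat.map_cast_int_atTop, tendsto_map'_iff]
  rfl

lemma Dq_pt (F : R.Rq → ℂ) (ε : Bool) (n : ℤ) :
    R.Dq F (R.pt ε n) = R.hDq ε (fun n => F (R.pt ε n)) n := by
  rw [Dq, shift_pt, coe_pt, hDq]

lemma L_pt_sub (F : R.Rq → ℂ) (ε : Bool) (m : ℂ) (n : ℤ) :
    R.L p F (R.pt ε n) - m * F (R.pt ε n) = R.An p ε n * F (R.pt ε (n - 1)) +
      R.Bn p ε n * F (R.pt ε (n + 1)) + R.Cn p ε m n * F (R.pt ε n) := by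
  rw [L, shift_pt, shift_pt, An, Bn, Cn, ← sub_eq_add_neg]
  ring

/-- `V_m` in terms of the restrictions to the half-lines. -/
lemma mem_V_iff {F : R.Rq → ℂ} : F ∈ R.V p m ↔
    (∀ ε, R.IsHalfSol p ε m fun n => F (R.pt ε n)) ∧
      ∃ l l', ∀ ε, R.HasDataAtZero ε (fun n => F (R.pt ε n)) l l' := by
  constructor
  · rintro ⟨h, ⟨l, hl⟩, ⟨l', hl'⟩⟩
    refine ⟨fun ε n => by rw [← L_pt_sub, h, sub_self], l, l', fun ε => ?_⟩
    refine ⟨tendsto_int_iff.2 (hl ε), tendsto_int_iff.2 ?_⟩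
    simpa only [Dq_pt] using hl' ε
  · rintro ⟨h, l, l', hd⟩
    refine ⟨fun x => ?_, ⟨l, fun ε => tendsto_int_iff.1 (hd ε).1⟩,
      ⟨l', fun ε => by simpa only [Dq_pt] using tendsto_int_iff.1 (hd ε).2⟩⟩
    obtain ⟨ε, n, rfl⟩ := R.exists_eq_pt x
    exact sub_eq_zero.1 ((L_pt_sub F ε m n).trans (h ε n))

lemma casorati_pt (F G : R.Rq → ℂ) (ε : Bool) (n : ℤ) : R.casorati p F G (R.pt ε n) =
    R.hcas p ε (fun n => F (R.pt ε n)) (fun n => G (R.pt ε n)) n := by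
  rw [casorati, shift_pt, hcas, cw]

/-- An eigenfunction vanishing at two consecutive points of a half-line vanishes. -/
lemma eq_zero_of_mem_V (h : R.Nondegenerate p) {F : R.Rq → ℂ} (hF : F ∈ R.V p m) (N : ℤ)
    (h0 : F (R.pt ε N) = 0) (h1 : F (R.pt ε (N + 1)) = 0) (x : R.Rq) : F x = 0 := by
  obtain ⟨hs, l, l', hd⟩ := mem_V_iff.1 hF
  have hε : (fun n => F (R.pt ε n)) = fun _ => 0 := funext
    (eq_zero_of_recurrence (f := fun n => F (R.pt ε n)) (h.An_ne ε) (h.Bn_ne ε) (hs ε) N h0 h1)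
  have hd' := hd ε
  rw [hε] at hd'
  have hl : l = 0 := tendsto_nhds_unique hd'.1 tendsto_const_nhds
  have hl' : l' = 0 := tendsto_nhds_unique hd'.2
    (tendsto_const_nhds.congr fun n => by simp [hDq])
  subst hl hl'
  obtain ⟨ε', n, rfl⟩ := R.exists_eq_pt x
  exact (hs ε').eq_zero_of_data h (hd ε') n

lemma sub_mem_V {F G : R.Rq → ℂ} (hF : F ∈ R.V p m) (hG : G ∈ R.V p m) :
    (fun x => F x - G x) ∈ R.V p m := by
  rw [mem_V_iff] at *
  obtain ⟨hF, l, l', hFd⟩ := hF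
  obtain ⟨hG, k, k', hGd⟩ := hG
  refine ⟨fun ε => ?_, 1 * l + -1 * k, 1 * l' + -1 * k', fun ε => ?_⟩
  · convert (hF ε).lin (hG ε) 1 (-1) using 2
    ring
  · convert (hFd ε).lin (hGd ε) 1 (-1) using 2
    ring

/-! ### Asymptotics at infinity -/

/-- `θ(y z_ε)` vanishes only if `1/y` lies on the half-line. -/
lemma theta_z_ne {y : ℂ} (hy0 : y ≠ 0) (hy : ∀ ε n, y * R.node ε n ≠ 1) (ε : Bool) :
    theta R.q (y * R.z ε) ≠ 0 := by
  refine mul_ne_zero ?_ ?_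
  · simpa [node] using Nondegenerate.qPochInf_node_ne hy ε 0
  · refine qPochInf_div_ne_zero R.q_pos R.q_lt_one (mul_ne_zero hy0 (R.z_ne ε)) fun n => ?_
    have := hy ε (-(n + 1 : ℕ))
    rwa [node, zpow_neg, zpow_natCast, ← mul_assoc, ← div_eq_mul_inv] at this

lemma node_neg (ε : Bool) (k : ℕ) : R.node ε (-k) = R.z ε / (R.q : ℂ) ^ k := by
  rw [node, zpow_neg, zpow_natCast, div_eq_mul_inv]

/-- The weight at `z q^{-k}` is asymptotic to a multiple of `(q/s²)^k`. -/
lemma tendsto_wn_neg (h : R.Nondegenerate p) (ε : Bool) :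
    Tendsto (fun k : ℕ => R.wn p ε (-k) * (R.s p ^ 2 / R.q) ^ k) atTop
      (𝓝 (theta R.q (p.a * R.z ε) * theta R.q (p.b * R.z ε) /
        (theta R.q (p.c * R.z ε) * theta R.q (p.d * R.z ε)))) := by
  set θa := theta R.q (p.a * R.z ε) with hθa
  set θb := theta R.q (p.b * R.z ε) with hθb
  set θc := theta R.q (p.c * R.z ε) with hθc
  set θd := theta R.q (p.d * R.z ε) with hθd
  let P : ℂ → ℕ → ℂ := fun y k => qPochInf R.q (R.q / (y * R.z ε) * (R.q : ℂ) ^ k)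
  have tP : ∀ y, Tendsto (P y) atTop (𝓝 1) := fun y =>
    tendsto_qPochInf_one R.q_pos R.q_lt_one (tendsto_mul_q_pow R.q_pos R.q_lt_one _)
  have lim := (((tP p.c).mul (tP p.d)).div ((tP p.a).mul (tP p.b)) (by norm_num)).const_mul
    (θa * θb / (θc * θd))
  simp only [mul_one, div_one] at lim
  refine lim.congr fun k => ?_
  have key : ∀ y : ℂ, y ≠ 0 → (∀ ε n, y * R.node ε n ≠ 1) →
      P y k ≠ 0 ∧ qPochInf R.q (y * R.node ε (-k)) =
        (-(y * R.z ε)) ^ k * theta R.q (y * R.z ε) / (P y k * (R.q : ℂ) ^ (k.choose 2 + k)) := by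
    intro y hy0 hy
    have hyz := mul_ne_zero hy0 (R.z_ne ε)
    have e := theta_mul_zpow_neg R.q_pos R.q_lt_one hyz k
    have hne : P y k ≠ 0 := by
      intro h0
      rw [show qPochInf R.q (R.q / (y * R.z ε) * (R.q : ℂ) ^ k) = 0 from h0, mul_zero,
        zero_mul] at e
      exact mul_ne_zero (pow_ne_zero _ (neg_ne_zero.2 hyz)) (theta_z_ne hy0 hy ε) e.symm
    refine ⟨hne, ?_⟩
    rw [eq_div_iff (mul_ne_zero hne (pow_ne_zero _ R.q_ne)), ← e, node_neg, mul_div_assoc,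
      mul_assoc]
  obtain ⟨na, ea⟩ := key p.a h.a_ne h.a_node
  obtain ⟨nb, eb⟩ := key p.b h.b_ne h.b_node
  obtain ⟨nc, ec⟩ := key p.c h.c_ne h.c_node
  obtain ⟨nd, ed⟩ := key p.d h.d_ne h.d_node
  have tc : θc ≠ 0 := theta_z_ne h.c_ne h.c_node ε
  have td : θd ≠ 0 := theta_z_ne h.d_ne h.d_node ε
  have ha := h.a_ne
  have hb := h.b_ne
  have hc := h.c_ne
  have hd := h.d_ne
  have hq := R.q_ne
  have hz := R.z_ne ε
  rw [wn_eq, ea, eb, ec, ed, ← hθa, ← hθb, ← hθc, ← hθd, h.s_sq, neg_pow, neg_pow (p.b * _),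
    neg_pow (p.c * _), neg_pow (p.d * _)]
  have h1 : ((-1 : ℂ)) ^ k ≠ 0 := pow_ne_zero _ (by norm_num)
  have hQ : (R.q : ℂ) ^ (k.choose 2 + k) ≠ 0 := pow_ne_zero _ hq
  simp only [Pi.div_apply]
  generalize ((-1 : ℂ)) ^ k = I at *
  generalize P p.a k = Pa at *
  generalize P p.b k = Pb at *
  generalize P p.c k = Pc at *
  generalize P p.d k = Pd at *
  generalize (R.q : ℂ) ^ (k.choose 2 + k) = Q at *
  rw [show p.c * p.d * R.q / (p.a * p.b) / R.q = p.c * p.d / (p.a * p.b) by field_simp]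
  simp only [mul_pow, div_pow]
  field_simp

/-- The factor of the Casorati determinant at `z q^{-k}` is asymptotic to a multiple of
`s^{-2k}`. -/
lemma exists_tendsto_cw_neg (h : R.Nondegenerate p) (ε : Bool) :
    ∃ l, Tendsto (fun k : ℕ => R.cw p ε (-k) * (R.s p ^ 2) ^ k) atTop (𝓝 l) := by
  have hq := R.q_ne
  have t : ∀ y : ℂ, Tendsto (fun k : ℕ => 1 - 1 / (y * R.node ε (-k))) atTop (𝓝 1) := by
    intro y
    have := (tendsto_mul_q_pow R.q_pos R.q_lt_one (1 / (y * R.z ε))).const_sub 1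
    rw [sub_zero] at this
    refine this.congr fun k => ?_
    rw [node, div_mul_zpow_neg]
  have := ((((t p.c).const_mul (R.s p)).mul (t p.d)).mul (tendsto_wn_neg h ε)).const_mul
    ((1 - R.q) * (R.z ε : ℂ))
  refine ⟨_, this.congr fun k => ?_⟩
  rw [cw_eq, Bn_eq, node_neg, div_pow]
  have : (R.q : ℂ) ^ k ≠ 0 := pow_ne_zero _ hq
  field_simp

/-- For `|γ| < 1` the solutions of size `(sγ)^k` at `z q^{-k}` are unique up to a constant. -/
lemma IsHalfSol.eq_mul_of_tendsto (h : R.Nondegenerate p) (hf : R.IsHalfSol p ε m f)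
    (hg : R.IsHalfSol p ε m g) (hγ : γ ≠ 0) (hγ1 : ‖γ‖ < 1) {κ : ℂ}
    (hf1 : Tendsto (fun k : ℕ => f (-k) / (R.s p * γ) ^ k) atTop (𝓝 1))
    (hg1 : Tendsto (fun k : ℕ => g (-k) / (R.s p * γ) ^ k) atTop (𝓝 κ)) (n : ℤ) :
    g n = κ * f n := by
  have hs := h.s_ne
  -- At `z q^{-k}` the Casorati determinant is of size `(sγ)^{2k+1} s^{-2k}`, which tends to `0`;
  -- hence it vanishes, and the solutions are proportional.
  have hcas0 : R.hcas p ε f g 0 = 0 := by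
    obtain ⟨l, hl⟩ := exists_tendsto_cw_neg h ε
    have tγ : Tendsto (fun k : ℕ => γ ^ (2 * k + 1) / R.s p) atTop (𝓝 (0 / R.s p)) :=
      ((tendsto_pow_atTop_nhds_zero_of_norm_lt_one hγ1).comp
        (tendsto_atTop_mono (fun k => show k ≤ 2 * k + 1 by omega) tendsto_id)).div_const _
    have sh := tendsto_add_atTop_nat 1
    have lim := ((((hf1.comp sh).mul hg1).sub (hf1.mul (hg1.comp sh))).mul (hl.comp sh)).mul tγ
    rw [zero_div, mul_zero] at lim
    refine tendsto_nhds_unique (tendsto_const_nhds.congr fun k => ?_) lim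
    rw [← h.hcas_const hf hg (-((k + 1 : ℕ) : ℤ)), hcas,
      show -((k + 1 : ℕ) : ℤ) + 1 = -(k : ℤ) by push_cast; ring]
    simp only [Function.comp_apply]
    have e : R.s p ^ 2 = R.s p * R.s p := sq _
    have h1 := pow_ne_zero k hs
    have h2 := pow_ne_zero k hγ
    rw [mul_pow, mul_pow, e, mul_pow, pow_succ, pow_succ, pow_succ γ (2 * k), two_mul, pow_add]
    field_simp
  obtain ⟨k, hk⟩ := (hf1.eventually_ne one_ne_zero).exists
  have hk0 : f (-k) ≠ 0 := fun h0 => hk (by rw [h0, zero_div])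
  have hW := h.hcas_const hf hg (-k)
  rw [hcas0, hcas] at hW
  have hW' := (mul_eq_zero.1 hW).resolve_right (h.cw_ne ε _)
  have key : ∀ n, 1 * g n + -(g (-k) / f (-k)) * f n = 0 := by
    refine eq_zero_of_recurrence (h.An_ne ε) (h.Bn_ne ε) (hg.lin hf _ _) (-k) ?_ ?_
    · field_simp
      ring
    · field_simp
      linear_combination hW'
  have key' : ∀ n, g n = g (-k) / f (-k) * f n := fun n => by linear_combination key n
  have : κ = g (-k) / f (-k) := by
    refine tendsto_nhds_unique hg1 ?_
    have := hf1.const_mul (g (-k) / f (-k))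
    rw [mul_one] at this
    refine this.congr fun j => ?_
    rw [key' (-j), mul_div_assoc]
  rw [this]
  exact key' n

lemma summable_norm_mul_pow {t : ℕ → ℂ} {l ρ : ℂ} (ht : Tendsto t atTop (𝓝 l)) (hρ : ‖ρ‖ < 1) :
    Summable fun k => ‖t k * ρ ^ k‖ := by
  obtain ⟨M, hM⟩ := (Metric.isBounded_range_of_tendsto t ht).exists_norm_le
  refine Summable.of_nonneg_of_le (fun _ => norm_nonneg _) (fun k => ?_)
    ((summable_geometric_of_lt_one (norm_nonneg ρ) hρ).mul_left M)
  rw [norm_mul, norm_pow]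
  gcongr
  exact hM _ ⟨k, rfl⟩

/-- Solutions of size `(sγ)^k` at `z q^{-k}` are square integrable if `|γ| < 1`. -/
lemma summable_of_tendsto (h : R.Nondegenerate p) {l l' : ℂ} (hf0 : R.HasDataAtZero ε f l l')
    (hγ : γ ≠ 0) (hγ1 : ‖γ‖ < 1)
    (hf1 : Tendsto (fun k : ℕ => f (-k) / (R.s p * γ) ^ k) atTop (𝓝 1)) :
    Summable fun k : ℤ => ‖(‖f k‖ : ℂ) ^ 2 * R.wn p ε k * R.node ε k‖ := by
  have e : ∀ k, ‖(‖f k‖ : ℂ) ^ 2 * R.wn p ε k * R.node ε k‖ =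
      ‖f k ^ 2 * R.wn p ε k * R.node ε k‖ := by
    intro k
    simp only [norm_mul, norm_pow, Complex.norm_real, norm_norm]
  simp only [e]
  have hq := R.q_ne
  have hs := h.s_ne
  refine Summable.of_nat_of_neg ?_ ?_
  · have t := (((tendsto_int_iff.1 hf0.1).pow 2).mul
      (tendsto_int_iff.1 (Nondegenerate.tendsto_wn (R := R) (p := p) ε))).mul_const (R.z ε : ℂ)
    refine (summable_norm_mul_pow t (ρ := R.q) ?_).congr fun k => ?_
    · rw [norm_q R.q_pos]
      exact R.q_lt_one
    · rw [node, zpow_natCast, mul_assoc (_ * _)]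
  · have t := ((hf1.pow 2).mul (tendsto_wn_neg h ε)).mul_const (R.z ε : ℂ)
    refine (summable_norm_mul_pow t (ρ := γ ^ 2) ?_).congr fun k => ?_
    · rw [norm_pow]
      exact pow_lt_one₀ (norm_nonneg _) hγ1 two_ne_zero
    · have h1 := pow_ne_zero k hs
      have h2 := pow_ne_zero k hγ
      have h3 := pow_ne_zero k hq
      congr 1
      rw [node_neg]
      simp only [mul_pow, div_pow, ← pow_mul, mul_comm 2 k]
      field_simp

/-! ### The Casorati determinant for small `γ` -/

lemma theta_inv {r : ℂ} (hr : r ≠ 0) : theta R.q r⁻¹ = -(theta R.q r / r) := by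
  have hq := R.q_ne
  have e := theta_div R.q_pos (mul_ne_zero hr hq)
  rw [show (R.q : ℂ) / (r * R.q) = r⁻¹ by field_simp] at e
  rw [e, theta_mul_q R.q_pos R.q_lt_one hr]
  field_simp

/-- The determinant of the data of `conv`: the formula `bilDet_eq` at `x = 1/z_+`, `y = 1/z_-`,
rewritten by means of `s² = cdq/ab` and the quasi-periodicity of the theta function. -/
lemma convSum_det (h : R.Nondegenerate p) (hγ : γ ≠ 0) (ht : ‖R.s p * γ‖ < 1)
    (he : ‖R.q * γ / R.s p‖ < R.q ^ 2) :
    qPochInf R.q (γ / R.s p) * qPochInf R.q (R.s p * γ) *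
      (convSum R.q (R.s p) γ p.a p.b p.c p.d R.zp 1 * convSum R.q (R.s p) γ p.a p.b p.c p.d R.zm 0 -
        convSum R.q (R.s p) γ p.a p.b p.c p.d R.zp 0 *
          convSum R.q (R.s p) γ p.a p.b p.c p.d R.zm 1) =
      qPochInf R.q (p.c * R.q * γ / (p.a * R.s p)) * qPochInf R.q (p.d * R.q * γ / (p.a * R.s p)) *
      (qPochInf R.q (p.c * R.q * γ / (p.b * R.s p)) *
        qPochInf R.q (p.d * R.q * γ / (p.b * R.s p))) *
      (p.a * p.b * R.s p * R.zp / (R.q ^ 2 * γ) * qPochInf R.q R.q ^ 2 *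
        (theta R.q (R.zm / R.zp) * theta R.q (p.a * p.b * R.s p * R.zm * R.zp / (R.q * γ)))) := by
  have ha := h.a_ne
  have hb := h.b_ne
  have hc := h.c_ne
  have hd := h.d_ne
  have hs := h.s_ne
  have hq := R.q_ne
  have hzp : (R.zp : ℂ) ≠ 0 := R.z_ne true
  have hzm : (R.zm : ℂ) ≠ 0 := R.z_ne false
  have hsq := h.s_sq
  have hcd : p.c * p.d = R.s p ^ 2 * (p.a * p.b) / R.q := by
    rw [hsq]
    field_simp
  have hh : R.s p * γ * R.q ^ 2 / (p.c * p.d) ≠ 0 := by positivity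
  have e1 : R.q ^ 2 * γ / (p.a * R.s p) * (R.q ^ 2 * γ / (p.b * R.s p)) =
      γ / R.s p * (R.q * (R.s p * γ * R.q ^ 2 / (p.c * p.d))) := by
    rw [hcd]
    field_simp
  have e2 : R.s p * γ * R.q ^ 2 / (p.c * p.d) * p.c * p.d = R.s p * γ * R.q ^ 2 := by
    field_simp
  have hq0 : ‖(R.q : ℂ)‖ = R.q := norm_q R.q_pos
  have hb1 : ‖γ / R.s p‖ < 1 := by
    rw [mul_div_assoc, norm_mul, hq0, sq] at he
    exact (lt_of_mul_lt_mul_left he R.q_pos.le).trans R.q_lt_one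
  have key := bilDet_eq R.q_pos R.q_lt_one (h := R.s p * γ * R.q ^ 2 / (p.c * p.d))
    (x := (R.zp : ℂ)⁻¹) (y := (R.zm : ℂ)⁻¹) (b₁ := R.q ^ 2 * γ / (p.a * R.s p))
    (b₂ := R.q ^ 2 * γ / (p.b * R.s p)) (α₁ := p.c) (α₂ := p.d) hh (inv_ne_zero hzp)
    (inv_ne_zero hzm) ?_ ?_
  · rw [e1, e2, mul_div_cancel_right₀ _ (mul_ne_zero hq hh),
      mul_div_cancel_right₀ _ (pow_ne_zero 2 hq)] at key
    have e3 : ∀ y w : ℂ, w ≠ 0 →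
        R.q ^ 2 * γ / (w * R.s p) * y / R.q = y * R.q * γ / (w * R.s p) := by
      intro y w hw
      field_simp
    rw [e3 _ _ ha, e3 _ _ ha, e3 _ _ hb, e3 _ _ hb] at key
    have e4 : (R.zm : ℂ)⁻¹ / (R.zp : ℂ)⁻¹ = (R.zm / R.zp : ℂ)⁻¹ := by
      field_simp
    set u := p.a * p.b * R.s p * R.zm * R.zp / (R.q * γ) with hu
    have hu0 : u ≠ 0 := by positivity
    have e5 : R.s p * γ * R.q ^ 2 / (p.c * p.d) * (R.zp : ℂ)⁻¹ * (R.zm : ℂ)⁻¹ = R.q / u * R.q := by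
      rw [hcd, hu]
      field_simp
    have e6 : theta R.q (R.q / u * R.q) = -(u / R.q * theta R.q u) := by
      have := theta_mul_q R.q_pos R.q_lt_one (div_ne_zero hq hu0)
      rw [theta_div R.q_pos hu0] at this
      rw [this]
      field_simp
    rw [e4, e5, e6, theta_inv (div_ne_zero hzm hzp)] at key
    refine key.trans ?_
    rw [show ∀ t₁ t₂ P : ℂ, (R.zp : ℂ)⁻¹ * P ^ 2 * (-(t₁ / (R.zm / R.zp)) * -(u / R.q * t₂)) =
      p.a * p.b * R.s p * R.zp / (R.q ^ 2 * γ) * P ^ 2 * (t₁ * t₂) by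
        intro t₁ t₂ P
        rw [hu]
        field_simp]
  · rw [e2, norm_mul, norm_pow, hq0]
    exact mul_lt_of_lt_one_left (pow_pos R.q_pos 2) ht
  · rw [e1, norm_mul, norm_mul (R.q : ℂ), hq0, mul_comm R.q]
    exact mul_lt_of_lt_one_left (mul_pos (norm_pos_iff.2 hh) R.q_pos) hb1

/-- The Casorati determinant of the two asymptotic solutions for small `γ`. -/
lemma det_eq_v_of_small (h : R.Nondegenerate p) (hγ : γ ∈ R.Sreg) (hγ1 : ‖γ‖ < 1)
    (ht : ‖R.s p * γ‖ < 1) (he : ‖R.q * γ / R.s p‖ < R.q ^ 2) {f : Bool → ℤ → ℂ}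
    {l l' : Bool → ℂ} (hf : ∀ ε, R.IsHalfSol p ε (mu γ) (f ε))
    (hf0 : ∀ ε, R.HasDataAtZero ε (f ε) (l ε) (l' ε))
    (hf1 : ∀ ε, Tendsto (fun k : ℕ => f ε (-k) / (R.s p * γ) ^ k) atTop (𝓝 1)) :
    (1 - R.q) ^ 2 * R.s p / (p.c * p.d) * (l' true * l false - l true * l' false) = R.v p γ := by
  have hγ0 := hγ.1
  have ha := h.a_ne
  have hb := h.b_ne
  have hc := h.c_ne
  have hd := h.d_ne
  have hs := h.s_ne
  have hq := R.q_ne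
  have h1q := R.one_sub_q_ne
  set K := ∑' j : ℕ, ker R.q (R.q * γ / R.s p) j * (R.s p * γ) ^ j with hKdef
  let κ : Bool → ℂ := fun ε => theta R.q (p.c * R.z ε) * theta R.q (p.d * R.z ε) * K
  let cv : Bool → ℤ → ℂ := fun ε => conv R.q (R.s p) γ p.a p.b p.c p.d (R.z ε)
  have hcv : ∀ ε, R.IsHalfSol p ε (mu γ) (cv ε) := by
    intro ε n
    have := conv_recurrence R.q_pos R.q_lt_one hs hγ0 ha hb hc hd (R.z_ne ε) h.s_sq ht he n
      (x := R.node ε n) rfl (R.An_eq p ε n) (R.Bn_eq p ε n)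
    rw [Cn_eq, mu]
    simp only [cv]
    linear_combination this
  have hcv1 : ∀ ε, Tendsto (fun k : ℕ => cv ε (-k) / (R.s p * γ) ^ k) atTop (𝓝 (κ ε)) := fun ε =>
    tendsto_conv_neg R.q_pos R.q_lt_one hs hγ0 hc hd (R.z_ne ε) ht
  -- The convolution is a multiple of the asymptotic solution, so its data are multiples of
  -- `l`, `l'`.
  have heq : ∀ ε n, cv ε n = κ ε * f ε n := fun ε =>
    (hf ε).eq_mul_of_tendsto h (hcv ε) hγ0 hγ1 (hf1 ε) (hcv1 ε)
  have hl : ∀ ε, κ ε * l ε = convSum R.q (R.s p) γ p.a p.b p.c p.d (R.z ε) 0 := fun ε =>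
    tendsto_nhds_unique (((hf0 ε).1.const_mul (κ ε)).congr fun n => (heq ε n).symm)
      (tendsto_conv R.q_pos R.q_lt_one hs hγ0 ha hb hc hd (R.z_ne ε) h.s_sq ht he)
  have hl' : ∀ ε, κ ε * l' ε = (R.q * γ / R.s p - R.q) / (1 - R.q) *
      convSum R.q (R.s p) γ p.a p.b p.c p.d (R.z ε) 1 := fun ε => by
    refine tendsto_nhds_unique (((hf0 ε).2.const_mul (κ ε)).congr fun n => ?_)
      (tendsto_conv_deriv R.q_pos R.q_lt_one hs hγ0 ha hb hc hd (R.z_ne ε) h.s_sq ht he)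
    have e1 := heq ε n
    have e2 := heq ε (n + 1)
    simp only [cv] at e1 e2
    rw [e1, e2, hDq, node]
    ring
  have he1 := norm_lt_of_lt_sq R.q_pos R.q_lt_one he
  have hE : qPochInf R.q (R.q * γ / R.s p) ≠ 0 :=
    qPochInf_ne_zero_of_norm_lt_one R.q_pos R.q_lt_one (he1.trans R.q_lt_one)
  have hT : qPochInf R.q (R.s p * γ) ≠ 0 :=
    qPochInf_ne_zero_of_norm_lt_one R.q_pos R.q_lt_one ht
  have hG := qPochInf_q_mul_sq_ne hγ
  have hQ := qPochInf_q_ne_zero R.q_pos R.q_lt_one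
  -- The factor `K` is evaluated by the `q`-binomial theorem.
  have hK : K * qPochInf R.q (R.s p * γ) * qPochInf R.q (R.q * γ / R.s p) =
      qPochInf R.q (R.q * γ ^ 2) * qPochInf R.q R.q := by
    have := qPochInf_mul_tsum_ker R.q_pos R.q_lt_one he1 ht
    rw [← hKdef, show R.q * γ / R.s p * (R.s p * γ) = R.q * γ ^ 2 by field_simp] at this
    rw [← mul_div_assoc, eq_div_iff hE] at this
    linear_combination this
  have hK0 : K ≠ 0 := by
    intro h0
    rw [h0, zero_mul, zero_mul] at hK
    exact mul_ne_zero hG hQ hK.symm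
  have hdet := convSum_det h hγ0 ht he
  have hsplit : qPochInf R.q (γ / R.s p) =
      (1 - γ / R.s p) * qPochInf R.q (R.q * γ / R.s p) := by
    rw [qPochInf_eq R.q_pos R.q_lt_one, show γ / R.s p * R.q = R.q * γ / R.s p by ring]
  have hcp := theta_z_ne h.c_ne h.c_node true
  have hdp := theta_z_ne h.d_ne h.d_node true
  have hcm := theta_z_ne h.c_ne h.c_node false
  have hdm := theta_z_ne h.d_ne h.d_node false
  have l1 := hl true
  have l2 := hl false
  have l3 := hl' true
  have l4 := hl' false
  simp only [κ, z, if_true, if_false, Bool.false_eq_true] at l1 l2 l3 l4 hcp hdp hcm hdm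
  rw [hsplit] at hdet
  have hsq : R.s p ^ 2 * (p.a * p.b) = p.c * p.d * R.q := by
    rw [h.s_sq]
    field_simp
  simp only [v]
  generalize convSum R.q (R.s p) γ p.a p.b p.c p.d R.zp 1 = S1 at *
  generalize convSum R.q (R.s p) γ p.a p.b p.c p.d R.zp 0 = S0 at *
  generalize convSum R.q (R.s p) γ p.a p.b p.c p.d R.zm 1 = T1 at *
  generalize convSum R.q (R.s p) γ p.a p.b p.c p.d R.zm 0 = T0 at *
  generalize qPochInf R.q (p.c * R.q * γ / (p.a * R.s p)) = P1 at *
  generalize qPochInf R.q (p.d * R.q * γ / (p.a * R.s p)) = P2 at *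
  generalize qPochInf R.q (p.c * R.q * γ / (p.b * R.s p)) = P3 at *
  generalize qPochInf R.q (p.d * R.q * γ / (p.b * R.s p)) = P4 at *
  generalize qPochInf R.q (R.s p * γ) = T at *
  generalize qPochInf R.q (R.q * γ / R.s p) = E at *
  generalize qPochInf R.q (R.q * γ ^ 2) = G at *
  generalize qPochInf R.q R.q = Q at *
  generalize theta R.q (R.zm / R.zp) = θ₁ at *
  generalize theta R.q (p.a * p.b * R.s p * R.zm * R.zp / (R.q * γ)) = θ₂ at *
  generalize theta R.q (p.c * R.zp) = t1 at *
  generalize theta R.q (p.d * R.zp) = t2 at *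
  generalize theta R.q (p.c * R.zm) = t3 at *
  generalize theta R.q (p.d * R.zm) = t4 at *
  generalize R.s p = s at *
  have hKe : K = G * Q / (T * E) := by
    field_simp
    linear_combination hK
  have hγs : (1 - γ / s) * (S1 * T0 - S0 * T1) = P1 * P2 * (P3 * P4) *
      (p.a * p.b * s * R.zp / (R.q ^ 2 * γ) * Q ^ 2 * (θ₁ * θ₂)) / (E * T) := by
    rw [← hdet]
    field_simp
  have r1 : l true = S0 / (t1 * t2 * K) := by rw [← l1]; field_simp
  have r2 : l false = T0 / (t3 * t4 * K) := by rw [← l2]; field_simp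
  have r3 : l' true = (R.q * γ / s - R.q) / (1 - R.q) * S1 / (t1 * t2 * K) := by
    rw [← l3]; field_simp
  have r4 : l' false = (R.q * γ / s - R.q) / (1 - R.q) * T1 / (t3 * t4 * K) := by
    rw [← l4]; field_simp
  have e1 : (1 - R.q) ^ 2 * s / (p.c * p.d) * (l' true * l false - l true * l' false) =
      -((1 - R.q) * s * R.q / (p.c * p.d)) * ((1 - γ / s) * (S1 * T0 - S0 * T1)) /
        (t1 * t2 * t3 * t4 * K ^ 2) := by
    rw [r1, r2, r3, r4]
    field_simp
    ring
  have e2 : s / (p.c * p.d) = R.q / (s * (p.a * p.b)) := by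
    rw [div_eq_div_iff (mul_ne_zero hc hd) (mul_ne_zero hs (mul_ne_zero ha hb))]
    linear_combination hsq
  rw [e1, hγs, hKe, show (1 - R.q) * s * R.q / (p.c * p.d) =
    (1 - R.q) * R.q * (s / (p.c * p.d)) by ring, e2]
  field_simp

/-! ### Analytic continuation in `γ` -/

lemma differentiableOn_v (h : R.Nondegenerate p) : DifferentiableOn ℂ (R.v p) R.Sreg := by
  intro γ hγ
  have hP := differentiable_qPochInf R.q_pos R.q_lt_one
  have ha := h.a_ne
  have hb := h.b_ne
  have hs := h.s_ne
  have hq := R.q_ne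
  have hγ0 := hγ.1
  have hG := qPochInf_q_mul_sq_ne hγ
  have hu : p.a * p.b * R.s p * R.zm * R.zp / (R.q * γ) ≠ 0 :=
    div_ne_zero (mul_ne_zero (mul_ne_zero (mul_ne_zero (mul_ne_zero ha hb) hs) (R.z_ne false))
      (R.z_ne true)) (mul_ne_zero hq hγ0)
  have dθ : DifferentiableAt ℂ
      (fun γ => theta R.q (p.a * p.b * R.s p * R.zm * R.zp / (R.q * γ))) γ :=
    DifferentiableAt.comp (g := theta R.q)
      (f := fun γ => p.a * p.b * R.s p * R.zm * R.zp / (R.q * γ)) γ (differentiableAt_theta hu)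
      (DifferentiableAt.fun_div (by fun_prop) (by fun_prop) (mul_ne_zero hq hγ0))
  have dP : ∀ {F : ℂ → ℂ}, Differentiable ℂ F →
      DifferentiableAt ℂ (fun γ => qPochInf R.q (F γ)) γ :=
    fun hF => (hP.comp hF) γ
  refine DifferentiableAt.differentiableWithinAt (DifferentiableAt.const_mul (DifferentiableAt.div
    (((((((dP ?_).mul (dP ?_)).mul (dP ?_)).mul (dP ?_)).mul (dP ?_)).mul (dP ?_)).mul dθ)
    (differentiableAt_id.mul ((dP ?_).pow 2)) (mul_ne_zero hγ0 (pow_ne_zero 2 hG))) _)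
  all_goals fun_prop

/-- The Casorati determinant of the two asymptotic solutions, for all regular `γ`. -/
lemma det_eq_v (h : R.Nondegenerate p) {f : Bool → ℂ → ℤ → ℂ} {l l' : Bool → ℂ → ℂ}
    (hl : ∀ ε, DifferentiableOn ℂ (l ε) R.Sreg) (hl' : ∀ ε, DifferentiableOn ℂ (l' ε) R.Sreg)
    (hf : ∀ ε, ∀ γ ∈ R.Sreg, R.IsHalfSol p ε (mu γ) (f ε γ))
    (hf0 : ∀ ε, ∀ γ ∈ R.Sreg, R.HasDataAtZero ε (f ε γ) (l ε γ) (l' ε γ))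
    (hf1 : ∀ ε, ∀ γ ∈ R.Sreg, Tendsto (fun k : ℕ => f ε γ (-k) / (R.s p * γ) ^ k) atTop (𝓝 1))
    (hγ : γ ∈ R.Sreg) :
    (1 - R.q) ^ 2 * R.s p / (p.c * p.d) * (l' true γ * l false γ - l true γ * l' false γ) =
      R.v p γ := by
  have small : ∀ᶠ γ in 𝓝 (0 : ℂ), ‖γ‖ < 1 ∧ ‖R.s p * γ‖ < 1 ∧ ‖R.q * γ / R.s p‖ < R.q ^ 2 := by
    have c : ∀ {F : ℂ → ℂ} {r : ℝ}, Continuous F → F 0 = 0 → 0 < r → ∀ᶠ γ in 𝓝 (0 : ℂ), ‖F γ‖ < r :=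
      fun {F r} hF h0 hr => (hF.norm.tendsto 0).eventually (gt_mem_nhds (by simpa [h0] using hr))
    exact (c continuous_id rfl one_pos).and ((c (by fun_prop) (by simp) one_pos).and
      (c (by fun_prop) (by simp) (pow_pos R.q_pos 2)))
  obtain ⟨W, hW, hWo, hW0⟩ := eventually_nhds_iff.1 small
  obtain ⟨δ, hδ, hball⟩ := Metric.isOpen_iff.1 hWo 0 hW0
  -- A point of `S_reg` near the origin: the excluded points are real.
  have hγ₀ : ((δ / 2 : ℝ) : ℂ) * Complex.I ∈ R.Sreg := ofReal_mul_I_mem_Sreg (by positivity)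
  have hγ₀W : ((δ / 2 : ℝ) : ℂ) * Complex.I ∈ W := by
    refine hball ?_
    rw [mem_ball_zero_iff, norm_mul, Complex.norm_I, Complex.norm_real, mul_one, Real.norm_eq_abs,
      abs_of_pos (by positivity)]
    linarith
  refine AnalyticOnNhd.eqOn_of_preconnected_of_eventuallyEq
    (f := fun γ => (1 - R.q) ^ 2 * R.s p / (p.c * p.d) *
      (l' true γ * l false γ - l true γ * l' false γ))
    (DifferentiableOn.analyticOnNhd ?_ isOpen_Sreg)
    ((differentiableOn_v h).analyticOnNhd isOpen_Sreg) isPreconnected_Sreg hγ₀ ?_ hγ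
  · exact (((hl' true).mul (hl false)).sub ((hl true).mul (hl' false))).const_mul _
  · filter_upwards [hWo.mem_nhds hγ₀W, isOpen_Sreg.mem_nhds hγ₀] with γ hγW hγ
    obtain ⟨h1, h2, h3⟩ := hW γ hγW
    exact det_eq_v_of_small h hγ h1 h2 h3 (f := fun ε => f ε γ) (l := fun ε => l ε γ)
      (l' := fun ε => l' ε γ) (fun ε => hf ε γ hγ) (fun ε => hf0 ε γ hγ) (fun ε => hf1 ε γ hγ)

/-! ### Uniqueness of the extended asymptotic solutions -/

/-- Far from the origin, the explicit formula applies. -/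
lemma eventually_formula_applies (ε : Bool) (γ : ℂ) :
    ∀ᶠ k : ℕ in atTop, R.q / ‖p.b‖ < |(R.pt ε (-k) : ℝ)| ∧
      ∀ n : ℕ, (R.q : ℂ) ^ 2 * γ / (p.a * R.s p * ((R.pt ε (-k) : ℝ) : ℂ)) * (R.q : ℂ) ^ n ≠ 1 := by
  have t := (tendsto_mul_q_pow R.q_pos R.q_lt_one (R.q ^ 2 * γ / (p.a * R.s p * R.z ε))).norm
  rw [norm_zero] at t
  filter_upwards [eventually_norm_lt_one p.b ε, t.eventually (gt_mem_nhds one_pos)] with k h1 h2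
  constructor
  · have hx : |(R.pt ε (-k) : ℝ)| = ‖R.node ε (-k)‖ := by
      rw [← coe_pt, Complex.norm_real, Real.norm_eq_abs]
    rw [hx]
    rw [norm_div, norm_mul, norm_q R.q_pos, ← div_div,
      div_lt_one (norm_pos_iff.2 (R.node_ne _ _))] at h1
    exact h1
  · rw [coe_pt, node, div_mul_zpow_neg]
    exact mul_pow_ne_one_of_norm_lt_one R.q_pos R.q_lt_one h2

/-- Two extensions agree far out on their half-line, hence everywhere. -/
lemma IsExtendedAsymptoticSolution.unique (h : R.Nondegenerate p) {F G : R.Rq → ℂ}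
    (hF : R.IsExtendedAsymptoticSolution p ε γ F) (hG : R.IsExtendedAsymptoticSolution p ε γ G) :
    F = G := by
  obtain ⟨K, hK⟩ := eventually_atTop.1 (eventually_formula_applies (R := R) (p := p) ε γ)
  have e : ∀ k : ℕ, K ≤ k → F (R.pt ε (-k)) - G (R.pt ε (-k)) = 0 := by
    intro k hk
    rw [hF.2 k (hK k hk).1 (hK k hk).2, hG.2 k (hK k hk).1 (hK k hk).2, sub_self]
  funext x
  refine sub_eq_zero.1 (eq_zero_of_mem_V h (sub_mem_V hF.1 hG.1) (-((K + 1 : ℕ) : ℤ))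
    (ε := ε) (e _ (Nat.le_succ K)) ?_ x)
  rw [show -((K + 1 : ℕ) : ℤ) + 1 = -(K : ℤ) by push_cast; ring]
  exact e K le_rfl

end QLine

end BigQJacobi

open BigQJacobi QLine in
theorem mainTheorem6 (R : BigQJacobi.QLine) (p : BigQJacobi.Params) (hp : R.InPgen p) :
    ∃ Φ : Bool → ℂ → (R.Rq → ℂ),
      (∀ (ε : Bool) (x : R.Rq), ContinuousOn (fun γ : ℂ => Φ ε γ x) R.Sreg) ∧
      ∀ γ ∈ R.Sreg,
        (∀ ε : Bool, R.IsExtendedAsymptoticSolution p ε γ (Φ ε γ) ∧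
          ∀ f : R.Rq → ℂ, R.IsExtendedAsymptoticSolution p ε γ f → f = Φ ε γ) ∧
        (‖γ‖ < 1 → ∀ ε : Bool,
          R.JacksonIntegrable ε (fun x => (‖Φ ε γ x‖ : ℂ) ^ 2 * R.w p x)) ∧
        (∀ x : R.Rq, R.casorati p (Φ true γ) (Φ false γ) x = R.v p γ) := by
  have h := hp.nondegenerate
  choose f hfd hf using fun ε => exists_extension h ε
  have hsol : ∀ ε, ∀ γ ∈ R.Sreg, R.IsHalfSol p ε (mu γ) (f ε γ) := fun ε γ hγ => (hf ε γ hγ).1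
  choose l l' hl hl' hdata using fun ε =>
    exists_data h ε isOpen_Sreg differentiableOn_mu (hfd ε) (hsol ε)
  have hasym : ∀ ε, ∀ γ ∈ R.Sreg,
      Tendsto (fun k : ℕ => f ε γ (-k) / (R.s p * γ) ^ k) atTop (𝓝 1) := by
    intro ε γ hγ
    refine (tendsto_phiSol_neg R.q_pos R.q_lt_one h.s_ne hγ.1 (qPochInf_q_mul_sq_ne hγ) p.a p.b
      p.c p.d (R.z ε)).congr' ?_
    filter_upwards [eventually_norm_lt_one p.b ε] with k hk
    rw [(hf ε γ hγ).2 _ hk]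
    rfl
  -- The other half-line carries the solution with the same data at the origin.
  choose g hgd hg using fun ε =>
    exists_sol_of_data h (!ε) isOpen_Sreg differentiableOn_mu (hl ε) (hl' ε)
  let G : Bool → ℂ → Bool → ℤ → ℂ := fun ε γ ε' => if ε' = ε then f ε γ else g ε γ
  have hG : ∀ ε, ∀ γ ∈ R.Sreg, ∀ ε', R.IsHalfSol p ε' (mu γ) (G ε γ ε') ∧
      R.HasDataAtZero ε' (G ε γ ε') (l ε γ) (l' ε γ) := by
    intro ε γ hγ ε'
    by_cases hε : ε' = ε
    · subst hε
      simp only [G, if_true]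
      exact ⟨hsol _ γ hγ, hdata _ γ hγ⟩
    · obtain rfl : ε' = !ε := by cases ε <;> cases ε' <;> simp_all
      simp only [G, if_neg hε]
      exact hg ε γ hγ
  have hGf : ∀ ε γ n, R.glue (G ε γ) (R.pt ε n) = f ε γ n := fun ε γ n => by
    rw [glue_pt]
    simp only [G, if_true]
  have hV : ∀ ε, ∀ γ ∈ R.Sreg, R.glue (G ε γ) ∈ R.V p (mu γ) := by
    intro ε γ hγ
    refine mem_V_iff.2 ⟨fun ε' => ?_, l ε γ, l' ε γ, fun ε' => ?_⟩
    · simpa only [glue_pt] using (hG ε γ hγ ε').1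
    · simpa only [glue_pt] using (hG ε γ hγ ε').2
  have hext : ∀ ε, ∀ γ ∈ R.Sreg, R.IsExtendedAsymptoticSolution p ε γ (R.glue (G ε γ)) := by
    refine fun ε γ hγ => ⟨hV ε γ hγ, fun k hk hD => ?_⟩
    rw [hGf, ← phiSol_eq_PhiFormula R p ε γ k hD (mul_sq_mul_pow_ne_one hγ)]
    refine (hf ε γ hγ).2 _ ?_
    rw [norm_div, norm_mul, norm_q R.q_pos, ← div_div,
      div_lt_one (norm_pos_iff.2 (R.node_ne _ _)), ← coe_pt, Complex.norm_real, Real.norm_eq_abs]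
    exact hk
  refine ⟨fun ε γ => R.glue (G ε γ), fun ε x => ?_, fun γ hγ => ⟨fun ε => ⟨hext ε γ hγ,
    fun F hF => hF.unique h (hext ε γ hγ)⟩, fun hγ1 ε => ?_, fun x => ?_⟩⟩
  · obtain ⟨ε', n, rfl⟩ := R.exists_eq_pt x
    simp only [glue_pt, G]
    split_ifs
    · exact (hfd ε n).continuousOn
    · exact (hgd ε n).continuousOn
  · refine (summable_of_tendsto h (hdata ε γ hγ) hγ.1 hγ1 (hasym ε γ hγ)).congr fun k => ?_
    simp only [hGf, coe_pt, wn]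
  · obtain ⟨ε, n, rfl⟩ := R.exists_eq_pt x
    rw [casorati_pt]
    simp only [glue_pt]
    rw [h.hcas_eq_of_data (hG true γ hγ ε).1 (hG false γ hγ ε).1 (hG true γ hγ ε).2
      (hG false γ hγ ε).2]
    exact det_eq_v h hl hl' hsol hdata hasym hγ
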